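/- Let $Ai$, $Bi$ be the solutions of the Airy equation $w''(x)=x\,w(x)$ that equal $\sqrt{2\pi}$, respectively $\sqrt{\pi/2}$, times the classical Airy functions of the first and second kind, so that $Ai\,Bi'-Ai'\,Bi=1$. Let $$K(x,y)=\frac{Ai(x)\,Bi'(y)-Ai'(x)\,Bi(y)}{x-y}\qquad(x\ne y)$$ be the Airy kernel, and define the connected correlation functions by $W_1(x)=Ai'(x)\,Bi'(x)-x\,Ai(x)\,Bi(x)$ and, for $n\ge 2$ and pairwise distinct $x_1,\dots,x_n$, $$W_n(x_1,\dots,x_n)=-\frac{\delta_{n,2}}{(x_1-x_2)^2}-(-1)^n\sum_{\sigma}\prod_{i=1}^n K(x_i,x_{\sigma(i)}),$$ where $\sigma$ runs over the permutations of $\{1,\dots,n\}$ that consist of a single cycle of length $n$. **Theorem (the Airy kernel satisfies the exponential formula).** (i) The $W_n$ have a topological expansion: there are functions $W_n^{(g)}$ ($n\ge1$, $g\ge0$), continuous on $(0,\infty)^n$ (and then unique), such that for all pairwise distinct $x_1,\dots,x_n>0$, as $N\to+\infty$, $$N^{2n/3}\,W_n(N^{2/3}x_1,\dots,N^{2/3}x_n)\sim\sum_{g\ge0}N^{2-2g-n}\,W_n^{(g)}(x_1,\dots,x_n).$$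 (ii) The formula $$K(x,y)=\frac1{x-y}\exp\Big(\sum_{l\ge1}\frac1{l!}\int_y^x\!\!\cdots\!\int_y^x W_l\Big)$$ holds as an identity of formal asymptotic series, that is: for $x,y>0$, $x\neq y$, let $$U_k(x,y)=\sum_{\substack{l\ge1,\ g\ge0\\ 2g+l-2=k}}\frac1{l!}\int_y^x\!\!\cdots\!\int_y^x W_l^{(g)}(t_1,\dots,t_l)\,dt_1\cdots dt_l\qquad(k\ge-1)$$ (finite sums), and let $E_k(x,y)$ be the coefficients of the formal power series $\sum_{k\ge0}E_kT^k=\exp\big(\sum_{k\ge1}U_kT^k\big)$. Then, as $N\to+\infty$, $$N^{2/3}\,K(N^{2/3}x,N^{2/3}y)\sim\frac{e^{N\,U_{-1}(x,y)+U_0(x,y)}}{x-y}\sum_{k\ge0}E_k(x,y)\,N^{-k}.$$ In both parts $\sim$ denotes an asymptotic expansion to all orders in the sense of Poincaré. -/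

import Mathlib

open Filter Asymptotics Finset

noncomputable section

/-- The even-type Maclaurin solution of `w'' = x w`, with `w(0) = 1`, `w'(0) = 0`:
`∑ 1·4·7⋯(3k-2) x^{3k} / (3k)!`. -/
def airyF (x : ℝ) : ℝ :=
  ∑' k : ℕ, (∏ i ∈ range k, (3 * (i : ℝ) + 1)) * x ^ (3 * k) / ((3 * k).factorial : ℝ)

/-- The Maclaurin solution of `w'' = x w` with `w(0) = 0`, `w'(0) = 1`:
`∑ 2·5·8⋯(3k-1) x^{3k+1} / (3k+1)!`. -/
def airyG (x : ℝ) : ℝ :=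
  ∑' k : ℕ, (∏ i ∈ range k, (3 * (i : ℝ) + 2)) * x ^ (3 * k + 1) / ((3 * k + 1).factorial : ℝ)

/-- The Airy function, normalised so that `Ai x ∼ exp (-2/3 x^{3/2}) / (√2 x^{1/4})` as
`x → +∞`: it is `√(2π)` times the classical Airy function, whose initial values are
`3^{-2/3} / Γ(2/3)` and `-3^{-1/3} / Γ(1/3)`. -/
def airyAi (x : ℝ) : ℝ :=
  Real.sqrt (2 * Real.pi) *
    (airyF x / ((3 : ℝ) ^ (2 / 3 : ℝ) * Real.Gamma (2 / 3))
      - airyG x / ((3 : ℝ) ^ (1 / 3 : ℝ) * Real.Gamma (1 / 3)))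

/-- The second Airy function, normalised so that `Bi x ∼ exp (2/3 x^{3/2}) / (√2 x^{1/4})` as
`x → +∞`, whence `Ai Bi' - Ai' Bi = 1`: it is `√(π/2)` times the classical function, whose
initial values are `3^{-1/6} / Γ(2/3)` and `3^{1/6} / Γ(1/3)`. -/
def airyBi (x : ℝ) : ℝ :=
  Real.sqrt (Real.pi / 2) *
    (airyF x / ((3 : ℝ) ^ (1 / 6 : ℝ) * Real.Gamma (2 / 3))
      + airyG x * (3 : ℝ) ^ (1 / 6 : ℝ) / Real.Gamma (1 / 3))

/-- The Airy kernel (used at `x ≠ y` only). -/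
def airyKernel (x y : ℝ) : ℝ :=
  (airyAi x * deriv airyBi y - deriv airyAi x * airyBi y) / (x - y)

open Classical in
/-- The connected correlation functions `W_n` of the Airy system (used for `n ≥ 1`, at pairwise
distinct points). For `n ≥ 2` the sum runs over the permutations of the `n` indices that consist
of a single cycle of length `n`. -/
def airyW : (n : ℕ) → (Fin n → ℝ) → ℝ
  | 0, _ => 0
  | 1, x => deriv airyAi (x 0) * deriv airyBi (x 0) - x 0 * airyAi (x 0) * airyBi (x 0)
  | m + 2, x =>
      -(if m = 0 then 1 / (x 0 - x 1) ^ 2 else 0)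
        - (-1) ^ (m + 2) *
          ∑ σ : Equiv.Perm (Fin (m + 2)) with σ.IsCycle ∧ σ.support = univ,
            ∏ i, airyKernel (x i) (x (σ i))

/-- `f N ∼ ∑_{k ≥ 0} a k * N ^ (-k)` as `N → +∞`, in the sense of Poincaré. -/
def HasAsymptoticSeries (f : ℝ → ℝ) (a : ℕ → ℝ) : Prop :=
  ∀ m : ℕ, (fun N : ℝ => f N - ∑ k ∈ range m, a k * N ^ (-(k : ℤ)))
    =O[atTop] fun N : ℝ => N ^ (-(m : ℤ))

/-- The family `ω g n = W_n^{(g)}` is the topological expansion of the Airy correlation functions: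
the `ω g n` are continuous on the open positive orthant, and at pairwise distinct positive points,
as `N → +∞`,
`N^{2n/3} W_n(N^{2/3} x_1, …, N^{2/3} x_n) ∼ ∑_{g ≥ 0} N^{2-2g-n} W_n^{(g)}(x_1, …, x_n)`.
Such a family is unique on the positive orthants for `n ≥ 1`. -/
def IsTopologicalExpansion (ω : ℕ → (n : ℕ) → (Fin n → ℝ) → ℝ) : Prop :=
  ∀ n : ℕ, 1 ≤ n →
    (∀ g : ℕ, ContinuousOn (ω g n) {x | ∀ i, 0 < x i}) ∧
    ∀ x : Fin n → ℝ, (∀ i, 0 < x i) → Function.Injective x → ∀ G : ℕ,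
      (fun N : ℝ => N ^ (2 * (n : ℝ) / 3) * airyW n (fun i => N ^ (2 / 3 : ℝ) * x i)
          - ∑ g ∈ range G, N ^ (2 - 2 * (g : ℤ) - (n : ℤ)) * ω g n x)
        =O[atTop] fun N : ℝ => N ^ (2 - 2 * (G : ℤ) - (n : ℤ))

/-- The `n`-fold iterated integral `∫_y^x ⋯ ∫_y^x F(t_1, …, t_n) dt_n ⋯ dt_1`. -/
def iteratedIntegral (y x : ℝ) : (n : ℕ) → ((Fin n → ℝ) → ℝ) → ℝ
  | 0, F => F Fin.elim0
  | n + 1, F => ∫ t in y..x, iteratedIntegral y x n (fun v => F (Fin.cons t v))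

/-- The coefficient of `N^{1-j}` in the formal series
`∑_{l ≥ 1} ∑_{g ≥ 0} N^{2-2g-l} (1/l!) ∫_y^x ⋯ ∫_y^x W_l^{(g)}`;
the finitely many pairs `(g, l)` that contribute are those with `l ≥ 1` and `2g + l = j + 1`. -/
def exponentCoeff (ω : ℕ → (n : ℕ) → (Fin n → ℝ) → ℝ) (x y : ℝ) (j : ℕ) : ℝ :=
  ∑ p ∈ range (j + 2) ×ˢ range (j + 2) with 1 ≤ p.2 ∧ 2 * p.1 + p.2 = j + 1,
    (1 / (p.2.factorial : ℝ)) * iteratedIntegral y x p.2 (ω p.1 p.2)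

/-- The part of the exponent with negative powers of `N`, as a formal power series in `1/N`. -/
def exponentTail (ω : ℕ → (n : ℕ) → (Fin n → ℝ) → ℝ) (x y : ℝ) : PowerSeries ℝ :=
  PowerSeries.mk fun k => if k = 0 then 0 else exponentCoeff ω x y (k + 1)

/-- The exponential of `exponentTail` makes sense, its constant coefficient being zero. -/
theorem hasSubst_exponentTail (ω : ℕ → (n : ℕ) → (Fin n → ℝ) → ℝ) (x y : ℝ) :
    PowerSeries.HasSubst (exponentTail ω x y) :=
  PowerSeries.HasSubst.of_constantCoeff_zero' (by
    rw [← PowerSeries.coeff_zero_eq_constantCoeff_apply]; simp [exponentTail])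

/-- The formal power series `exp (∑_{k ≥ 1} U_k N^{-k})` in `1/N`, where `U_k` is the coefficient
of `N^{-k}` in the exponent. -/
def expTail (ω : ℕ → (n : ℕ) → (Fin n → ℝ) → ℝ) (x y : ℝ) : PowerSeries ℝ :=
  (PowerSeries.exp ℝ).subst (exponentTail ω x y)

end

/-! Rescale so that ħ = 1/N plays the role of a Planck constant, and let a, b be the scaled
logarithmic derivatives of Ai and Bi. Both solve the Riccati equation ħ w' + w² = x, and the
Wronskian gives f = 1/(b - a) for the scaled product of Ai and Bi. Up to conjugation by Ai(x)/Ai(y),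
which no cycle sees, the kernel is k(x,y) = f(y)(b(y) - a(x))/(x - y). So everything is algebra in a
and b.

The algebra rests on an insertion operator. Replace x by x + u and let d = ∂/∂u. The infinitesimal
change u → u + 2ε d f(z) carries a(x) to a(x) + ε d(f(z)(a(x) - a(z))/(x - z)), and b likewise, and
the result again solves the Riccati equation (`riccati_variation_a`); over dual numbers it is a new
system of the same kind, so insertions can be iterated. For its derivative δ_z one finds ħ δ_z
k(x,y) = -k(x,z)k(z,y) + k(x,y)(k(x,z) - k(y,z)) (`h_mul_im_k`). Around a cycle the last term
telescopes and the first inserts z, hence ħ δ_z W_n = W_{n+1} for n ≥ 2. Therefore W_n is ħ^(n-2)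
times an iterated variation of the regular two-point function (`X_pow_mul_evS_topCoeff_w`). The
symmetry ħ → -ħ exchanges a with -b and transposes the kernel, so only every second power of ħ
survives. Continuity at coinciding points comes from antisymmetry: multiplied by a Vandermonde
product, a cycle sum becomes an antisymmetric polynomial in the x_i^(-1/2), which absorbs all the
poles (`exists_extension_cycleSum`).

For the exponential formula, let τ(z;x,y) be ħ δ_z of the logarithm of the numerator of the kernel.
It vanishes at x = y, its x-derivative is W_2(z,x) + ħ δ_z τ(x;x,y), where τ(x;x,y) is its limit as
z → x, and ħ ∂_x of the logarithm of the numerator is W_1(x) + ħ τ(x;x,y). The sums of iterated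
integrals of the symmetric functions W_l obey the same recursion, so induction on the order in ħ,
with arbitrarily many points inserted, identifies the two (`tauCoeff_eq_tauSum`,
`hasDerivAt_expSum`).

Analysis enters only to show that the formal series are the true expansions. The difference between
Bi'/Bi and a truncation solves an equation with damping; the same difference for Ai Bi solves one
with growth, controlled from infinity because Ai/Bi → 0. That limit is where the Gamma values in the
definition of Ai are used. The expansions are uniform on compact sets, so the logarithmic derivative
of the kernel can be integrated from y to x and the result exponentiated. -/

noncomputable section

/-! ### Dual numbers -/

section DualNumbers
open TrivSqZeroExt
variable {R : Type} [CommRing R]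

theorem DualNumber.snd_mul' (p q : DualNumber R) :
    (p * q).snd = p.fst * q.snd + p.snd * q.fst := by
  simp [TrivSqZeroExt.snd_mul, mul_comm]

theorem DualNumber.fst_inverse {p : DualNumber R} (hp : IsUnit p) :
    (Ring.inverse p).fst = Ring.inverse p.fst := by
  have h1 : IsUnit p.fst := isUnit_iff_isUnit_fst.1 hp
  have h := congrArg TrivSqZeroExt.fst (Ring.mul_inverse_cancel p hp)
  simp only [fst_mul, fst_one] at h
  exact (h1.mul_left_cancel (h.trans (Ring.mul_inverse_cancel _ h1).symm))

theorem DualNumber.snd_inverse {p : DualNumber R} (hp : IsUnit p) :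
    (Ring.inverse p).snd = -(Ring.inverse p.fst ^ 2 * p.snd) := by
  have h1 : IsUnit p.fst := isUnit_iff_isUnit_fst.1 hp
  have h := congrArg TrivSqZeroExt.snd (Ring.mul_inverse_cancel p hp)
  have h2 := Ring.mul_inverse_cancel _ h1
  simp only [DualNumber.snd_mul', snd_one, DualNumber.fst_inverse hp] at h
  apply h1.mul_left_cancel
  linear_combination h + (Ring.inverse p.fst * p.snd) * h2

/-- The inverse of p + qε is p⁻¹ - p⁻²qε, and this formula holds in a whole neighbourhood because
units are open. It lets the topological axioms of `AirySystem` pass to dual numbers. -/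
theorem DualNumber.continuousAt_inverse [TopologicalSpace R] [IsTopologicalRing R]
    (hR : ∀ r : R, IsUnit r → ContinuousAt Ring.inverse r)
    (hU : ∀ r : R, IsUnit r → ∀ᶠ s in nhds r, IsUnit s)
    (p : DualNumber R) (hp : IsUnit p) : ContinuousAt Ring.inverse p := by
  have h1 : IsUnit p.fst := isUnit_iff_isUnit_fst.1 hp
  have hfst : ContinuousAt (fun q : DualNumber R => q.fst) p := TrivSqZeroExt.continuous_fst.continuousAt
  have hsnd : ContinuousAt (fun q : DualNumber R => q.snd) p := TrivSqZeroExt.continuous_snd.continuousAt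
  have hi : ContinuousAt (fun q : DualNumber R => Ring.inverse q.fst) p :=
    ContinuousAt.comp (f := fun q : DualNumber R => q.fst) (hR _ h1) hfst
  have hev : (fun q : DualNumber R => (inl (Ring.inverse q.fst) : DualNumber R) -
      inr (Ring.inverse q.fst ^ 2 * q.snd)) =ᶠ[nhds p] Ring.inverse := by
    filter_upwards [hfst.eventually (hU _ h1)] with q hq
    have hq' : IsUnit q := isUnit_iff_isUnit_fst.2 hq
    refine TrivSqZeroExt.ext ?_ ?_
    · simp [DualNumber.fst_inverse hq']
    · simp [DualNumber.snd_inverse hq']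
  refine ContinuousAt.congr ?_ hev
  exact (TrivSqZeroExt.continuous_inl.continuousAt.comp hi).sub
    (TrivSqZeroExt.continuous_inr.continuousAt.comp ((hi.pow 2).mul hsnd))

end DualNumbers

/-! ### Pairs of Riccati solutions and their divided differences -/

/-- An abstract solution of the Airy system: two solutions `a x`, `b x` of the Riccati equation
`h w' + w² = x + u`, for `x` in an open set of real parameters, over a topological ring with a
derivation `d`. -/
structure AirySystem where
  /-- the ring of values -/
  R : Type
  [ring : CommRing R]
  [alg : Algebra ℝ R]
  [top : TopologicalSpace R]
  [topRing : IsTopologicalRing R]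
  [contSMul : ContinuousSMul ℝ R]
  [t2 : T2Space R]
  continuousAt_inverse : ∀ r : R, IsUnit r → ContinuousAt Ring.inverse r
  isUnit_nhds : ∀ r : R, IsUnit r → ∀ᶠ s in nhds r, IsUnit s
  /-- the derivation -/
  d : R →ₗ[ℝ] R
  d_mul : ∀ p q, d (p * q) = p * d q + d p * q
  continuous_d : Continuous d
  /-- the admissible parameters -/
  G : Set ℝ
  isOpen_G : IsOpen G
  /-- the formal Planck constant -/
  h : R
  d_h : d h = 0
  h_mul_cancel : ∀ p q : R, h * p = h * q → p = q
  /-- the potential -/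
  u : R
  /-- the first solution -/
  a : ℝ → R
  /-- the second solution -/
  b : ℝ → R
  /-- the derivative of the first solution with respect to the parameter -/
  a' : ℝ → R
  isUnit_sub : ∀ x ∈ G, ∀ y ∈ G, IsUnit (b y - a x)
  riccati_a : ∀ x ∈ G, h * d (a x) + a x ^ 2 = algebraMap ℝ R x + u
  riccati_b : ∀ x ∈ G, h * d (b x) + b x ^ 2 = algebraMap ℝ R x + u
  slope_a : ∀ x ∈ G, Tendsto (slope a x) (nhdsWithin x {x}ᶜ) (nhds (a' x))
  continuousAt_b : ∀ x ∈ G, ContinuousAt b x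

namespace AirySystem

attribute [instance] ring alg top topRing contSMul t2

variable (S : AirySystem)

/-- The inverse of `b y - a x`. -/
def r (x y : ℝ) : S.R := Ring.inverse (S.b y - S.a x)

/-- The diagonal Green function. -/
def f (x : ℝ) : S.R := S.r x x

/-- The divided difference of `a`. -/
def da (x z : ℝ) : S.R := (x - z)⁻¹ • (S.a x - S.a z)

/-- The divided difference of `b`. -/
def db (x z : ℝ) : S.R := (x - z)⁻¹ • (S.b x - S.b z)

/-- The kernel. -/
def k (x y : ℝ) : S.R := (x - y)⁻¹ • (S.f y * (S.b y - S.a x))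

variable {S}

theorem r_mul {x y : ℝ} (hx : x ∈ S.G) (hy : y ∈ S.G) : S.r x y * (S.b y - S.a x) = 1 :=
  Ring.inverse_mul_cancel _ (S.isUnit_sub x hx y hy)

theorem f_mul {x : ℝ} (hx : x ∈ S.G) : S.f x * (S.b x - S.a x) = 1 := r_mul hx hx

theorem d_one : S.d 1 = 0 := by
  have h := S.d_mul 1 1
  rw [mul_one, one_mul, mul_one] at h
  exact left_eq_add.1 h

theorem d_h_mul (p : S.R) : S.d (S.h * p) = S.h * S.d p := by
  rw [S.d_mul, S.d_h, zero_mul, add_zero]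

theorem sub_mul_da {x z : ℝ} (h : x ≠ z) :
    (algebraMap ℝ S.R x - algebraMap ℝ S.R z) * S.da x z = S.a x - S.a z := by
  rw [da, Algebra.smul_def, ← mul_assoc, ← map_sub, ← map_mul, mul_inv_cancel₀ (sub_ne_zero.2 h),
    map_one, one_mul]

theorem sub_mul_db {x z : ℝ} (h : x ≠ z) :
    (algebraMap ℝ S.R x - algebraMap ℝ S.R z) * S.db x z = S.b x - S.b z := by
  rw [db, Algebra.smul_def, ← mul_assoc, ← map_sub, ← map_mul, mul_inv_cancel₀ (sub_ne_zero.2 h),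
    map_one, one_mul]

theorem sub_cancel {x z : ℝ} (h : x ≠ z) {p q : S.R}
    (hpq : (algebraMap ℝ S.R x - algebraMap ℝ S.R z) * p
      = (algebraMap ℝ S.R x - algebraMap ℝ S.R z) * q) : p = q := by
  have hu : IsUnit (algebraMap ℝ S.R x - algebraMap ℝ S.R z) := by
    rw [← map_sub]
    exact (IsUnit.mk0 _ (sub_ne_zero.2 h)).map _
  exact hu.mul_left_cancel hpq

/-- Differentiate f(b - a) = 1; the difference of the two Riccati equations is h(b' - a') = -(b -
a)(b + a), primes being `d`. -/
theorem h_mul_d_f {x : ℝ} (hx : x ∈ S.G) :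
    S.h * S.d (S.f x) = S.f x * (S.a x + S.b x) := by
  have h1 := f_mul hx
  have h2 : S.d (S.f x * (S.b x - S.a x)) = 0 := by rw [h1, d_one]
  rw [S.d_mul, map_sub] at h2
  have ha := S.riccati_a x hx
  have hb := S.riccati_b x hx
  have h3 : S.h * S.d (S.f x) * (S.b x - S.a x) = S.f x * (S.a x + S.b x) * (S.b x - S.a x) := by
    linear_combination S.h * h2 - S.f x * hb + S.f x * ha
  have h4 := congrArg (· * S.f x) h3
  linear_combination h4 - (S.h * S.d (S.f x) - S.f x * (S.a x + S.b x)) * h1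

/-- Subtract the Riccati equations at x and z and divide by x - z, a unit: the potential cancels and
leaves the constant 1. -/
theorem h_mul_d_da {x z : ℝ} (hx : x ∈ S.G) (hz : z ∈ S.G) (h : x ≠ z) :
    S.h * S.d (S.da x z) = 1 - (S.a x + S.a z) * S.da x z := by
  have ha := S.riccati_a x hx
  have hb := S.riccati_a z hz
  apply sub_cancel h
  have h1 := sub_mul_da (S := S) h
  have h2 : (algebraMap ℝ S.R x - algebraMap ℝ S.R z) * S.d (S.da x z)
      = S.d (S.a x) - S.d (S.a z) := by
    rw [da, map_smul, map_sub, Algebra.smul_def, ← mul_assoc, ← map_sub, ← map_mul,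
      mul_inv_cancel₀ (sub_ne_zero.2 h), map_one, one_mul]
  linear_combination S.h * h2 + ha - hb + (S.a x + S.a z) * h1

theorem h_mul_d_db {x z : ℝ} (hx : x ∈ S.G) (hz : z ∈ S.G) (h : x ≠ z) :
    S.h * S.d (S.db x z) = 1 - (S.b x + S.b z) * S.db x z := by
  have ha := S.riccati_b x hx
  have hb := S.riccati_b z hz
  apply sub_cancel h
  have h1 := sub_mul_db (S := S) h
  have h2 : (algebraMap ℝ S.R x - algebraMap ℝ S.R z) * S.d (S.db x z)
      = S.d (S.b x) - S.d (S.b z) := by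
    rw [db, map_smul, map_sub, Algebra.smul_def, ← mul_assoc, ← map_sub, ← map_mul,
      mul_inv_cancel₀ (sub_ne_zero.2 h), map_one, one_mul]
  linear_combination S.h * h2 + ha - hb + (S.b x + S.b z) * h1

/-- The variation of `a x` under an insertion at `z`. -/
theorem h_mul_d_f_mul_da {x z : ℝ} (hx : x ∈ S.G) (hz : z ∈ S.G) (h : x ≠ z) :
    S.h * S.d (S.f z * S.da x z) = S.f z * (1 + (S.b z - S.a x) * S.da x z) := by
  rw [S.d_mul]
  linear_combination S.f z * h_mul_d_da hx hz h + S.da x z * h_mul_d_f hz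

/-- The variation of `b x` under an insertion at `z`. -/
theorem h_mul_d_f_mul_db {x z : ℝ} (hx : x ∈ S.G) (hz : z ∈ S.G) (h : x ≠ z) :
    S.h * S.d (S.f z * S.db x z) = S.f z * (1 + (S.a z - S.b x) * S.db x z) := by
  rw [S.d_mul]
  linear_combination S.f z * h_mul_d_db hx hz h + S.db x z * h_mul_d_f hz

/-- This is the Riccati equation linearised at a(x), with δa = d(f(z) da(x,z)) and δu = 2 d f(z). It
is what makes an insertion a deformation of solutions. Multiplying by h removes second derivatives:
h d of each ingredient is a polynomial in a, b, f and divided differences. -/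
theorem riccati_variation_a {x z : ℝ} (hx : x ∈ S.G) (hz : z ∈ S.G) (h : x ≠ z) :
    S.h * S.d (S.d (S.f z * S.da x z)) + 2 * S.a x * S.d (S.f z * S.da x z) = 2 * S.d (S.f z) := by
  apply S.h_mul_cancel
  have h1 := h_mul_d_f_mul_da hx hz h
  have h2 : S.h * S.d (S.d (S.f z * S.da x z)) =
      S.d (S.f z * (1 + (S.b z - S.a x) * S.da x z)) := by
    rw [← h1, d_h_mul]
  rw [S.d_mul (S.f z) (1 + _), map_add, d_one, S.d_mul (_ - _), map_sub] at h2
  have h3 := h_mul_d_f hz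
  have h4 := h_mul_d_da hx hz h
  have h5 := sub_mul_da (S := S) h
  linear_combination S.h * h2 + 2 * S.a x * h1 + (1 + (S.b z - S.a x) * S.da x z - 2) * h3
    + S.f z * (S.b z - S.a x) * h4 + S.f z * S.da x z * (S.riccati_b z hz - S.riccati_a x hx)
    - S.f z * h5

theorem riccati_variation_b {x z : ℝ} (hx : x ∈ S.G) (hz : z ∈ S.G) (h : x ≠ z) :
    S.h * S.d (S.d (S.f z * S.db x z)) + 2 * S.b x * S.d (S.f z * S.db x z) = 2 * S.d (S.f z) := by
  apply S.h_mul_cancel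
  have h1 := h_mul_d_f_mul_db hx hz h
  have h2 : S.h * S.d (S.d (S.f z * S.db x z)) =
      S.d (S.f z * (1 + (S.a z - S.b x) * S.db x z)) := by
    rw [← h1, d_h_mul]
  rw [S.d_mul (S.f z) (1 + _), map_add, d_one, S.d_mul (_ - _), map_sub] at h2
  have h3 := h_mul_d_f hz
  have h4 := h_mul_d_db hx hz h
  have h5 := sub_mul_db (S := S) h
  linear_combination S.h * h2 + 2 * S.b x * h1 + (1 + (S.a z - S.b x) * S.db x z - 2) * h3
    + S.f z * (S.a z - S.b x) * h4 + S.f z * S.db x z * (S.riccati_a z hz - S.riccati_b x hx)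
    - S.f z * h5

end AirySystem

/-! ### Infinitesimal insertion of a point -/

namespace AirySystem
open TrivSqZeroExt

variable (S : AirySystem)

/-- The coefficientwise extension of a linear map to dual numbers. -/
def dualMap (R : Type) [CommRing R] [Algebra ℝ R] (d : R →ₗ[ℝ] R) :
    DualNumber R →ₗ[ℝ] DualNumber R where
  toFun p := inl (d p.fst) + inr (d p.snd)
  map_add' p q := by ext <;> simp
  map_smul' c p := by ext <;> simp

theorem slope_da {x y z : ℝ} (hyx : y ≠ x) (hyz : y ≠ z) (hxz : x ≠ z) :
    slope (fun y => S.da y z) x y = (y - z)⁻¹ • (slope S.a x y - S.da x z) := by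
  have h1 : y - x ≠ 0 := sub_ne_zero.2 hyx
  have h2 : y - z ≠ 0 := sub_ne_zero.2 hyz
  have h3 : x - z ≠ 0 := sub_ne_zero.2 hxz
  simp only [slope, vsub_eq_sub, da]
  match_scalars <;> field_simp <;> ring

theorem tendsto_slope_da {x z : ℝ} (hx : x ∈ S.G) (hxz : x ≠ z) :
    Tendsto (slope (fun y => S.da y z) x) (nhdsWithin x {x}ᶜ)
      (nhds ((x - z)⁻¹ • (S.a' x - S.da x z))) := by
  have h1 : Tendsto (fun y : ℝ => (y - z)⁻¹) (nhdsWithin x {x}ᶜ) (nhds (x - z)⁻¹) := by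
    have : ContinuousAt (fun y : ℝ => (y - z)⁻¹) x :=
      ContinuousAt.inv₀ (by fun_prop) (sub_ne_zero.2 hxz)
    exact this.tendsto.mono_left nhdsWithin_le_nhds
  have h2 := h1.smul ((S.slope_a x hx).sub_const (S.da x z))
  refine h2.congr' ?_
  filter_upwards [self_mem_nhdsWithin, nhdsWithin_le_nhds (isOpen_ne.mem_nhds hxz)] with y hy hy'
  exact (S.slope_da hy hy' hxz).symm

/-- The infinitesimal insertion of the point `z`. -/
def step (z : ℝ) : AirySystem where
  R := DualNumber S.R
  continuousAt_inverse :=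
    DualNumber.continuousAt_inverse S.continuousAt_inverse S.isUnit_nhds
  isUnit_nhds p hp := by
    have h1 : IsUnit p.fst := isUnit_iff_isUnit_fst.1 hp
    have hfst : ContinuousAt (fun q : DualNumber S.R => q.fst) p :=
      TrivSqZeroExt.continuous_fst.continuousAt
    filter_upwards [hfst.eventually (S.isUnit_nhds _ h1)] with q hq
    exact isUnit_iff_isUnit_fst.2 hq
  d := dualMap S.R S.d
  d_mul p q := by
    ext
    · simp [dualMap, S.d_mul]
    · simp only [dualMap, LinearMap.coe_mk, AddHom.coe_mk, DualNumber.snd_mul', snd_add, snd_inl,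
        snd_inr, fst_add, fst_inl, fst_inr, map_add, S.d_mul]
      ring
  continuous_d :=
    (TrivSqZeroExt.continuous_inl.comp (S.continuous_d.comp TrivSqZeroExt.continuous_fst)).add
      (TrivSqZeroExt.continuous_inr.comp (S.continuous_d.comp TrivSqZeroExt.continuous_snd))
  -- Admissibility of z is stored in the parameter set, so z itself needs no hypothesis: if z is not
  -- admissible the new system has no parameters.
  G := {x | x ∈ S.G ∧ x ≠ z ∧ z ∈ S.G}
  isOpen_G := S.isOpen_G.inter (isOpen_ne.inter isOpen_const)
  h := inl S.h
  d_h := by ext <;> simp [dualMap, S.d_h]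
  h_mul_cancel p q hpq := by
    have h1 := congrArg fst hpq
    have h2 := congrArg snd hpq
    simp only [fst_mul, fst_inl, DualNumber.snd_mul', snd_inl, zero_mul, add_zero] at h1 h2
    exact TrivSqZeroExt.ext (S.h_mul_cancel _ _ h1) (S.h_mul_cancel _ _ h2)
  -- The potential moves by twice the derivative of the diagonal Green function at z; the velocities
  -- of a and b are those found in `riccati_variation_a` and `riccati_variation_b`.
  u := inl S.u + inr (2 * S.d (S.f z))
  a x := inl (S.a x) + inr (S.d (S.f z * S.da x z))
  b x := inl (S.b x) + inr (S.d (S.f z * S.db x z))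
  -- The derivative in x of the velocity of a: differentiating da(x,z) produces a second divided
  -- difference with a double node at x.
  a' x := inl (S.a' x) + inr (S.d (S.f z * ((x - z)⁻¹ • (S.a' x - S.da x z))))
  isUnit_sub x hx y hy := by
    rw [isUnit_iff_isUnit_fst]
    simpa using S.isUnit_sub x hx.1 y hy.1
  riccati_a x hx := by
    ext
    · simpa [dualMap, algebraMap_eq_inl'] using S.riccati_a x hx.1
    · have := riccati_variation_a hx.1 hx.2.2 hx.2.1
      simp only [dualMap, algebraMap_eq_inl', LinearMap.coe_mk, AddHom.coe_mk, DualNumber.snd_mul',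
        sq, snd_add, snd_inl, snd_inr, fst_add, fst_inl, fst_inr, zero_add, add_zero]
      linear_combination this
  riccati_b x hx := by
    ext
    · simpa [dualMap, algebraMap_eq_inl'] using S.riccati_b x hx.1
    · have := riccati_variation_b hx.1 hx.2.2 hx.2.1
      simp only [dualMap, algebraMap_eq_inl', LinearMap.coe_mk, AddHom.coe_mk, DualNumber.snd_mul',
        sq, snd_add, snd_inl, snd_inr, fst_add, fst_inl, fst_inr, zero_add, add_zero]
      linear_combination this
  slope_a x hx := by
    have h1 := (TrivSqZeroExt.continuous_inl (M := S.R)).continuousAt.tendsto.comp (S.slope_a x hx.1)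
    have h2 := ((tendsto_const_nhds (x := S.f z)).mul (S.tendsto_slope_da hx.1 hx.2.1))
    have h3 := (S.continuous_d.tendsto _).comp h2
    have h4 := (TrivSqZeroExt.continuous_inr (R := S.R)).continuousAt.tendsto.comp h3
    refine (h1.add h4).congr fun y => ?_
    ext
    · simp [slope]
    · simp [slope, mul_sub, map_sub]
  continuousAt_b x hx := by
    have h1 := S.continuousAt_b x hx.1
    have h2 : ContinuousAt (fun y : ℝ => (y - z)⁻¹) x :=
      ContinuousAt.inv₀ (by fun_prop) (sub_ne_zero.2 hx.2.1)
    have h3 : ContinuousAt (fun y => S.d (S.f z * S.db y z)) x :=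
      (S.continuous_d.continuousAt).comp
        (continuousAt_const.mul (h2.smul (h1.sub continuousAt_const)))
    exact (TrivSqZeroExt.continuous_inl.continuousAt.comp h1).add
      (TrivSqZeroExt.continuous_inr.continuousAt.comp h3)

variable {S}
variable {z : ℝ}

@[simp] theorem mem_step_G {x : ℝ} : x ∈ (S.step z).G ↔ x ∈ S.G ∧ x ≠ z ∧ z ∈ S.G := Iff.rfl

/-- The value at `ε = 0`. -/
def re (S : AirySystem) (z : ℝ) : (S.step z).R →ₐ[ℝ] S.R := TrivSqZeroExt.fstHom ℝ S.R S.R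

/-- The coefficient of `ε`. -/
def im (S : AirySystem) (z : ℝ) : (S.step z).R →ₗ[ℝ] S.R where
  toFun p := TrivSqZeroExt.snd (p : DualNumber S.R)
  map_add' _ _ := rfl
  map_smul' _ _ := rfl

theorem continuous_im : Continuous (S.im z) := TrivSqZeroExt.continuous_snd

theorem im_mul (p q : (S.step z).R) :
    S.im z (p * q) = S.re z p * S.im z q + S.im z p * S.re z q :=
  DualNumber.snd_mul' p q

theorem im_one : S.im z 1 = 0 := rfl

theorem re_h : S.re z (S.step z).h = S.h := rfl

theorem im_h : S.im z (S.step z).h = 0 := rfl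

theorem re_inverse {p : (S.step z).R} (hp : IsUnit p) :
    S.re z (Ring.inverse p) = Ring.inverse (S.re z p) :=
  DualNumber.fst_inverse hp

theorem im_inverse {p : (S.step z).R} (hp : IsUnit p) :
    S.im z (Ring.inverse p) = -(Ring.inverse (S.re z p) ^ 2 * S.im z p) :=
  DualNumber.snd_inverse hp

theorem re_a (x : ℝ) : S.re z ((S.step z).a x) = S.a x := add_zero _

theorem im_a (x : ℝ) : S.im z ((S.step z).a x) = S.d (S.f z * S.da x z) := zero_add _

theorem re_a' (x : ℝ) : S.re z ((S.step z).a' x) = S.a' x := add_zero _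

theorem im_a' (x : ℝ) : S.im z ((S.step z).a' x) =
    S.d (S.f z * ((x - z)⁻¹ • (S.a' x - S.da x z))) := zero_add _

theorem re_b (x : ℝ) : S.re z ((S.step z).b x) = S.b x := add_zero _

theorem im_b (x : ℝ) : S.im z ((S.step z).b x) = S.d (S.f z * S.db x z) := zero_add _

theorem re_r {x y : ℝ} (hx : x ∈ (S.step z).G) (hy : y ∈ (S.step z).G) :
    S.re z ((S.step z).r x y) = S.r x y := by
  rw [r, re_inverse ((S.step z).isUnit_sub x hx y hy), map_sub, re_a, re_b, r]

theorem im_r {x y : ℝ} (hx : x ∈ (S.step z).G) (hy : y ∈ (S.step z).G) :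
    S.im z ((S.step z).r x y) =
      -(S.r x y ^ 2 * (S.d (S.f z * S.db y z) - S.d (S.f z * S.da x z))) := by
  rw [r, im_inverse ((S.step z).isUnit_sub x hx y hy), map_sub, map_sub, re_a, re_b, im_a, im_b, r]

theorem re_f {x : ℝ} (hx : x ∈ (S.step z).G) : S.re z ((S.step z).f x) = S.f x := re_r hx hx

theorem im_f {x : ℝ} (hx : x ∈ (S.step z).G) : S.im z ((S.step z).f x) =
    -(S.f x ^ 2 * (S.d (S.f z * S.db x z) - S.d (S.f z * S.da x z))) := im_r hx hx

theorem re_k {x y : ℝ} (hy : y ∈ (S.step z).G) :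
    S.re z ((S.step z).k x y) = S.k x y := by
  rw [k, map_smul, map_mul, map_sub, re_f hy, re_a, re_b, k]

theorem sub_mul_smul {x y : ℝ} (h : x ≠ y) (p : S.R) :
    (algebraMap ℝ S.R x - algebraMap ℝ S.R y) * ((x - y)⁻¹ • p) = p := by
  rw [Algebra.smul_def, ← mul_assoc, ← map_sub, ← map_mul, mul_inv_cancel₀ (sub_ne_zero.2 h),
    map_one, one_mul]

theorem sub_mul_k {x y : ℝ} (h : x ≠ y) :
    (algebraMap ℝ S.R x - algebraMap ℝ S.R y) * S.k x y = S.f y * (S.b y - S.a x) :=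
  sub_mul_smul h _

/-- `(y - z) δ_z f y`, up to the factor `h`. -/
theorem sub_mul_variation_f {y z : ℝ} (hy : y ∈ S.G) (hz : z ∈ S.G) (hyz : y ≠ z) :
    (algebraMap ℝ S.R y - algebraMap ℝ S.R z) * (S.f y ^ 2 *
      (S.h * S.d (S.f z * S.db y z) - S.h * S.d (S.f z * S.da y z))) =
      S.f y * S.f z * (S.a z + S.b z - S.a y - S.b y) := by
  rw [h_mul_d_f_mul_da hy hz hyz, h_mul_d_f_mul_db hy hz hyz]
  linear_combination S.f y ^ 2 * S.f z * (S.a z - S.b y) * sub_mul_db (S := S) hyz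
    - S.f y ^ 2 * S.f z * (S.b z - S.a y) * sub_mul_da (S := S) hyz
    + S.f y * S.f z * (S.a z + S.b z - S.a y - S.b y) * f_mul hy

/-- The variation of the kernel under an insertion. -/
theorem h_mul_im_k {x y : ℝ} (hx : x ∈ (S.step z).G) (hy : y ∈ (S.step z).G) (hxy : x ≠ y) :
    S.h * S.im z ((S.step z).k x y) =
      -(S.k x z * S.k z y) - S.k x y * S.k y z + S.k x y * S.k x z := by
  have hz := hx.2.2
  have e2 : (algebraMap ℝ S.R x - algebraMap ℝ S.R y) * S.im z ((S.step z).k x y) =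
      (S.f y * (S.d (S.f z * S.db y z) - S.d (S.f z * S.da x z)) +
        -(S.f y ^ 2 * (S.d (S.f z * S.db y z) - S.d (S.f z * S.da y z))) * (S.b y - S.a x)) := by
    rw [k, map_smul, im_mul, map_sub, map_sub, re_f hy, re_a, re_b, im_a, im_b, im_f hy,
      sub_mul_smul hxy]
  have d1 := h_mul_d_f_mul_da hx.1 hz hx.2.1
  have d2 := h_mul_d_f_mul_da hy.1 hz hy.2.1
  have d3 := h_mul_d_f_mul_db hy.1 hz hy.2.1
  have k1 := sub_mul_k (S := S) hx.2.1
  have k2 := sub_mul_k (S := S) hy.2.1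
  have k3 := sub_mul_k (S := S) hy.2.1.symm
  have k4 := sub_mul_k (S := S) hxy
  have a1 := sub_mul_da (S := S) hx.2.1
  have a2 := sub_mul_da (S := S) hy.2.1
  have vf := sub_mul_variation_f hy.1 hz hy.2.1
  have fy := f_mul hy.1
  -- The three differences of points are units. After multiplication by them, every kernel and
  -- divided difference is a polynomial in a, b, f, and the claim is a polynomial consequence of
  -- f(y)(b(y) - a(y)) = 1.
  apply sub_cancel hxy
  apply sub_cancel hx.2.1
  apply sub_cancel hy.2.1
  generalize algebraMap ℝ S.R x = X at *
  generalize algebraMap ℝ S.R y = Y at *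
  generalize algebraMap ℝ S.R z = Z at *
  generalize S.d (S.f z * S.db y z) = DB at *
  generalize S.d (S.f z * S.da y z) = DA at *
  generalize S.d (S.f z * S.da x z) = DX at *
  linear_combination (Y - Z) * (X - Z) * S.h * e2
    - (Y - Z) * (X - Z) * S.f y * (S.h * DB - S.h * DA) * fy
    - (X - Z) * (S.a y - S.a x) * vf
    + (Y - Z) * (X - Z) * S.f y * (d2 - d1)
    + (X - Z) * S.f y * S.f z * (S.b z - S.a y) * a2
    - (Y - Z) * S.f y * S.f z * (S.b z - S.a x) * a1
    - (X - Y) * ((Z - Y) * S.k z y * k1 + S.f z * (S.b z - S.a x) * k3)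
    + (X - Z) * ((Y - Z) * S.k y z * k4 + S.f y * (S.b y - S.a x) * k2)
    - (Y - Z) * ((X - Z) * S.k x z * k4 + S.f y * (S.b y - S.a x) * k1)

end AirySystem

/-! ### Sums over full cycles -/

namespace Equiv.Perm

/-- A full cycle is a permutation with a single orbit; in this form the property is easy to follow
when a point is inserted. -/
theorem isCycle_and_support_eq_univ_iff {n : ℕ} (σ : Perm (Fin (n + 2))) :
    (σ.IsCycle ∧ σ.support = univ) ↔ ∀ x y, σ.SameCycle x y := by
  constructor
  · rintro ⟨h1, h2⟩ x y
    exact h1.sameCycle (mem_support.1 (h2 ▸ mem_univ x)) (mem_support.1 (h2 ▸ mem_univ y))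
  · intro h
    have h0 : ∀ x, σ x ≠ x := by
      intro x hx
      obtain ⟨y, hy⟩ := exists_ne x
      exact hy ((SameCycle.eq_of_left (h x y) hx).symm)
    exact ⟨⟨0, h0 0, fun y _ => h 0 y⟩, by ext x; simp [h0 x]⟩

theorem SameCycle.map_of_step {α β : Type*} [Finite α] {σ : Perm α} {τ : Perm β} (π : α → β)
    (h : ∀ x, τ.SameCycle (π x) (π (σ x))) {x y : α} (hxy : σ.SameCycle x y) :
    τ.SameCycle (π x) (π y) := by
  obtain ⟨i, -, -, rfl⟩ := hxy.exists_pow_eq'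
  clear hxy
  induction i with
  | zero => exact SameCycle.refl _ _
  | succ i ih =>
    rw [pow_succ', mul_apply]
    exact ih.trans (h _)

/-- The permutation encoded by `((e i).succ, e)` is e with the new point 0 spliced between i and e
i. -/
theorem decomposeFin_symm_succ_of_eq {n : ℕ} (e : Perm (Fin n)) (i : Fin n) :
    decomposeFin.symm ((e i).succ, e) i.succ = 0 := by
  rw [decomposeFin_symm_apply_succ, Equiv.swap_apply_right]

theorem decomposeFin_symm_succ_of_ne {n : ℕ} (e : Perm (Fin n)) {i j : Fin n} (h : j ≠ i) :
    decomposeFin.symm ((e i).succ, e) j.succ = (e j).succ := by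
  rw [decomposeFin_symm_apply_succ, Equiv.swap_apply_of_ne_of_ne (Fin.succ_ne_zero _)]
  simpa using h

theorem sameCycle_decomposeFin_iff {n : ℕ} (e : Perm (Fin n)) (i : Fin n) :
    (∀ x y, (decomposeFin.symm ((e i).succ, e)).SameCycle x y) ↔ ∀ x y, e.SameCycle x y := by
  constructor
  · intro h x y
    -- Contract the new point 0 onto e i: each step of the enlarged permutation becomes a step of e
    -- or no step at all.
    have := SameCycle.map_of_step (σ := decomposeFin.symm ((e i).succ, e)) (τ := e)
      (Fin.cases (e i) id) ?_ (h x.succ y.succ)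
    · simpa using this
    · intro z
      refine Fin.cases ?_ (fun j => ?_) z
      · rw [decomposeFin_symm_apply_zero]
        exact SameCycle.refl _ _
      · rcases eq_or_ne j i with rfl | hj
        · rw [decomposeFin_symm_succ_of_eq]
          exact SameCycle.rfl.apply_right
        · rw [decomposeFin_symm_succ_of_ne e hj]
          exact SameCycle.rfl.apply_right
  · intro h
    set σ := decomposeFin.symm ((e i).succ, e) with hσ
    have h1 : ∀ x y : Fin n, σ.SameCycle x.succ y.succ := by
      intro x y
      refine SameCycle.map_of_step (σ := e) (τ := σ) Fin.succ ?_ (h x y)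
      intro j
      rcases eq_or_ne j i with rfl | hj
      · have h2 : σ (σ j.succ) = (e j).succ := by
          rw [hσ, decomposeFin_symm_succ_of_eq, decomposeFin_symm_apply_zero]
        rw [← h2]
        exact (SameCycle.rfl.apply_right).apply_right
      · rw [← decomposeFin_symm_succ_of_ne e hj]
        exact SameCycle.rfl.apply_right
    have h0 : ∀ x : Fin n, σ.SameCycle 0 x.succ := by
      intro x
      have h2 : σ 0 = (e i).succ := decomposeFin_symm_apply_zero _ _
      have h3 : σ.SameCycle 0 (e i).succ := h2 ▸ SameCycle.rfl.apply_right
      exact h3.trans (h1 _ _)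
    intro x y
    refine Fin.cases ?_ (fun x => ?_) x <;> refine Fin.cases ?_ (fun y => ?_) y
    · exact SameCycle.rfl
    · exact h0 y
    · exact (h0 x).symm
    · exact h1 x y

end Equiv.Perm

section CycleSum
variable {R : Type*} [CommRing R]
open Equiv.Perm
open scoped Classical in
/-- The sum over the full cycles `σ` of the products of the `κ i (σ i)`. -/
def cycleSum {n : ℕ} (κ : Fin n → Fin n → R) : R :=
  ∑ σ : Equiv.Perm (Fin n) with σ.IsCycle ∧ σ.support = univ, ∏ i, κ i (σ i)

open scoped Classical in
/-- Full cycles on `n + 1` points arise from full cycles on `n` points by inserting a point. -/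
theorem cycleSum_insert {n : ℕ} (κ : Fin (n + 3) → Fin (n + 3) → R) :
    cycleSum κ = ∑ σ : Equiv.Perm (Fin (n + 2)) with σ.IsCycle ∧ σ.support = univ,
      ∑ i, κ i.succ 0 * κ 0 (σ i).succ * ∏ j ∈ univ.erase i, κ j.succ (σ j).succ := by
  have key : ∀ (e : Equiv.Perm (Fin (n + 2))) (i : Fin (n + 2)),
      ∏ j, κ j (decomposeFin.symm ((e i).succ, e) j) =
        κ i.succ 0 * κ 0 (e i).succ * ∏ j ∈ univ.erase i, κ j.succ (e j).succ := by
    intro e i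
    rw [Fin.prod_univ_succ, decomposeFin_symm_apply_zero, ← mul_prod_erase univ _ (mem_univ i),
      decomposeFin_symm_succ_of_eq, prod_congr rfl (fun j hj => by
        rw [decomposeFin_symm_succ_of_ne e (ne_of_mem_erase hj)])]
    ring
  rw [cycleSum, sum_filter, ← decomposeFin.symm.sum_comp, Fintype.sum_prod_type_right, sum_filter]
  refine sum_congr rfl fun e _ => ?_
  rw [Fin.sum_univ_succ]
  have h0 : ¬ ((decomposeFin.symm (0, e)).IsCycle ∧ (decomposeFin.symm (0, e)).support = univ) := by
    rintro ⟨-, h⟩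
    have := h ▸ mem_univ (0 : Fin (n + 3))
    simp at this
  -- The remaining choices for the image of 0 are written as e i, so that they run over the gap (i,
  -- e i) in which 0 is placed; the choice 0 ↦ 0 fixes a point and contributes nothing.
  rw [if_neg h0, zero_add, ← Equiv.sum_comp e]
  split_ifs with he
  · refine sum_congr rfl fun i _ => ?_
    rw [if_pos, key]
    rw [isCycle_and_support_eq_univ_iff, sameCycle_decomposeFin_iff]
    exact (isCycle_and_support_eq_univ_iff e).1 he
  · refine sum_eq_zero fun i _ => ?_
    rw [if_neg]
    rw [isCycle_and_support_eq_univ_iff, sameCycle_decomposeFin_iff]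
    exact fun h => he ((isCycle_and_support_eq_univ_iff e).2 h)

theorem cycleSum_two (κ : Fin 2 → Fin 2 → R) : cycleSum κ = κ 0 1 * κ 1 0 := by
  classical
  have : (univ.filter fun σ : Equiv.Perm (Fin 2) => σ.IsCycle ∧ σ.support = univ) =
      {Equiv.swap 0 1} := by
    ext σ
    simp only [mem_filter, mem_univ, true_and, mem_singleton]
    constructor
    · rintro ⟨-, h⟩
      have h0 : σ 0 ≠ 0 := mem_support.1 (h ▸ mem_univ 0)
      have h1 : σ 1 ≠ 1 := mem_support.1 (h ▸ mem_univ 1)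
      ext i
      fin_cases i <;> simp <;> omega
    · rintro rfl
      exact ⟨isCycle_swap (by decide), by decide⟩
  rw [cycleSum, this, sum_singleton, Fin.prod_univ_two]
  simp

theorem cycleSum_reindex {n m : ℕ} (e : Fin n ≃ Fin m) (κ : Fin m → Fin m → R) :
    cycleSum (fun i j => κ (e i) (e j)) = cycleSum κ := by
  classical
  obtain rfl : n = m := by simpa using Fintype.card_congr e
  rw [cycleSum, cycleSum]
  refine sum_nbij' (fun σ => (e : Equiv.Perm (Fin n)) * σ * (e : Equiv.Perm (Fin n))⁻¹)
    (fun σ => (e : Equiv.Perm (Fin n))⁻¹ * σ * e) ?_ ?_ ?_ ?_ ?_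
  · intro σ hσ
    simp only [mem_filter, mem_univ, true_and] at hσ ⊢
    rw [Equiv.Perm.support_conj, hσ.2]
    exact ⟨hσ.1.conj, by simp⟩
  · intro σ hσ
    simp only [mem_filter, mem_univ, true_and] at hσ ⊢
    have hc : (e : Equiv.Perm (Fin n))⁻¹ * σ * e = e⁻¹ * σ * e⁻¹⁻¹ := by rw [inv_inv]
    rw [hc, Equiv.Perm.support_conj, hσ.2]
    exact ⟨hσ.1.conj, by simp⟩
  · intro σ _; group
  · intro σ _; group
  · intro σ _
    rw [← Equiv.prod_comp e fun i =>
      κ i (((e : Equiv.Perm (Fin n)) * σ * (e : Equiv.Perm (Fin n))⁻¹) i)]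
    refine prod_congr rfl fun i _ => ?_
    change κ (e i) (e (σ i)) = κ (e i) (e (σ (e.symm (e i))))
    rw [Equiv.symm_apply_apply]

theorem cycleSum_map {R' : Type*} [CommRing R'] (φ : R →+* R') {n : ℕ} (κ : Fin n → Fin n → R) :
    φ (cycleSum κ) = cycleSum fun i j => φ (κ i j) := by
  simp [cycleSum]

/-- Transposing the kernel does not change the sum. -/
theorem cycleSum_transpose {n : ℕ} (κ : Fin n → Fin n → R) :
    cycleSum (fun i j => κ j i) = cycleSum κ := by
  classical
  rw [cycleSum, cycleSum]
  refine sum_nbij' (fun σ => σ⁻¹) (fun σ => σ⁻¹) ?_ ?_ ?_ ?_ ?_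
  · intro σ hσ
    simpa using hσ
  · intro σ hσ
    simpa using hσ
  · intro σ _; simp
  · intro σ _; simp
  · intro σ _
    rw [← Equiv.prod_comp σ (fun i => κ i (σ⁻¹ i))]
    simp

/-- Diagonal conjugation of the kernel does not change the sum. -/
theorem cycleSum_congr_of_prod {n : ℕ} {κ κ' : Fin n → Fin n → R}
    (h : ∀ σ : Equiv.Perm (Fin n), (∀ i, σ i ≠ i) → ∏ i, κ i (σ i) = ∏ i, κ' i (σ i)) :
    cycleSum κ = cycleSum κ' := by
  classical
  rw [cycleSum, cycleSum]
  refine sum_congr rfl fun σ hσ => h σ fun i => ?_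
  simp only [mem_filter, mem_univ, true_and] at hσ
  exact mem_support.1 (hσ.2 ▸ mem_univ i)

end CycleSum

namespace AirySystem
variable {S : AirySystem} {z : ℝ}

/-! ### Cycle sums of the kernel -/

/-- The sum over full cycles of products of kernels. -/
def cyc (S : AirySystem) (l : List ℝ) : S.R :=
  cycleSum fun i j : Fin l.length => S.k l[i] l[j]

theorem im_prod {ι : Type*} [DecidableEq ι] (s : Finset ι) (g : ι → (S.step z).R) :
    S.im z (∏ i ∈ s, g i) = ∑ i ∈ s, S.im z (g i) * ∏ j ∈ s.erase i, S.re z (g j) := by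
  induction s using Finset.induction_on with
  | empty => simp [im_one]
  | insert i s hi ih =>
    rw [prod_insert hi, im_mul, ih, sum_insert hi, erase_insert hi, map_prod, add_comm, mul_sum]
    congr 1
    refine sum_congr rfl fun j hj => ?_
    rw [erase_insert_of_ne (by rintro rfl; exact hi hj), prod_insert (fun h => hi (mem_of_mem_erase h))]
    ring

/-- By the product rule and `h_mul_im_k`, each factor k(x,y) of a cycle is replaced by
-k(x,z)k(z,y), which splices z into that edge, or multiplied by k(x,z) - k(y,z), which cancels
around the cycle. Splicing into all edges of all full cycles gives each full cycle on one more point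
once. -/
theorem h_mul_im_cyc {l : List ℝ} (hl : 2 ≤ l.length) (hn : l.Nodup)
    (hG : ∀ x ∈ l, x ∈ (S.step z).G) :
    S.h * S.im z ((S.step z).cyc l) = -S.cyc (z :: l) := by
  classical
  obtain ⟨n, hn'⟩ : ∃ n, l.length = n + 2 := ⟨l.length - 2, by omega⟩
  obtain ⟨p, rfl⟩ : ∃ p : Fin (n + 2) → ℝ, l = List.ofFn p :=
    ⟨fun i => l[i], by
      apply List.ext_getElem
      · simp [hn', -List.ofFn_succ]
      · intros; simp [-List.ofFn_succ]⟩
  have hp : Function.Injective p := List.nodup_ofFn.1 hn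
  have hpG : ∀ i, p i ∈ (S.step z).G := fun i => hG _ (by simp [-List.ofFn_succ])
  have e1 : (S.step z).cyc (List.ofFn p) = cycleSum fun i j => (S.step z).k (p i) (p j) := by
    rw [cyc, ← cycleSum_reindex (finCongr (List.length_ofFn (f := p)))]
    simp [-List.ofFn_succ]
    rfl
  have e2 : S.cyc (z :: List.ofFn p) = cycleSum fun i j : Fin (n + 3) =>
      S.k (Fin.cons (α := fun _ => ℝ) z p i) (Fin.cons (α := fun _ => ℝ) z p j) := by
    rw [cyc, ← cycleSum_reindex (finCongr (by simp : (z :: List.ofFn p).length = n + 3))]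
    have : ∀ i : Fin (z :: List.ofFn p).length, (z :: List.ofFn p)[i] =
        Fin.cons (α := fun _ => ℝ) z p
          (finCongr (by simp : (z :: List.ofFn p).length = n + 3) i) := by
      rintro ⟨i, hi⟩
      cases i with
      | zero => rfl
      | succ i =>
        simp only [Fin.getElem_fin, List.getElem_cons_succ, List.getElem_ofFn, finCongr_apply_mk]
        exact (Fin.cons_succ (α := fun _ => ℝ) z p ⟨i, _⟩).symm
    simp only [this]
  rw [e1, e2, cycleSum_insert, cycleSum, map_sum, mul_sum, ← sum_neg_distrib]
  refine sum_congr rfl fun σ hσ => ?_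
  have hσ' : ∀ i, σ i ≠ i := fun i => by
    have := (mem_filter.1 hσ).2.2
    exact Equiv.Perm.mem_support.1 (this ▸ mem_univ i)
  rw [im_prod, mul_sum]
  have h1 : ∀ i, S.h * (S.im z ((S.step z).k (p i) (p (σ i))) *
      ∏ j ∈ univ.erase i, S.re z ((S.step z).k (p j) (p (σ j)))) =
      -(S.k (p i) z * S.k z (p (σ i)) * ∏ j ∈ univ.erase i, S.k (p j) (p (σ j)))
      + (S.k (p i) z - S.k (p (σ i)) z) * ∏ j, S.k (p j) (p (σ j)) := by
    intro i
    rw [← mul_assoc, h_mul_im_k (hpG _) (hpG _) (fun h => hσ' i (hp h).symm),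
      ← mul_prod_erase univ (fun j => S.k (p j) (p (σ j))) (mem_univ i)]
    simp only [re_k (hpG _)]
    ring
  -- The factors k(p i, z) and k(p (σ i), z) have equal sums over i, as σ is a bijection.
  rw [sum_congr rfl fun i _ => h1 i, sum_add_distrib, ← sum_mul, sum_sub_distrib,
    Equiv.sum_comp σ (fun i => S.k (p i) z), sub_self, zero_mul, add_zero, sum_neg_distrib]
  simp

/-! ### Iterated insertions -/

/-- The system obtained by inserting the points of a list. -/
def insertList : List ℝ → AirySystem → AirySystem
  | [], S => S
  | z :: L, S => insertList L (S.step z)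

/-- The coefficient of the product of all the `ε`. -/
def topCoeff : (L : List ℝ) → (S : AirySystem) → (insertList L S).R →ₗ[ℝ] S.R
  | [], _ => LinearMap.id
  | z :: L, S => S.im z ∘ₗ topCoeff L (S.step z)

theorem continuous_topCoeff (L : List ℝ) (S : AirySystem) : Continuous (topCoeff L S) := by
  induction L generalizing S with
  | nil => exact continuous_id
  | cons z L ih => exact continuous_im.comp (ih (S.step z))

theorem topCoeff_h_mul (L : List ℝ) (S : AirySystem) (p : (insertList L S).R) :
    topCoeff L S ((insertList L S).h * p) = S.h * topCoeff L S p := by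
  induction L generalizing S with
  | nil => rfl
  | cons z L ih =>
    change S.im z (topCoeff L (S.step z) _) = S.h * S.im z (topCoeff L (S.step z) p)
    refine (congrArg _ (ih (S.step z) p)).trans ?_
    rw [im_mul, re_h, im_h, zero_mul, add_zero]

theorem mem_insertList_G {L : List ℝ} {S : AirySystem} {x : ℝ} :
    x ∈ (insertList L S).G ↔ x ∈ S.G ∧ x ∉ L ∧ L.Nodup ∧ ∀ z ∈ L, z ∈ S.G := by
  induction L generalizing S with
  | nil => simp [insertList]
  | cons z L ih =>
    rw [insertList, ih]
    simp only [mem_step_G, List.mem_cons, not_or, List.nodup_cons, forall_eq_or_imp]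
    constructor
    · rintro ⟨⟨h1, h2, h3⟩, h4, h5, h6⟩
      exact ⟨h1, ⟨h2, h4⟩, ⟨fun h => (h6 z h).2.1 rfl, h5⟩, h3, fun w hw => (h6 w hw).1⟩
    · rintro ⟨h1, ⟨h2, h4⟩, ⟨h7, h5⟩, h3, h6⟩
      exact ⟨⟨h1, h2, h3⟩, h4, h5, fun w hw => ⟨h6 w hw, fun h => h7 (h ▸ hw), h3⟩⟩

/-- A list is consumed from its head, so its last point is inserted into the fully deformed system.
Here E stands for any expression defined uniformly for all systems. -/
theorem topCoeff_append_singleton (L : List ℝ) (S : AirySystem) (w : ℝ)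
    (E : (S : AirySystem) → S.R) :
    topCoeff (L ++ [w]) S (E (insertList (L ++ [w]) S)) =
      topCoeff L S ((insertList L S).im w (E ((insertList L S).step w))) := by
  induction L generalizing S with
  | nil => rfl
  | cons z L ih => exact congrArg (S.im z) (ih (S.step z))

/-- Iteration of `h_mul_im_cyc`. Every point beyond l costs one factor h, which is the origin of the
decay N^(2-n) of the n-point functions. -/
theorem h_pow_mul_topCoeff_cyc (L l : List ℝ) (S : AirySystem) (hl : 2 ≤ l.length)
    (hn : (L ++ l).Nodup) (hG : ∀ x ∈ L ++ l, x ∈ S.G) :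
    S.h ^ L.length * topCoeff L S ((insertList L S).cyc l) =
      (-1) ^ L.length * S.cyc (L ++ l) := by
  induction L generalizing S with
  | nil => simp [insertList, topCoeff]; rfl
  | cons z L ih =>
    rw [List.cons_append, List.nodup_cons] at hn
    have hG' : ∀ x ∈ L ++ l, x ∈ (S.step z).G := fun x hx =>
      ⟨hG x (List.mem_cons_of_mem _ hx), fun h => hn.1 (h ▸ hx), hG z List.mem_cons_self⟩
    have h1 := ih (S.step z) hn.2 hG'
    have h2 := h_mul_im_cyc (S := S) (z := z) (l := L ++ l) (by simp; omega) hn.2 hG'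
    have h3 := congrArg (S.im z) h1
    have hh : ∀ (n : ℕ) (p : (S.step z).R),
        S.im z ((S.step z).h ^ n * p) = S.h ^ n * S.im z p := by
      intro n p
      induction n generalizing p with
      | zero => simp
      | succ n ih => rw [pow_succ, mul_assoc, ih, im_mul, re_h, im_h, pow_succ]; ring
    have hs : ∀ (n : ℕ) (p : (S.step z).R),
        S.im z ((-1) ^ n * p) = (-1) ^ n * S.im z p := by
      intro n p
      rcases neg_one_pow_eq_or (S.step z).R n with h | h <;>
      rcases Nat.even_or_odd n with h' | h' <;> simp [h'.neg_one_pow]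
    rw [hh, hs] at h3
    change S.h ^ (L.length + 1) * S.im z (topCoeff L (S.step z) ((insertList L (S.step z)).cyc l)) =
      (-1) ^ (L.length + 1) * S.cyc (z :: (L ++ l))
    rw [pow_succ, pow_succ]
    linear_combination S.h * h3 + (-1) ^ L.length * h2

/-! ### Correlation functions and their primitives -/

/-- The regular two-point function. -/
def w (S : AirySystem) (x y : ℝ) : S.R := -(S.f x * S.f y * S.da x y * S.db x y)

/-- Since (b(y) - a(x))(b(x) - a(y)) differs from (b(x) - a(x))(b(y) - a(y)) by -(a(x) - a(y))(b(x)
- b(y)), the product k(x,y)k(y,x) is -1/(x - y)² plus a term without pole. -/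
theorem w_eq {x y : ℝ} (hx : x ∈ S.G) (hy : y ∈ S.G) (h : x ≠ y) :
    S.w x y = -((((x - y) ^ 2)⁻¹ : ℝ) • (1 : S.R)) - S.cyc [x, y] := by
  have hc : S.cyc [x, y] = S.k x y * S.k y x := cycleSum_two _
  rw [hc]
  have e : (algebraMap ℝ S.R x - algebraMap ℝ S.R y) * ((algebraMap ℝ S.R x - algebraMap ℝ S.R y) *
      ((((x - y) ^ 2)⁻¹ : ℝ) • (1 : S.R))) = 1 := by
    rw [sq, mul_inv, mul_smul, sub_mul_smul h, sub_mul_smul h]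
  have k1 := sub_mul_k (S := S) h
  have k2 := sub_mul_k (S := S) h.symm
  have a1 := sub_mul_da (S := S) h
  have b1 := sub_mul_db (S := S) h
  have fx := f_mul hx
  have fy := f_mul hy
  apply sub_cancel h
  apply sub_cancel h
  rw [w]
  generalize algebraMap ℝ S.R x = X at *
  generalize algebraMap ℝ S.R y = Y at *
  linear_combination -S.f x * S.f y * ((X - Y) * S.db x y * a1 + (S.a x - S.a y) * b1) + e
    - (Y - X) * S.k y x * k1 - S.f y * (S.b y - S.a x) * k2
    - fx - S.f x * (S.b x - S.a x) * fy

/-- The primitive `τ` of the two-point function. -/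
def tau (S : AirySystem) (z x y : ℝ) : S.R :=
  -((x - y) • (S.f z * S.da x z * S.db z y * S.r x y))

theorem tau_self (z x : ℝ) : S.tau z x x = 0 := by simp [tau]

/-- The limit of `tau z x y` as `z → x`. -/
def tauDiag (S : AirySystem) (x y : ℝ) : S.R := S.f x * S.a' x - S.a' x * S.r x y

theorem db_comm (x y : ℝ) : S.db x y = S.db y x := by
  rw [db, db, ← neg_sub y x, inv_neg, neg_smul, ← smul_neg, neg_sub]

theorem da_comm (x y : ℝ) : S.da x y = S.da y x := by
  rw [da, da, ← neg_sub y x, inv_neg, neg_smul, ← smul_neg, neg_sub]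

/-- Thinking of a and b as h d log A and h d log B, the right side is h δ_z log (A(x) B(y) (b(y) -
a(x))): the first two terms vary log A(x) and log B(y), the last one the difference b(y) - a(x). So
τ is the variation of the logarithm of the numerator of the kernel. -/
theorem tau_eq {z x y : ℝ} (hz : z ∈ S.G) (hx : x ∈ S.G) (hy : y ∈ S.G) (hxz : x ≠ z)
    (hyz : y ≠ z) : S.tau z x y = S.f z * S.da x z + S.f z * S.db y z +
      S.r x y * (S.h * S.d (S.f z * S.db y z) - S.h * S.d (S.f z * S.da x z)) := by
  rw [h_mul_d_f_mul_da hx hz hxz, h_mul_d_f_mul_db hy hz hyz, tau, db_comm z y, Algebra.smul_def,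
    map_sub]
  have a1 := sub_mul_da (S := S) hxz
  have b1 := sub_mul_db (S := S) hyz
  have fz := f_mul hz
  have r1 := r_mul hx hy
  generalize algebraMap ℝ S.R x = X at *
  generalize algebraMap ℝ S.R y = Y at *
  generalize algebraMap ℝ S.R z = Z at *
  linear_combination (-S.f z * S.db y z * S.r x y) * a1 + (S.f z * S.da x z * S.r x y) * b1
    + S.f z * (S.da x z + S.db y z) * r1

theorem continuousAt_a {x : ℝ} (hx : x ∈ S.G) : ContinuousAt S.a x := by
  rw [continuousAt_iff_punctured_nhds]
  have h1 : Tendsto (fun y : ℝ => y - x) (nhdsWithin x {x}ᶜ) (nhds (x - x)) :=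
    (Continuous.tendsto (by fun_prop) x).mono_left nhdsWithin_le_nhds
  have h2 := (h1.smul (S.slope_a x hx)).add_const (S.a x)
  rw [sub_self, zero_smul, zero_add] at h2
  refine h2.congr fun y => ?_
  rw [sub_smul_slope, vsub_eq_sub, sub_add_cancel]

theorem eventually_mem_G {x : ℝ} (hx : x ∈ S.G) : ∀ᶠ y in nhdsWithin x {x}ᶜ, y ∈ S.G ∧ y ≠ x := by
  filter_upwards [self_mem_nhdsWithin, nhdsWithin_le_nhds (S.isOpen_G.mem_nhds hx)] with y h1 h2
  exact ⟨h2, h1⟩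

theorem tendsto_a {x : ℝ} (hx : x ∈ S.G) : Tendsto S.a (nhdsWithin x {x}ᶜ) (nhds (S.a x)) :=
  (continuousAt_a hx).tendsto.mono_left nhdsWithin_le_nhds

theorem tendsto_b {x : ℝ} (hx : x ∈ S.G) : Tendsto S.b (nhdsWithin x {x}ᶜ) (nhds (S.b x)) :=
  (S.continuousAt_b x hx).tendsto.mono_left nhdsWithin_le_nhds

/-- The Riccati equation differentiated in x, obtained as a limit of its difference quotients
through the continuity of `d`. -/
theorem riccati_a' {x : ℝ} (hx : x ∈ S.G) : S.h * S.d (S.a' x) + 2 * S.a x * S.a' x = 1 := by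
  have h1 : Tendsto (fun y => S.h * S.d (slope S.a x y) + (S.a y + S.a x) * slope S.a x y)
      (nhdsWithin x {x}ᶜ) (nhds (S.h * S.d (S.a' x) + (S.a x + S.a x) * S.a' x)) :=
    (((S.continuous_d.tendsto _).comp (S.slope_a x hx)).const_mul S.h).add
      (((tendsto_a hx).add_const _).mul (S.slope_a x hx))
  have h2 : Tendsto (fun y => S.h * S.d (slope S.a x y) + (S.a y + S.a x) * slope S.a x y)
      (nhdsWithin x {x}ᶜ) (nhds 1) := by
    refine tendsto_const_nhds.congr' ?_
    filter_upwards [eventually_mem_G hx] with y hy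
    have e1 := S.riccati_a x hx
    have e2 := S.riccati_a y hy.1
    have e3 : (algebraMap ℝ S.R y - algebraMap ℝ S.R x) * slope S.a x y = S.a y - S.a x :=
      sub_mul_smul hy.2 _
    have e4 : (algebraMap ℝ S.R y - algebraMap ℝ S.R x) * S.d (slope S.a x y) =
        S.d (S.a y) - S.d (S.a x) := by
      rw [slope, map_smul, sub_mul_smul hy.2, vsub_eq_sub, map_sub]
    apply sub_cancel hy.2
    linear_combination e1 - e2 - S.h * e4 - (S.a y + S.a x) * e3
  have h3 := tendsto_nhds_unique h1 h2
  linear_combination h3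

theorem tendsto_r {x y : ℝ} (hx : x ∈ S.G) (hy : y ∈ S.G) :
    Tendsto (fun x => S.r x y) (nhdsWithin x {x}ᶜ) (nhds (S.r x y)) :=
  (S.continuousAt_inverse _ (S.isUnit_sub x hx y hy)).tendsto.comp ((tendsto_a hx).const_sub _)

theorem tendsto_f {x : ℝ} (hx : x ∈ S.G) : Tendsto S.f (nhdsWithin x {x}ᶜ) (nhds (S.f x)) :=
  (S.continuousAt_inverse _ (S.isUnit_sub x hx x hx)).tendsto.comp
    ((tendsto_b hx).sub (tendsto_a hx))

theorem tendsto_slope_r {x y : ℝ} (hx : x ∈ S.G) (hy : y ∈ S.G) :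
    Tendsto (slope (fun x => S.r x y) x) (nhdsWithin x {x}ᶜ) (nhds (S.r x y ^ 2 * S.a' x)) := by
  have h1 := ((tendsto_r hx hy).mul_const (S.r x y)).mul (S.slope_a x hx)
  rw [← sq] at h1
  refine h1.congr' ?_
  filter_upwards [eventually_mem_G hx] with z hz
  have e1 := r_mul hx hy
  have e2 := r_mul hz.1 hy
  rw [slope, slope, mul_smul_comm, vsub_eq_sub, vsub_eq_sub]
  congr 1
  linear_combination S.r z y * e1 - S.r x y * e2

/-- The derivative in x of `h_mul_d_f_mul_da`, proved directly from the equations for a'(x) and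
da(x,z). -/
theorem h_mul_d_second_difference {x z : ℝ} (hx : x ∈ S.G) (hz : z ∈ S.G) (h : x ≠ z) :
    S.h * S.d (S.f z * ((x - z)⁻¹ • (S.a' x - S.da x z))) =
      S.f z * ((S.b z - S.a x) * ((x - z)⁻¹ • (S.a' x - S.da x z)) - S.a' x * S.da x z) := by
  have h1 := h_mul_d_da hx hz h
  have h2 := riccati_a' hx
  have h3 := h_mul_d_f hz
  have h4 := sub_mul_da (S := S) h
  have h5 : (algebraMap ℝ S.R x - algebraMap ℝ S.R z) * S.d ((x - z)⁻¹ • (S.a' x - S.da x z)) =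
      S.d (S.a' x) - S.d (S.da x z) := by rw [map_smul, sub_mul_smul h, map_sub]
  have h6 := sub_mul_smul h (S.a' x - S.da x z)
  apply sub_cancel h
  rw [S.d_mul]
  generalize (x - z)⁻¹ • (S.a' x - S.da x z) = A2 at *
  linear_combination S.h * S.f z * h5 + S.f z * h2 - S.f z * h1
    + (algebraMap ℝ S.R x - algebraMap ℝ S.R z) * A2 * h3
    + S.f z * (S.a z + S.a x) * h6 + S.f z * S.a' x * h4

/-- The derivative of `tau z x y` with respect to `x`. -/
theorem tendsto_slope_tau {z x y : ℝ} (hz : z ∈ S.G) (hx : x ∈ S.G) (hy : y ∈ S.G) (hxz : x ≠ z)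
    (hyz : y ≠ z) : Tendsto (slope (fun x => S.tau z x y) x) (nhdsWithin x {x}ᶜ)
      (nhds (S.w z x + S.h * S.im z ((S.step z).tauDiag x y))) := by
  have hx' : x ∈ (S.step z).G := ⟨hx, hxz, hz⟩
  have hy' : y ∈ (S.step z).G := ⟨hy, hyz, hz⟩
  set A2 := (x - z)⁻¹ • (S.a' x - S.da x z) with hA2
  have tda := S.tendsto_slope_da hx hxz
  have tr := tendsto_slope_r hx hy
  have tg : Tendsto (fun x' => S.h * S.d (S.f z * slope (fun x => S.da x z) x x'))
      (nhdsWithin x {x}ᶜ) (nhds (S.h * S.d (S.f z * A2))) :=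
    ((S.continuous_d.tendsto _).comp (tda.const_mul (S.f z))).const_mul S.h
  have tda0 : Tendsto (fun x => S.da x z) (nhdsWithin x {x}ᶜ) (nhds (S.da x z)) := by
    have h1 : ContinuousAt (fun x : ℝ => (x - z)⁻¹) x :=
      ContinuousAt.inv₀ (by fun_prop) (sub_ne_zero.2 hxz)
    exact (h1.tendsto.mono_left nhdsWithin_le_nhds).smul ((tendsto_a hx).sub_const _)
  have tg0 : Tendsto (fun x' => S.h * S.d (S.f z * S.da x' z))
      (nhdsWithin x {x}ᶜ) (nhds (S.h * S.d (S.f z * S.da x z))) :=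
    ((S.continuous_d.tendsto _).comp (tda0.const_mul (S.f z))).const_mul S.h
  have lim := ((tda.const_mul (S.f z)).add
    (tr.mul (tg0.const_sub (S.h * S.d (S.f z * S.db y z))))).sub (tg.const_mul (S.r x y))
  -- The product rule applied to `tau_eq` gives the right side. Its comparison with the variation of
  -- f a' - a' r is algebraic, and the discrepancy is exactly the two-point function.
  have hval : S.w z x + S.h * S.im z ((S.step z).tauDiag x y) = S.f z * A2 +
      S.r x y ^ 2 * S.a' x * (S.h * S.d (S.f z * S.db y z) - S.h * S.d (S.f z * S.da x z)) -
      S.r x y * (S.h * S.d (S.f z * A2)) := by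
    rw [tauDiag, map_sub, im_mul, im_mul, re_f hx', im_f hx', re_a', im_a', re_r hx' hy',
      im_r hx' hy', ← hA2, w, da_comm z x, db_comm z x]
    have e1 := h_mul_d_second_difference hx hz hxz
    have e2 := sub_mul_variation_f hx hz hxz
    have e3 := sub_mul_smul hxz (S.a' x - S.da x z)
    have e4 := sub_mul_da (S := S) hxz
    have e5 := sub_mul_db (S := S) hxz
    have fx := f_mul hx
    rw [← hA2] at e1 e3
    apply sub_cancel hxz
    generalize algebraMap ℝ S.R x = X at *
    generalize algebraMap ℝ S.R z = Z at *
    linear_combination (X - Z) * S.f x * e1 - S.a' x * e2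
      + S.f x * S.f z * (S.b z - S.a x) * e3 - S.f x * S.f z * S.a' x * e4
      - S.f x * S.f z * S.da x z * e5 - S.f z * e3
      + S.f z * (S.a' x - S.da x z) * fx
  rw [hval]
  refine lim.congr' ?_
  filter_upwards [eventually_mem_G hx, nhdsWithin_le_nhds (isOpen_ne.mem_nhds hxz)] with x' h1 h2
  simp only [slope, vsub_eq_sub]
  rw [tau_eq hz hx hy hxz hyz, tau_eq hz h1.1 hy h2 hyz]
  simp only [mul_smul_comm, smul_mul_assoc, map_smul, ← smul_add, ← smul_sub]
  congr 1
  rw [mul_sub, map_sub]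
  ring

/-- `tauDiag` is the limit of `tau z x y` as `z → x`. -/
theorem tendsto_tau {x y : ℝ} (hx : x ∈ S.G) (hy : y ∈ S.G) (hxy : x ≠ y) :
    Tendsto (fun z => S.tau z x y) (nhdsWithin x {x}ᶜ) (nhds (S.tauDiag x y)) := by
  have h1 : Tendsto (fun z => S.da x z) (nhdsWithin x {x}ᶜ) (nhds (S.a' x)) :=
    (S.slope_a x hx).congr fun z => by rw [da_comm, da, slope, vsub_eq_sub]
  have h2 : Tendsto (fun z => S.db z y) (nhdsWithin x {x}ᶜ) (nhds (S.db x y)) := by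
    have h3 : ContinuousAt (fun z : ℝ => (z - y)⁻¹) x :=
      ContinuousAt.inv₀ (by fun_prop) (sub_ne_zero.2 hxy)
    exact (h3.tendsto.mono_left nhdsWithin_le_nhds).smul ((tendsto_b hx).sub_const _)
  have h3 := (((((tendsto_f hx).mul h1).mul h2).mul_const (S.r x y)).const_smul (x - y)).neg
  -- The limit arises as one product; the difference form of `tauDiag` follows from (b(x) - b(y))
  -- f(x) r(x,y) = r(x,y) - f(x) + f(x) r(x,y) (b(x) - b(y) - (b(x) - a(x)) + (b(y) - a(x))), that
  -- is, from the inverse relations of f and r.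
  have hval : S.tauDiag x y = -((x - y) • (S.f x * S.a' x * S.db x y * S.r x y)) := ?_
  · rw [hval]; exact h3
  rw [tauDiag, Algebra.smul_def, map_sub]
  have e1 := sub_mul_db (S := S) hxy
  have e2 := r_mul hx hy
  have e3 := f_mul hx
  linear_combination S.f x * S.a' x * S.r x y * e1 - S.f x * S.a' x * e2 + S.a' x * S.r x y * e3

end AirySystem

/-! ### The formal WKB series -/

namespace AiryFormal
open PowerSeries

/-- The coefficients of the asymptotic series of `√x Ai(x) Bi(x)` in powers of `x ^ (-3/2)`. -/
def phiCoeff : ℕ → ℝ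
  | 0 => 1 / 2
  | 1 => 0
  -- The recursion comes from the third-order equation f''' = 4x f' + 2f satisfied by products of
  -- two Airy solutions.
  | m + 2 => (m + 1) * (15 + 9 * m) * (1 + 3 * m) / (48 * (m + 2)) * phiCoeff m

/-- The asymptotic series of `√x Ai(x) Bi(x)`. -/
def phi : ℝ⟦X⟧ := mk phiCoeff

/-- The asymptotic series of `(Ai Bi)'`. -/
def phi' : ℝ⟦X⟧ := -(C (1 / 2) * X * phi) - C (3 / 2) * X ^ 2 * d⁄dX ℝ phi

theorem coeff_phi (n : ℕ) : coeff n phi = phiCoeff n := coeff_mk _ _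

theorem coeff_succ_phi' (n : ℕ) : coeff (n + 1) phi' = -(1 / 2 + 3 / 2 * n) * phiCoeff n := by
  have h1 : phi' = X * (-(C (1 / 2) * phi) - C (3 / 2) * (X * d⁄dX ℝ phi)) := by
    rw [phi']; ring
  rw [h1, coeff_succ_X_mul, map_sub, map_neg, coeff_C_mul, coeff_C_mul, coeff_phi]
  cases n with
  | zero => simp
  | succ n => rw [coeff_succ_X_mul, coeff_derivative, coeff_phi]; push_cast; ring

theorem coeff_zero_phi' : coeff 0 phi' = 0 := by
  simp [phi', coeff_zero_eq_constantCoeff]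

theorem coeff_X_mul_derivative (s : ℝ⟦X⟧) (n : ℕ) : coeff n (X * d⁄dX ℝ s) = n * coeff n s := by
  cases n with
  | zero => simp
  | succ n => rw [coeff_succ_X_mul, coeff_derivative]; push_cast; ring

theorem C_ne_zero {c : ℝ} (hc : c ≠ 0) : (C c : ℝ⟦X⟧) ≠ 0 := fun h =>
  hc (by simpa using congrArg constantCoeff h)

/-- This is f''' = 4x f' + 2f, divided by x, for f = x^(-1/2) φ(x^(-3/2)); the variable X stands for
x^(-3/2). -/
theorem phi_linear :
    X ^ 3 * (C (15 / 4) * d⁄dX ℝ phi' + C (9 / 4) * (X * d⁄dX ℝ (d⁄dX ℝ phi'))) =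
      C 4 * phi' + C 2 * (X * phi) := by
  ext n
  rw [coeff_X_pow_mul', map_add, coeff_C_mul, coeff_C_mul]
  rcases n with _ | _ | _ | m
  · rw [if_neg (by norm_num), map_add, coeff_C_mul, coeff_C_mul, coeff_zero_phi',
      coeff_zero_X_mul]
    norm_num
  · rw [if_neg (by norm_num), map_add, coeff_C_mul, coeff_C_mul, coeff_succ_phi',
      coeff_succ_X_mul, coeff_phi]
    norm_num [phiCoeff]
  · rw [if_neg (by norm_num), map_add, coeff_C_mul, coeff_C_mul, coeff_succ_phi',
      coeff_succ_X_mul, coeff_phi]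
    norm_num [phiCoeff]
  · rw [if_pos (by omega), map_add, coeff_C_mul, coeff_C_mul,
      coeff_X_mul_derivative, show m + 1 + 1 + 1 - 3 = m by omega, coeff_derivative,
      coeff_succ_phi', coeff_succ_phi', coeff_succ_X_mul, coeff_phi, phiCoeff]
    push_cast
    field_simp
    ring

/-- The first integral 2 f f'' - f'² - 4x f² = -1. Its derivative is 2f (f''' - 4x f' - 2f) = 0, and
the constant is read off from the leading coefficient 1/2 of φ. -/
theorem phi_quadratic :
    -(C 3 * X ^ 2 * phi * d⁄dX ℝ phi') - phi' ^ 2 - C 4 * phi ^ 2 = C (-1) := by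
  set D := -(C 3 * X ^ 2 * phi * d⁄dX ℝ phi') - phi' ^ 2 - C 4 * phi ^ 2 with hD
  have hlin := phi_linear
  have hphi' : phi' = -(C (1 / 2) * X * phi) - C (3 / 2) * X ^ 2 * d⁄dX ℝ phi := rfl
  have c1 : (C (1 / 2) : ℝ⟦X⟧) * 2 = 1 := by
    rw [show (2 : ℝ⟦X⟧) = C 2 from (map_ofNat C 2).symm, ← map_mul]; norm_num
  have hdD : X ^ 2 * d⁄dX ℝ D = 0 := by
    have e1 : d⁄dX ℝ D = -(C 6 * X * phi * d⁄dX ℝ phi') - C 3 * X ^ 2 * d⁄dX ℝ phi * d⁄dX ℝ phi'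
        - C 3 * X ^ 2 * phi * d⁄dX ℝ (d⁄dX ℝ phi') - C 2 * phi' * d⁄dX ℝ phi'
        - C 8 * phi * d⁄dX ℝ phi := by
      simp only [hD, map_sub, map_neg, Derivation.leibniz, smul_eq_mul, sq, derivative_C,
        derivative_X]
      have : (C 6 : ℝ⟦X⟧) = 2 * C 3 := by
        rw [show (2 : ℝ⟦X⟧) = C 2 from (map_ofNat C 2).symm, ← map_mul]; norm_num
      have h8 : (C 8 : ℝ⟦X⟧) = 2 * C 4 := by
        rw [show (2 : ℝ⟦X⟧) = C 2 from (map_ofNat C 2).symm, ← map_mul]; norm_num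
      have h2 : (C 2 : ℝ⟦X⟧) = 2 := map_ofNat C 2
      rw [this, h8, h2]
      ring
    have h2 : (C 2 : ℝ⟦X⟧) = 2 := map_ofNat C 2
    have h3 : (C 3 : ℝ⟦X⟧) = 3 := map_ofNat C 3
    have h4 : (C 4 : ℝ⟦X⟧) = 4 := map_ofNat C 4
    have h6 : (C 6 : ℝ⟦X⟧) = 6 := map_ofNat C 6
    have h8 : (C 8 : ℝ⟦X⟧) = 8 := map_ofNat C 8
    have h15 : (C (15 / 4) : ℝ⟦X⟧) * 4 = 15 := by
      rw [← h4, ← map_mul]; norm_num; exact map_ofNat C 15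
    have h9 : (C (9 / 4) : ℝ⟦X⟧) * 4 = 9 := by
      rw [← h4, ← map_mul]; norm_num; exact map_ofNat C 9
    have h32 : (C (3 / 2) : ℝ⟦X⟧) * 2 = 3 := by
      rw [← h2, ← map_mul]; norm_num; exact map_ofNat C 3
    have h12 := c1
    rw [h2, h4] at hlin
    rw [e1, h2, h3, h6, h8]
    have three : (3 : ℝ⟦X⟧) ≠ 0 := h3 ▸ C_ne_zero three_ne_zero
    apply mul_left_cancel₀ three
    have key : 2 * phi' = -(X * phi) - 3 * X ^ 2 * d⁄dX ℝ phi := by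
      linear_combination 2 * hphi' - X * phi * h12 - X ^ 2 * d⁄dX ℝ phi * h32
    have key2 : X ^ 3 * (15 * d⁄dX ℝ phi' + 9 * (X * d⁄dX ℝ (d⁄dX ℝ phi'))) =
        16 * phi' + 8 * (X * phi) := by
      linear_combination 4 * hlin - X ^ 3 * d⁄dX ℝ phi' * h15
        - X ^ 4 * d⁄dX ℝ (d⁄dX ℝ phi') * h9
    linear_combination -phi * key2 + (-3 * X ^ 2 * d⁄dX ℝ phi' - 8 * phi) * key
  have hX : (X ^ 2 : ℝ⟦X⟧) ≠ 0 := pow_ne_zero _ X_ne_zero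
  have h0 : d⁄dX ℝ D = 0 := (mul_eq_zero.1 hdD).resolve_left hX
  ext n
  cases n with
  | zero =>
    have p0 : constantCoeff phi = 1 / 2 := by
      rw [← coeff_zero_eq_constantCoeff_apply, coeff_phi, phiCoeff]
    have p1 : constantCoeff phi' = 0 := by
      rw [← coeff_zero_eq_constantCoeff_apply, coeff_zero_phi']
    rw [coeff_zero_eq_constantCoeff_apply, coeff_zero_eq_constantCoeff_apply, hD]
    simp only [map_sub, map_neg, map_mul, map_pow, p0, p1, constantCoeff_X, constantCoeff_C]
    norm_num
  | succ n =>
    have := congrArg (coeff n) h0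
    rw [coeff_derivative, map_zero] at this
    rw [coeff_C, if_neg (Nat.succ_ne_zero n)]
    exact (mul_eq_zero.1 this).resolve_right (by positivity)

theorem two_phi_ne_zero : constantCoeff (C 2 * phi) ≠ 0 := by
  rw [map_mul, ← coeff_zero_eq_constantCoeff_apply phi, coeff_phi]
  norm_num [phiCoeff]

/-- The asymptotic series of `x ^ (-1/2) Ai'(x) / Ai(x)`. -/
def alpha : ℝ⟦X⟧ := (phi' - 1) * (C 2 * phi)⁻¹

/-- The asymptotic series of `x ^ (-1/2) Bi'(x) / Bi(x)`. -/
def beta : ℝ⟦X⟧ := (phi' + 1) * (C 2 * phi)⁻¹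

theorem alpha_mul : alpha * (C 2 * phi) = phi' - 1 := by
  rw [alpha, mul_assoc, PowerSeries.inv_mul_cancel _ two_phi_ne_zero, mul_one]

theorem beta_mul : beta * (C 2 * phi) = phi' + 1 := by
  rw [beta, mul_assoc, PowerSeries.inv_mul_cancel _ two_phi_ne_zero, mul_one]

theorem phi_mul_beta_sub_alpha : phi * (beta - alpha) = 1 := by
  have h2 : (C 2 : ℝ⟦X⟧) = 2 := map_ofNat C 2
  have h1 := alpha_mul
  have h3 := beta_mul
  rw [h2] at h1 h3
  have two : (2 : ℝ⟦X⟧) ≠ 0 := h2 ▸ C_ne_zero two_ne_zero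
  apply mul_left_cancel₀ two
  linear_combination h3 - h1

/-- If the first integral is -1 and e² = 1, then (f' + e)/(2f) solves w' + w² = x. The two signs of
e yield a and b with b - a = 1/f. -/
theorem riccati_of_mul {s e : ℝ⟦X⟧} (he : e ^ 2 = 1) (hde : d⁄dX ℝ e = 0)
    (h : s * (C 2 * phi) = phi' + e) :
    s ^ 2 + C (1 / 2) * (X * s) - C (3 / 2) * (X ^ 2 * d⁄dX ℝ s) = 1 := by
  have h2 : (C 2 : ℝ⟦X⟧) = 2 := map_ofNat C 2
  have h3 : (C 3 : ℝ⟦X⟧) = 3 := map_ofNat C 3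
  have h4 : (C 4 : ℝ⟦X⟧) = 4 := map_ofNat C 4
  have h32 : (C (3 / 2) : ℝ⟦X⟧) * 2 = 3 := by
    rw [← h2, ← map_mul, ← h3]; norm_num
  have h12 : (C (1 / 2) : ℝ⟦X⟧) * 2 = 1 := by
    rw [← h2, ← map_mul]; norm_num
  have hd := congrArg (d⁄dX ℝ) h
  have hq := phi_quadratic
  have hphi' : phi' = -(C (1 / 2) * X * phi) - C (3 / 2) * X ^ 2 * d⁄dX ℝ phi := rfl
  rw [map_neg, map_one] at hq
  have h0 : (C 2 * phi : ℝ⟦X⟧) ≠ 0 := fun h => two_phi_ne_zero (by rw [h, map_zero])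
  rw [map_add, hde] at hd
  simp only [Derivation.leibniz, smul_eq_mul, derivative_C, mul_zero, add_zero] at hd
  rw [h2] at h hd h0
  rw [h3, h4] at hq
  have key : 2 * phi' = -(X * phi) - 3 * X ^ 2 * d⁄dX ℝ phi := by
    linear_combination 2 * hphi' - X * phi * h12 - X ^ 2 * d⁄dX ℝ phi * h32
  apply mul_left_cancel₀ h0
  apply mul_left_cancel₀ h0
  linear_combination (2 * phi * s + phi' + e + X * phi) * h - 3 * X ^ 2 * phi * hd
    + 2 * phi * s * key - (2 * phi' + X * phi) * h + hq + he
    + 2 * phi ^ 2 * X * s * h12 - 2 * phi ^ 2 * X ^ 2 * d⁄dX ℝ s * h32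

theorem riccati_alpha :
    alpha ^ 2 + C (1 / 2) * (X * alpha) - C (3 / 2) * (X ^ 2 * d⁄dX ℝ alpha) = 1 :=
  riccati_of_mul (e := -1) (by ring) (by simp) (by rw [alpha_mul, sub_eq_add_neg])

theorem riccati_beta :
    beta ^ 2 + C (1 / 2) * (X * beta) - C (3 / 2) * (X ^ 2 * d⁄dX ℝ beta) = 1 :=
  riccati_of_mul (e := 1) (by ring) (by simp) beta_mul

theorem coeff_riccati {s : ℝ⟦X⟧}
    (h : s ^ 2 + C (1 / 2) * (X * s) - C (3 / 2) * (X ^ 2 * d⁄dX ℝ s) = 1) (n : ℕ) :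
    ∑ p ∈ antidiagonal (n + 1), coeff p.1 s * coeff p.2 s + (1 / 2 - 3 / 2 * n) * coeff n s = 0 := by
  have h1 := congrArg (coeff (n + 1)) h
  rw [sq, sq, mul_assoc X X, map_sub, map_add, coeff_mul, coeff_C_mul, coeff_C_mul,
    coeff_succ_X_mul, coeff_succ_X_mul, coeff_X_mul_derivative, coeff_one,
    if_neg (Nat.succ_ne_zero n)] at h1
  linear_combination h1

theorem rescale_phi : rescale (-1) phi = phi := by
  ext n
  rw [coeff_rescale, coeff_phi]
  induction n using Nat.twoStepInduction with
  | zero => simp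
  | one => simp [phiCoeff]
  | more m ih _ =>
    rw [phiCoeff, pow_add]
    linear_combination ((m : ℝ) + 1) * (15 + 9 * m) * (1 + 3 * m) / (48 * (m + 2)) * ih

theorem rescale_phi' : rescale (-1) phi' = -phi' := by
  ext n
  rw [coeff_rescale]
  cases n with
  | zero => rw [map_neg, coeff_zero_phi']; simp
  | succ n =>
    have h := congrArg (coeff n) rescale_phi
    rw [coeff_rescale, coeff_phi] at h
    rw [map_neg, coeff_succ_phi', pow_succ]
    linear_combination (1 / 2 + 3 / 2 * (n : ℝ)) * h

/-- The Riccati equation is preserved by (ħ, w) → (-ħ, -w), which exchanges the two solutions;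
concretely φ is even and the series of f' is odd. -/
theorem rescale_alpha : rescale (-1) alpha = -beta := by
  have h := congrArg (rescale (-1 : ℝ)) alpha_mul
  rw [map_mul, map_mul, map_sub, rescale_phi, rescale_phi', map_one,
    show rescale (-1 : ℝ) (C 2) = C 2 by ext n; rw [coeff_rescale, coeff_C]; split_ifs with h <;> simp [h]] at h
  have h0 : (C 2 * phi : ℝ⟦X⟧) ≠ 0 := fun h => two_phi_ne_zero (by rw [h, map_zero])
  apply mul_right_cancel₀ h0
  linear_combination h + beta_mul

theorem coeff_beta (n : ℕ) : coeff n beta = -((-1) ^ n * coeff n alpha) := by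
  have h := congrArg (coeff n) rescale_alpha
  rw [coeff_rescale, map_neg] at h
  linear_combination h

theorem coeff_zero_alpha : coeff 0 alpha = -1 := by
  have h := congrArg (coeff 0) alpha_mul
  simp only [coeff_zero_eq_constantCoeff, map_mul, map_sub, constantCoeff_C, map_one] at h
  rw [← coeff_zero_eq_constantCoeff_apply phi, ← coeff_zero_eq_constantCoeff_apply phi',
    coeff_zero_phi', coeff_phi, phiCoeff] at h
  rw [coeff_zero_eq_constantCoeff_apply]
  linarith

theorem coeff_zero_beta : coeff 0 beta = 1 := by
  rw [coeff_beta, coeff_zero_alpha]; norm_num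

end AiryFormal

/-! ### Topology of power series rings -/

section PowerSeriesTopology
open PowerSeries
open scoped PowerSeries.WithPiTopology
variable {A : Type} [CommRing A] [TopologicalSpace A] [IsTopologicalRing A]

theorem PowerSeries.isUnit_nhds
    (hU : ∀ r : A, IsUnit r → ∀ᶠ s in nhds r, IsUnit s) (p : A⟦X⟧) (hp : IsUnit p) :
    ∀ᶠ q in nhds p, IsUnit q := by
  have h1 := (PowerSeries.WithPiTopology.continuous_constantCoeff A).tendsto p
  filter_upwards [h1.eventually (hU _ (isUnit_iff_constantCoeff.1 hp))] with q hq
  exact isUnit_iff_constantCoeff.2 hq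

theorem PowerSeries.constantCoeff_inverse {p : A⟦X⟧} (hp : IsUnit p) :
    constantCoeff (Ring.inverse p) = Ring.inverse (constantCoeff p) := by
  have h1 : IsUnit (constantCoeff p) := isUnit_iff_constantCoeff.1 hp
  apply h1.mul_left_cancel
  rw [← map_mul, Ring.mul_inverse_cancel p hp, map_one, Ring.mul_inverse_cancel _ h1]

theorem PowerSeries.coeff_succ_inverse {p : A⟦X⟧} (hp : IsUnit p) (n : ℕ) :
    coeff (n + 1) (Ring.inverse p) = -(Ring.inverse (constantCoeff p) *
      ∑ i ∈ antidiagonal n, coeff (i.1 + 1) p * coeff i.2 (Ring.inverse p)) := by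
  have h1 : IsUnit (constantCoeff p) := isUnit_iff_constantCoeff.1 hp
  have h2 := congrArg (coeff (n + 1)) (Ring.mul_inverse_cancel p hp)
  rw [coeff_mul, coeff_one, if_neg (Nat.succ_ne_zero n), Nat.sum_antidiagonal_succ,
    coeff_zero_eq_constantCoeff_apply] at h2
  apply h1.mul_left_cancel
  linear_combination h2 + (∑ i ∈ antidiagonal n, coeff (i.1 + 1) p * coeff i.2 (Ring.inverse p)) *
    Ring.mul_inverse_cancel _ h1

/-- Each coefficient of the inverse is a polynomial in the inverse of the constant term, the
coefficients of the series and the earlier coefficients of the inverse; induct on the index. -/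
theorem PowerSeries.continuousAt_inverse
    (hR : ∀ r : A, IsUnit r → ContinuousAt Ring.inverse r)
    (hU : ∀ r : A, IsUnit r → ∀ᶠ s in nhds r, IsUnit s) (p : A⟦X⟧) (hp : IsUnit p) :
    ContinuousAt Ring.inverse p := by
  have h1 : IsUnit (constantCoeff p) := isUnit_iff_constantCoeff.1 hp
  have hc : ContinuousAt (fun q : A⟦X⟧ => Ring.inverse (constantCoeff q)) p :=
    ContinuousAt.comp (f := fun q : A⟦X⟧ => constantCoeff q) (hR _ h1)
      (PowerSeries.WithPiTopology.continuous_constantCoeff A).continuousAt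
  rw [ContinuousAt, PowerSeries.WithPiTopology.tendsto_iff_coeff_tendsto]
  intro n
  induction n using Nat.strong_induction_on with
  | _ n ih =>
    cases n with
    | zero =>
      rw [coeff_zero_eq_constantCoeff_apply, constantCoeff_inverse hp]
      refine hc.tendsto.congr' ?_
      filter_upwards [PowerSeries.isUnit_nhds hU p hp] with q hq
      rw [coeff_zero_eq_constantCoeff_apply, constantCoeff_inverse hq]
    | succ n =>
      rw [coeff_succ_inverse hp]
      have h2 : Tendsto (fun q : A⟦X⟧ => -(Ring.inverse (constantCoeff q) *
          ∑ i ∈ antidiagonal n, coeff (i.1 + 1) q * coeff i.2 (Ring.inverse q))) (nhds p)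
          (nhds (-(Ring.inverse (constantCoeff p) *
          ∑ i ∈ antidiagonal n, coeff (i.1 + 1) p * coeff i.2 (Ring.inverse p)))) := by
        refine (hc.tendsto.mul (tendsto_finsetSum _ fun i hi => Tendsto.mul ?_ (ih _ ?_))).neg
        · exact (PowerSeries.WithPiTopology.continuous_coeff A _).tendsto p
        · have := mem_antidiagonal.1 hi
          omega
      refine h2.congr' ?_
      filter_upwards [PowerSeries.isUnit_nhds hU p hp] with q hq
      rw [coeff_succ_inverse hq]

theorem PowerSeries.continuousSMul [Algebra ℝ A] [ContinuousSMul ℝ A] : ContinuousSMul ℝ A⟦X⟧ :=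
  ⟨continuous_pi fun d => by
    have h : Continuous fun q : ℝ × A⟦X⟧ => q.2 d :=
      (continuous_apply d).comp continuous_snd
    exact continuous_fst.smul h⟩

end PowerSeriesTopology

/-! ### Powers of `r + X` -/

namespace AiryFormal
open PowerSeries
open scoped PowerSeries.WithPiTopology

theorem succ_mul_choose (s : ℝ) (n : ℕ) :
    (n + 1) * Ring.choose s (n + 1) = (s - n) * Ring.choose s n := by
  have h1 := Ring.descPochhammer_eq_factorial_smul_choose s (n + 1)
  have h2 := Ring.descPochhammer_eq_factorial_smul_choose s n
  rw [descPochhammer_succ_right, Polynomial.smeval_mul, h2, Nat.factorial_succ] at h1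
  simp only [nsmul_eq_mul, Polynomial.smeval_sub, Polynomial.smeval_X, Polynomial.smeval_natCast,
    pow_one, pow_zero] at h1
  have h3 : (n.factorial : ℝ) ≠ 0 := by positivity
  apply mul_left_cancel₀ h3
  push_cast at h1
  linear_combination -h1

/-- The expansion of `(r + X) ^ s`. -/
def shiftPow (s r : ℝ) : ℝ⟦X⟧ := C (r ^ s) * rescale r⁻¹ (binomialSeries ℝ s)

theorem coeff_shiftPow (s : ℝ) {r : ℝ} (hr : 0 < r) (n : ℕ) :
    coeff n (shiftPow s r) = Ring.choose s n * r ^ (s - n) := by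
  rw [shiftPow, coeff_C_mul, coeff_rescale, binomialSeries_coeff, smul_eq_mul, mul_one,
    Real.rpow_sub hr, Real.rpow_natCast, inv_pow]
  field_simp

theorem shiftPow_mul (s s' : ℝ) {r : ℝ} (hr : 0 < r) :
    shiftPow s r * shiftPow s' r = shiftPow (s + s') r := by
  rw [shiftPow, shiftPow, shiftPow, binomialSeries_add, Real.rpow_add hr, map_mul, map_mul]
  ring

theorem shiftPow_one (r : ℝ) (hr : 0 < r) : shiftPow 1 r = C r + X := by
  have h := binomialSeries_nat (R := ℝ) (A := ℝ) 1
  rw [Nat.cast_one, pow_one] at h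
  rw [shiftPow, h, map_add, map_one, Real.rpow_one, rescale_X, mul_add, mul_one, ← mul_assoc,
    ← map_mul, mul_inv_cancel₀ hr.ne', map_one, one_mul]

theorem derivative_shiftPow (s : ℝ) {r : ℝ} (hr : 0 < r) :
    d⁄dX ℝ (shiftPow s r) = s • shiftPow (s - 1) r := by
  have hs : ∀ n : ℕ, (n + 1) * Ring.choose s (n + 1) = s * Ring.choose (s - 1) n := by
    intro n
    induction n with
    | zero => simp
    | succ n ih =>
      have h1 := succ_mul_choose s (n + 1)
      have h2 := succ_mul_choose (s - 1) n
      have h3 : ((n : ℝ) + 1) ≠ 0 := by positivity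
      apply mul_left_cancel₀ h3
      push_cast at *
      linear_combination (n + 1 : ℝ) * h1 + (s - (n + 1)) * ih - s * h2
  ext n
  rw [coeff_derivative, coeff_shiftPow _ hr, coeff_smul, coeff_shiftPow _ hr, smul_eq_mul]
  have : s - ((n + 1 : ℕ) : ℝ) = s - 1 - n := by push_cast; ring
  rw [this]
  linear_combination r ^ (s - 1 - n) * hs n

theorem constantCoeff_shiftPow (s : ℝ) {r : ℝ} (hr : 0 < r) :
    constantCoeff (shiftPow s r) = r ^ s := by
  rw [← coeff_zero_eq_constantCoeff_apply, coeff_shiftPow s hr]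
  simp

/-- The expansion depends on r and X through r + X only, so differentiation in r and in X agree. -/
theorem tendsto_slope_shiftPow (s : ℝ) {r : ℝ} (hr : 0 < r) :
    Tendsto (slope (shiftPow s) r) (nhdsWithin r {r}ᶜ) (nhds (d⁄dX ℝ (shiftPow s r))) := by
  rw [PowerSeries.WithPiTopology.tendsto_iff_coeff_tendsto]
  intro n
  have h1 : HasDerivAt (fun r : ℝ => Ring.choose s n * r ^ (s - n))
      (coeff n (d⁄dX ℝ (shiftPow s r))) r := by
    have h2 := (Real.hasDerivAt_rpow_const (x := r) (p := s - n) (Or.inl hr.ne')).const_mul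
      (Ring.choose s n)
    refine h2.congr_deriv ?_
    rw [coeff_derivative, coeff_shiftPow _ hr]
    have : s - ((n + 1 : ℕ) : ℝ) = s - n - 1 := by push_cast; ring
    rw [this]
    linear_combination -r ^ (s - n - 1) * succ_mul_choose s n
  refine h1.tendsto_slope.congr' ?_
  filter_upwards [nhdsWithin_le_nhds (lt_mem_nhds hr)] with r' hr'
  rw [slope, slope, coeff_smul, vsub_eq_sub, vsub_eq_sub, map_sub, coeff_shiftPow _ hr,
    coeff_shiftPow _ hr']

/-! ### The formal Airy system -/

/-- The formal solution of the Riccati equation attached to the series `s`. -/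
def wkb (s : ℝ⟦X⟧) (r : ℝ) : ℝ⟦X⟧⟦X⟧ := mk fun k => coeff k s • shiftPow (1 / 2 - 3 / 2 * k) r

/-- The coefficientwise derivative. -/
def coeffDeriv : ℝ⟦X⟧⟦X⟧ →ₗ[ℝ] ℝ⟦X⟧⟦X⟧ where
  toFun p := mk fun k => d⁄dX ℝ (coeff k p)
  map_add' p q := by ext1 k; simp
  map_smul' c p := by
    ext1 k
    rw [coeff_mk, RingHom.id_apply, coeff_smul, coeff_smul, coeff_mk, Derivation.map_smul]

theorem coeff_coeffDeriv (k : ℕ) (p : ℝ⟦X⟧⟦X⟧) :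
    coeff k (coeffDeriv p) = d⁄dX ℝ (coeff k p) :=
  coeff_mk k fun k => d⁄dX ℝ (coeff k p)

theorem continuous_coeffDeriv : Continuous coeffDeriv := by
  rw [continuous_iff_continuousAt]
  intro p
  rw [ContinuousAt, PowerSeries.WithPiTopology.tendsto_iff_coeff_tendsto]
  intro k
  rw [PowerSeries.WithPiTopology.tendsto_iff_coeff_tendsto]
  intro n
  simp only [coeff_coeffDeriv, coeff_derivative]
  exact ((((PowerSeries.WithPiTopology.continuous_coeff ℝ (n + 1)).comp
    (PowerSeries.WithPiTopology.continuous_coeff _ k)).tendsto p)).mul_const _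

/-- At each order in the outer variable all terms are multiples of a single power of r + X, and the
scalars satisfy the recursion `coeff_riccati`. The order 0 term is r + X itself, the parameter plus
the potential. -/
theorem riccati_wkb {s : ℝ⟦X⟧}
    (h : s ^ 2 + C (1 / 2) * (X * s) - C (3 / 2) * (X ^ 2 * d⁄dX ℝ s) = 1) {r : ℝ} (hr : 0 < r) :
    X * coeffDeriv (wkb s r) + wkb s r ^ 2 = algebraMap ℝ _ r + C X := by
  have e1 : (algebraMap ℝ ℝ⟦X⟧⟦X⟧ r) + C X = C (shiftPow 1 r) := by
    rw [shiftPow_one r hr, map_add, PowerSeries.algebraMap_apply, PowerSeries.algebraMap_apply]; rfl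
  rw [e1]
  ext1 k
  rw [map_add, sq, coeff_mul _ (wkb s r), coeff_C]
  have e2 : ∀ i ∈ antidiagonal k, coeff i.1 (wkb s r) * coeff i.2 (wkb s r) =
      (coeff i.1 s * coeff i.2 s) • shiftPow (1 - 3 / 2 * k) r := by
    intro i hi
    rw [wkb, coeff_mk, coeff_mk, smul_mul_smul_comm, shiftPow_mul _ _ hr,
      ← mem_antidiagonal.1 hi]
    congr 2
    push_cast
    ring
  rw [sum_congr rfl e2, ← sum_smul]
  cases k with
  | zero =>
    have h0 := congrArg (coeff 0) h
    simp [sq] at h0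
    simp [h0]
  | succ k =>
    rw [if_neg (Nat.succ_ne_zero k), coeff_succ_X_mul, coeff_coeffDeriv, wkb, coeff_mk,
      Derivation.map_smul, derivative_shiftPow _ hr, smul_smul]
    have h1 := coeff_riccati h k
    have h2 : (1 / 2 - 3 / 2 * k - 1 : ℝ) = 1 - 3 / 2 * (k + 1 : ℕ) := by push_cast; ring
    rw [h2, ← add_smul]
    have h3 : coeff k s * (1 / 2 - 3 / 2 * k) +
        ∑ i ∈ antidiagonal (k + 1), coeff i.1 s * coeff i.2 s = 0 := by
      linear_combination h1
    rw [h3, zero_smul]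

theorem tendsto_slope_wkb (s : ℝ⟦X⟧) {r : ℝ} (hr : 0 < r) :
    Tendsto (slope (wkb s) r) (nhdsWithin r {r}ᶜ) (nhds (coeffDeriv (wkb s r))) := by
  rw [PowerSeries.WithPiTopology.tendsto_iff_coeff_tendsto]
  intro k
  rw [coeff_coeffDeriv, wkb, coeff_mk, Derivation.map_smul]
  have : ContinuousSMul ℝ ℝ⟦X⟧ := PowerSeries.continuousSMul
  refine ((tendsto_slope_shiftPow (1 / 2 - 3 / 2 * k) hr).const_smul (coeff k s)).congr fun r' => ?_
  rw [slope, slope, coeff_smul, vsub_eq_sub, vsub_eq_sub, map_sub, wkb, wkb, coeff_mk, coeff_mk,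
    ← smul_sub, smul_comm]

theorem continuousAt_wkb (s : ℝ⟦X⟧) {r : ℝ} (hr : 0 < r) : ContinuousAt (wkb s) r := by
  have : ContinuousSMul ℝ ℝ⟦X⟧ := PowerSeries.continuousSMul
  have : ContinuousSMul ℝ ℝ⟦X⟧⟦X⟧ := PowerSeries.continuousSMul
  rw [continuousAt_iff_punctured_nhds]
  have h1 : Tendsto (fun y : ℝ => y - r) (nhdsWithin r {r}ᶜ) (nhds (r - r)) :=
    (Continuous.tendsto (by fun_prop) r).mono_left nhdsWithin_le_nhds
  have h2 := (h1.smul (tendsto_slope_wkb s hr)).add_const (wkb s r)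
  rw [sub_self, zero_smul, zero_add] at h2
  refine h2.congr fun y => ?_
  rw [sub_smul_slope, vsub_eq_sub, sub_add_cancel]

/-- The evaluation at `X = 0` of the coefficients. -/
def ev : ℝ⟦X⟧⟦X⟧ →+* ℝ⟦X⟧ := PowerSeries.map constantCoeff

theorem isUnit_of_constantCoeff_ev {p : ℝ⟦X⟧⟦X⟧} (hp : constantCoeff (ev p) ≠ 0) : IsUnit p := by
  rw [isUnit_iff_constantCoeff, isUnit_iff_constantCoeff, isUnit_iff_ne_zero]
  rwa [ev, ← coeff_zero_eq_constantCoeff_apply, coeff_map, coeff_zero_eq_constantCoeff_apply] at hp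

/-- The formal solution of the Riccati equation, numerically. -/
def wkbHat (s : ℝ⟦X⟧) (r : ℝ) : ℝ⟦X⟧ := mk fun k => coeff k s * r ^ (1 / 2 - 3 / 2 * k : ℝ)

theorem ev_wkb (s : ℝ⟦X⟧) {r : ℝ} (hr : 0 < r) : ev (wkb s r) = wkbHat s r := by
  ext k
  rw [ev, coeff_map, wkb, coeff_mk, wkbHat, coeff_mk, ← coeff_zero_eq_constantCoeff_apply,
    coeff_smul, coeff_zero_eq_constantCoeff_apply, constantCoeff_shiftPow _ hr, smul_eq_mul]

/-- The formal Airy system. -/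
def system : AirySystem :=
  have : ContinuousSMul ℝ ℝ⟦X⟧ := PowerSeries.continuousSMul
  have : ContinuousSMul ℝ ℝ⟦X⟧⟦X⟧ := PowerSeries.continuousSMul
  have hU : ∀ r : ℝ, IsUnit r → ∀ᶠ s in nhds r, IsUnit s := fun r hr => by
    filter_upwards [isOpen_ne.mem_nhds hr.ne_zero] with s hs
    exact isUnit_iff_ne_zero.2 hs
  have hR : ∀ r : ℝ, IsUnit r → ContinuousAt Ring.inverse r := fun r hr => by
    rw [Ring.inverse_eq_inv']
    exact continuousAt_inv₀ hr.ne_zero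
  { R := ℝ⟦X⟧⟦X⟧
    continuousAt_inverse := PowerSeries.continuousAt_inverse
      (PowerSeries.continuousAt_inverse hR hU) (PowerSeries.isUnit_nhds hU)
    isUnit_nhds := PowerSeries.isUnit_nhds (PowerSeries.isUnit_nhds hU)
    d := coeffDeriv
    d_mul := fun p q => by
      ext1 k
      rw [coeff_coeffDeriv, coeff_mul, map_sum, map_add, coeff_mul, coeff_mul,
        ← sum_add_distrib]
      refine sum_congr rfl fun i _ => ?_
      rw [Derivation.leibniz, coeff_coeffDeriv, coeff_coeffDeriv, smul_eq_mul, smul_eq_mul]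
      ring
    continuous_d := continuous_coeffDeriv
    G := Set.Ioi 0
    isOpen_G := isOpen_Ioi
    h := X
    d_h := by
      ext1 k
      rw [coeff_coeffDeriv, coeff_X]
      split_ifs <;> simp
    h_mul_cancel := fun p q h => X_mul_cancel h
    -- The outer variable is ħ and the inner one is the potential u. The solutions depend on x + u
    -- only, so the derivative in the parameter is again `coeffDeriv`.
    u := C X
    a := wkb alpha
    b := wkb beta
    a' := fun r => coeffDeriv (wkb alpha r)
    isUnit_sub := fun x hx y hy => by
      apply isUnit_of_constantCoeff_ev
      rw [map_sub, ev_wkb _ hx, ev_wkb _ hy, map_sub, ← coeff_zero_eq_constantCoeff_apply,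
        ← coeff_zero_eq_constantCoeff_apply, wkbHat, wkbHat, coeff_mk, coeff_mk, coeff_zero_alpha,
        coeff_zero_beta]
      have h1 := Real.rpow_pos_of_pos hx (1 / 2 - 3 / 2 * (0 : ℕ) : ℝ)
      have h2 := Real.rpow_pos_of_pos hy (1 / 2 - 3 / 2 * (0 : ℕ) : ℝ)
      apply ne_of_gt
      linarith
    riccati_a := fun x hx => riccati_wkb riccati_alpha hx
    riccati_b := fun x hx => riccati_wkb riccati_beta hx
    slope_a := fun x hx => tendsto_slope_wkb alpha hx
    continuousAt_b := fun x hx => continuousAt_wkb beta hx }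

end AiryFormal

/-! ### The formal correlation functions -/

namespace AiryFormal
open PowerSeries
open scoped PowerSeries.WithPiTopology

/-- The series `∑ s_k x ^ (e - 3k/2) ħ^k`. -/
def hat (e : ℝ) (s : ℝ⟦X⟧) (x : ℝ) : ℝ⟦X⟧ := C (x ^ e) * rescale (x ^ (-3 / 2 : ℝ)) s

theorem coeff_hat (e : ℝ) (s : ℝ⟦X⟧) {x : ℝ} (hx : 0 < x) (k : ℕ) :
    coeff k (hat e s x) = coeff k s * x ^ (e - 3 / 2 * k) := by
  rw [hat, coeff_C_mul, coeff_rescale, ← Real.rpow_mul_natCast hx.le, sub_eq_add_neg,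
    Real.rpow_add hx, show (-3 / 2 * k : ℝ) = -(3 / 2 * k) by ring]
  ring

theorem hat_mul (e e' : ℝ) (s s' : ℝ⟦X⟧) {x : ℝ} (hx : 0 < x) :
    hat e s x * hat e' s' x = hat (e + e') (s * s') x := by
  rw [hat, hat, hat, Real.rpow_add hx, map_mul, map_mul]
  ring

theorem hat_sub (e : ℝ) (s s' : ℝ⟦X⟧) (x : ℝ) : hat e (s - s') x = hat e s x - hat e s' x := by
  rw [hat, hat, hat, map_sub, mul_sub]

/-- The expansion of `Ai'/Ai`. -/
def aHat (x : ℝ) : ℝ⟦X⟧ := hat (1 / 2) alpha x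

/-- The expansion of `Bi'/Bi`. -/
def bHat (x : ℝ) : ℝ⟦X⟧ := hat (1 / 2) beta x

/-- The expansion of `Ai Bi`. -/
def fHat (x : ℝ) : ℝ⟦X⟧ := hat (-1 / 2) phi x

/-- The expansion of the kernel. -/
def kHat (x y : ℝ) : ℝ⟦X⟧ := (x - y)⁻¹ • (fHat y * (bHat y - aHat x))

/-- The expansion of the correlation functions. -/
def connHat : (n : ℕ) → (Fin n → ℝ) → ℝ⟦X⟧
  | 0, _ => 0
  | 1, x => fHat (x 0) * (aHat (x 0) * bHat (x 0) - C (x 0))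
  | m + 2, x => -C (if m = 0 then 1 / (x 0 - x 1) ^ 2 else 0)
      - (-1) ^ (m + 2) * cycleSum fun i j => kHat (x i) (x j)

theorem fHat_mul {x : ℝ} (hx : 0 < x) : fHat x * (bHat x - aHat x) = 1 := by
  rw [fHat, bHat, aHat, ← hat_sub, hat_mul _ _ _ _ hx, phi_mul_beta_sub_alpha, hat]
  norm_num

/-- The evaluation of the formal Airy system. -/
def evS : system.R →+* ℝ⟦X⟧ := ev

theorem evS_a {x : ℝ} (hx : 0 < x) : evS (system.a x) = aHat x := by
  refine (ev_wkb alpha hx).trans ?_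
  ext k
  rw [wkbHat, coeff_mk, aHat, coeff_hat _ _ hx]

theorem evS_b {x : ℝ} (hx : 0 < x) : evS (system.b x) = bHat x := by
  refine (ev_wkb beta hx).trans ?_
  ext k
  rw [wkbHat, coeff_mk, bHat, coeff_hat _ _ hx]

theorem ev_smul (c : ℝ) (p : ℝ⟦X⟧⟦X⟧) : ev (c • p) = c • ev p := by
  ext k
  rw [ev, coeff_map, coeff_smul, coeff_smul, coeff_map, ← coeff_zero_eq_constantCoeff_apply,
    coeff_smul, coeff_zero_eq_constantCoeff_apply]

theorem evS_smul (c : ℝ) (p : system.R) : evS (c • p) = c • evS p := ev_smul c p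

theorem evS_h : evS system.h = X := PowerSeries.map_X _

theorem evS_f {x : ℝ} (hx : 0 < x) : evS (system.f x) = fHat x := by
  have h1 := congrArg evS (AirySystem.f_mul (S := system) (x := x) hx)
  have h2 := fHat_mul hx
  rw [map_one, map_mul, map_sub, evS_a hx, evS_b hx] at h1
  linear_combination (fHat x) * h1 - evS (system.f x) * h2

theorem evS_k {x y : ℝ} (hx : 0 < x) (hy : 0 < y) : evS (system.k x y) = kHat x y := by
  rw [AirySystem.k, evS_smul, map_mul, map_sub, kHat, evS_f hy, evS_a hx, evS_b hy]

/-- A family of functions of tuples, as a function of lists. -/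
def onList {α : Type*} (Φ : (n : ℕ) → (Fin n → ℝ) → α) (l : List ℝ) : α := Φ l.length l.get

theorem onList_ofFn {α : Type*} (Φ : (n : ℕ) → (Fin n → ℝ) → α) {n : ℕ} (p : Fin n → ℝ) :
    onList Φ (List.ofFn p) = Φ n p :=
  congrArg (fun s : Σ n, Fin n → ℝ => Φ s.1 s.2) (List.equivSigmaTuple.right_inv ⟨n, p⟩)

theorem evS_cyc {l : List ℝ} (hl : ∀ x ∈ l, 0 < x) :
    evS (system.cyc l) = cycleSum fun i j => kHat (l.get i) (l.get j) := by
  refine (cycleSum_map evS _).trans ?_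
  congr 1
  funext i j
  exact evS_k (hl _ (List.get_mem l i)) (hl _ (List.get_mem l j))

/-- Constants are not moved by insertions. This confines the double pole of the correlation
functions to n = 2. -/
theorem topCoeff_one {L : List ℝ} (hL : L ≠ []) (S : AirySystem) :
    AirySystem.topCoeff L S 1 = 0 := by
  induction L generalizing S with
  | nil => exact absurd rfl hL
  | cons z L ih =>
    by_cases h : L = []
    · subst h
      exact AirySystem.im_one
    · exact (congrArg (S.im z) (ih h (S.step z))).trans (map_zero _)

/-- Combine `w_eq` with `h_pow_mul_topCoeff_cyc` and set the potential to zero: the n-point series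
is ħ^(n-2) times a mixed variation of the two-point function. This holds for n = 2 as well, where
the constant double pole is not varied. -/
theorem X_pow_mul_evS_topCoeff_w {L : List ℝ} {x y : ℝ} (hn : (L ++ [x, y]).Nodup)
    (hp : ∀ z ∈ L ++ [x, y], 0 < z) :
    X ^ L.length * evS (AirySystem.topCoeff L system ((AirySystem.insertList L system).w x y)) =
      onList connHat (L ++ [x, y]) := by
  obtain ⟨h1, h2, h3⟩ := List.nodup_append.1 hn
  have hx : x ∉ L := fun h => h3 x h x (by simp) rfl
  have hy : y ∉ L := fun h => h3 y h y (by simp) rfl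
  have hxy : x ≠ y := by simpa using h2
  have hG : ∀ z ∈ L, z ∈ system.G := fun z hz => hp z (List.mem_append_left _ hz)
  have hxG : x ∈ (AirySystem.insertList L system).G :=
    AirySystem.mem_insertList_G.2 ⟨hp x (by simp), hx, h1, hG⟩
  have hyG : y ∈ (AirySystem.insertList L system).G :=
    AirySystem.mem_insertList_G.2 ⟨hp y (by simp), hy, h1, hG⟩
  have e1 := AirySystem.h_pow_mul_topCoeff_cyc L [x, y] system le_rfl hn hp
  have e3 := congrArg evS e1
  rw [map_mul, map_mul, map_pow, map_pow, map_neg, map_one, evS_h, evS_cyc hp] at e3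
  have e5 : evS (AirySystem.topCoeff L system ((AirySystem.insertList L system).w x y)) =
      -((((x - y) ^ 2)⁻¹ : ℝ) • evS (AirySystem.topCoeff L system 1)) -
        evS (AirySystem.topCoeff L system ((AirySystem.insertList L system).cyc [x, y])) := by
    rw [AirySystem.w_eq hxG hyG hxy, map_sub, map_neg, map_smul, map_sub, map_neg, evS_smul]
  rw [e5, mul_sub, e3]
  have key : ∀ (l : List ℝ) (m : ℕ) (hm : l.length = m + 2), onList connHat l =
      -C (if m = 0 then (1 : ℝ) / (l[0] - l[1]) ^ 2 else 0)
      - (-1) ^ m * cycleSum fun i j => kHat (l.get i) (l.get j) := by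
    intro l m hm
    obtain ⟨p, rfl⟩ : ∃ p : Fin (m + 2) → ℝ, l = List.ofFn p :=
      ⟨fun i => l[i], by
        apply List.ext_getElem
        · simp [hm, -List.ofFn_succ]
        · intros; simp [-List.ofFn_succ]⟩
    rw [onList_ofFn, connHat, ← cycleSum_reindex (finCongr (List.length_ofFn (f := p)).symm),
      pow_add]
    simp [-List.ofFn_succ]
  rw [key (L ++ [x, y]) L.length (by simp)]
  congr 1
  by_cases hL : L = []
  · subst hL
    simp only [List.length_nil, pow_zero, one_mul, if_true, List.nil_append]
    rw [show AirySystem.topCoeff [] system 1 = 1 from rfl, map_one, ← one_div,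
      PowerSeries.smul_eq_C_mul, mul_one]
    rfl
  · rw [topCoeff_one hL, if_neg (by simpa using hL), map_zero, map_zero, smul_zero, neg_zero,
      mul_zero]

theorem exists_append_pair {n : ℕ} (p : Fin (n + 2) → ℝ) :
    ∃ L x y, List.ofFn p = L ++ [x, y] ∧ L.length = n := by
  refine ⟨List.ofFn fun i : Fin n => p i.castSucc.castSucc, p (Fin.last n).castSucc,
    p (Fin.last (n + 1)), ?_, by simp⟩
  rw [List.ofFn_succ', List.ofFn_succ']
  simp

theorem coeff_connHat_of_lt {n : ℕ} {p : Fin n → ℝ} (hp : ∀ i, 0 < p i)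
    (hi : Function.Injective p) {k : ℕ} (hk : k < n - 2) : coeff k (connHat n p) = 0 := by
  obtain ⟨m, rfl⟩ : ∃ m, n = m + 2 := ⟨n - 2, by omega⟩
  obtain ⟨L, x, y, hL, hm⟩ := exists_append_pair p
  rw [← onList_ofFn connHat p, hL, ← X_pow_mul_evS_topCoeff_w, coeff_X_pow_mul', if_neg (by omega)]
  · rw [← hL]; exact List.nodup_ofFn.2 hi
  · rw [← hL]
    intro z hz
    obtain ⟨i, rfl⟩ := (List.mem_ofFn' _ _).1 hz
    exact hp i

theorem coeff_evS_topCoeff_w {L : List ℝ} {x y : ℝ} (hn : (L ++ [x, y]).Nodup)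
    (hp : ∀ z ∈ L ++ [x, y], 0 < z) (k : ℕ) :
    coeff k (evS (AirySystem.topCoeff L system ((AirySystem.insertList L system).w x y))) =
      coeff (L.length + k) (onList connHat (L ++ [x, y])) := by
  rw [← X_pow_mul_evS_topCoeff_w hn hp, coeff_X_pow_mul', if_pos (by omega), Nat.add_sub_cancel_left]

theorem rescale_hat (e : ℝ) (s : ℝ⟦X⟧) (x : ℝ) :
    rescale (-1) (hat e s x) = hat e (rescale (-1) s) x := by
  ext k
  rw [coeff_rescale, hat, hat, coeff_C_mul, coeff_C_mul, coeff_rescale, coeff_rescale,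
    coeff_rescale]
  ring

theorem rescale_aHat (x : ℝ) : rescale (-1) (aHat x) = -bHat x := by
  rw [aHat, rescale_hat, rescale_alpha, bHat, hat, hat, map_neg, mul_neg]

theorem rescale_beta : rescale (-1) beta = -alpha := by
  ext n
  rw [coeff_rescale, coeff_beta, map_neg]
  have : ((-1 : ℝ) ^ n) * (-1) ^ n = 1 := by rw [← mul_pow]; simp
  linear_combination -coeff n alpha * this

theorem rescale_bHat (x : ℝ) : rescale (-1) (bHat x) = -aHat x := by
  rw [aHat, bHat, rescale_hat, rescale_beta, hat, hat, map_neg, mul_neg]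

theorem rescale_fHat (x : ℝ) : rescale (-1) (fHat x) = fHat x := by
  rw [fHat, rescale_hat, rescale_phi]

theorem rescale_C (c : ℝ) : rescale (-1 : ℝ) (C c) = C c := by
  ext n
  rw [coeff_rescale, coeff_C]
  split_ifs with h <;> simp [h]

theorem fHat_ne_zero {x : ℝ} (hx : 0 < x) : fHat x ≠ 0 := fun h => by
  have := fHat_mul hx
  rw [h, zero_mul] at this
  exact zero_ne_one this

/-- Under ħ → -ħ the difference b(y) - a(x) becomes b(x) - a(y). So k(x,y) turns into -k(y,x) times
f(y)/f(x): a transposition, one sign per factor, and a conjugation that cancels around a cycle. -/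
theorem rescale_cycleSum_kHat {n : ℕ} {p : Fin n → ℝ} (hp : ∀ i, 0 < p i) :
    rescale (-1) (cycleSum fun i j => kHat (p i) (p j)) =
      (-1) ^ n * cycleSum fun i j => kHat (p i) (p j) := by
  rw [cycleSum_map]
  have h1 : ∀ i j, rescale (-1) (kHat (p i) (p j)) =
      (p i - p j)⁻¹ • (fHat (p j) * (bHat (p i) - aHat (p j))) := by
    intro i j
    rw [kHat, PowerSeries.smul_eq_C_mul, map_mul, map_mul, map_sub, rescale_aHat, rescale_bHat,
      rescale_fHat, rescale_C, PowerSeries.smul_eq_C_mul]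
    ring
  rw [← cycleSum_transpose]
  have h3 : (-1 : ℝ⟦X⟧) ^ n * cycleSum (fun i j => kHat (p i) (p j)) =
      cycleSum fun i j => -kHat (p i) (p j) := by
    rw [cycleSum, cycleSum, mul_sum]
    refine sum_congr rfl fun σ _ => ?_
    rw [prod_neg, card_univ, Fintype.card_fin]
  rw [h3]
  refine cycleSum_congr_of_prod fun σ _ => ?_
  have hF : ∏ i, fHat (p (σ i)) = ∏ i, fHat (p i) := Equiv.prod_comp σ fun i => fHat (p i)
  have hne : ∏ i, fHat (p i) ≠ 0 := prod_ne_zero_iff.2 fun i _ => fHat_ne_zero (hp i)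
  apply mul_left_cancel₀ hne
  conv_lhs => rw [← hF]
  rw [← prod_mul_distrib, ← prod_mul_distrib]
  refine prod_congr rfl fun i _ => ?_
  rw [h1, kHat, PowerSeries.smul_eq_C_mul, PowerSeries.smul_eq_C_mul, ← neg_sub (p i), inv_neg,
    map_neg]
  ring

theorem rescale_connHat {n : ℕ} {p : Fin n → ℝ} (hp : ∀ i, 0 < p i) :
    rescale (-1) (connHat n p) = (-1) ^ (n - 2) * connHat n p := by
  match n, p with
  | 0, _ => simp [connHat]
  | 1, p =>
    rw [connHat, map_mul, map_sub, map_mul, rescale_aHat, rescale_bHat, rescale_fHat, rescale_C]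
    rw [show 1 - 2 = 0 from rfl, pow_zero]
    ring
  | m + 2, p =>
    rw [connHat, map_sub, map_neg, rescale_C, map_mul, rescale_cycleSum_kHat hp, map_pow, map_neg,
      map_one, Nat.add_sub_cancel]
    have : C (if m = 0 then 1 / (p 0 - p 1) ^ 2 else 0) =
        (-1) ^ m * (C (if m = 0 then 1 / (p 0 - p 1) ^ 2 else 0) : ℝ⟦X⟧) := by
      split_ifs with h
      · simp [h]
      · rw [map_zero, mul_zero]
    rw [mul_sub, mul_neg, ← this, pow_add]
    ring

theorem coeff_connHat_of_odd {n : ℕ} {p : Fin n → ℝ} (hp : ∀ i, 0 < p i) {j : ℕ} (hj : Odd j) :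
    coeff (n - 2 + j) (connHat n p) = 0 := by
  have h := congrArg (coeff (n - 2 + j)) (rescale_connHat hp)
  have e : ((-1 : ℝ⟦X⟧)) ^ (n - 2) = C ((-1) ^ (n - 2)) := by simp
  rw [coeff_rescale, e, coeff_C_mul, pow_add, hj.neg_one_pow] at h
  rcases neg_one_pow_eq_or ℝ (n - 2) with h' | h' <;> rw [h'] at h <;> linarith

theorem connHat_comp {n : ℕ} (p : Fin n → ℝ) (e : Equiv.Perm (Fin n)) :
    connHat n (p ∘ e) = connHat n p := by
  match n, p with
  | 0, _ => rfl
  | 1, p => rw [Subsingleton.elim e 1]; rfl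
  | m + 2, p =>
    rw [connHat, connHat, ← cycleSum_reindex e fun i j => kHat (p i) (p j)]
    congr 3
    split_ifs with h
    · subst h
      have h0 : ∀ i : Fin 2, i = 0 ∨ i = 1 := by decide
      have h01 : e 0 ≠ e 1 := fun h => absurd (e.injective h) (by decide)
      simp only [Function.comp]
      rcases h0 (e 0) with a | a <;> rcases h0 (e 1) with b | b
      · exact absurd (a.trans b.symm) h01
      · rw [a, b]
      · rw [a, b, ← neg_sub, neg_sq]
      · exact absurd (a.trans b.symm) h01
    · rfl

end AiryFormal

/-! ### Antisymmetric polynomials -/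

section Antisymmetric
open MvPolynomial
variable {n : ℕ}

/-- The substitution of `X j` for `X i`. -/
def MvPolynomial.identify (i j : Fin n) : MvPolynomial (Fin n) ℝ →ₐ[ℝ] MvPolynomial (Fin n) ℝ :=
  aeval (Function.update X i (X j))

/-- Modulo X i - X j the identification of the two variables is the identity. -/
theorem MvPolynomial.X_sub_X_dvd {i j : Fin n} {P : MvPolynomial (Fin n) ℝ}
    (h : identify i j P = 0) : X i - X j ∣ P := by
  have h1 : (Ideal.Quotient.mkₐ ℝ (Ideal.span {(X i - X j : MvPolynomial (Fin n) ℝ)})).comp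
      (identify i j) = Ideal.Quotient.mkₐ ℝ _ := by
    apply algHom_ext
    intro k
    rw [AlgHom.comp_apply, identify, aeval_X]
    by_cases hk : k = i
    · subst hk
      rw [Function.update_self]
      refine (Ideal.Quotient.mk_eq_mk_iff_sub_mem _ _).2 ?_
      have h0 := Ideal.mem_span_singleton_self (X k - X j : MvPolynomial (Fin n) ℝ)
      have h1 := (Ideal.neg_mem_iff _).2 h0
      rwa [neg_sub] at h1
    · rw [Function.update_of_ne hk]
  have h2 := DFunLike.congr_fun h1 P
  rw [AlgHom.comp_apply, h, map_zero] at h2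
  exact Ideal.mem_span_singleton.1 (Ideal.Quotient.eq_zero_iff_mem.1 h2.symm)

/-- The pairs `i < j`. -/
def ltPairs (n : ℕ) : Finset (Fin n × Fin n) := univ.filter fun q => q.1 < q.2

theorem det_vandermonde_eq_prod_ltPairs {R : Type*} [CommRing R] (v : Fin n → R) :
    (Matrix.vandermonde v).det = ∏ q ∈ ltPairs n, (v q.2 - v q.1) := by
  rw [Matrix.det_vandermonde, ltPairs, prod_filter, ← univ_product_univ, prod_product]
  refine prod_congr rfl fun i _ => ?_
  rw [← prod_filter]
  refine prod_congr ?_ fun _ _ => rfl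
  ext j
  simp

theorem MvPolynomial.prod_ltPairs_dvd {P : MvPolynomial (Fin n) ℝ}
    (h : ∀ i j, i < j → identify j i P = 0) : ∏ q ∈ ltPairs n, (X q.2 - X q.1) ∣ P := by
  have key : ∀ s ⊆ ltPairs n, ∏ q ∈ s, (X q.2 - X q.1 : MvPolynomial (Fin n) ℝ) ∣ P := by
    intro s
    induction s using Finset.induction_on with
    | empty => simp
    | insert q s hq ih =>
      intro hs
      obtain ⟨Q, hQ⟩ := ih ((subset_insert q s).trans hs)
      have hq1 : q.1 < q.2 := (mem_filter.1 (hs (mem_insert_self q s))).2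
      have h1 := h q.1 q.2 hq1
      rw [hQ, map_mul, map_prod] at h1
      -- A difference other than X q.2 - X q.1 stays nonzero when these two variables are
      -- identified, so it cannot account for the vanishing and the new factor divides the cofactor.
      have h2 : ∏ q' ∈ s, identify q.2 q.1 (X q'.2 - X q'.1) ≠ 0 := by
        refine prod_ne_zero_iff.2 fun q' hq' => ?_
        have hlt : q'.1 < q'.2 := (mem_filter.1 (hs (mem_insert_of_mem hq'))).2
        have hne : q' ≠ q := fun h => hq (h ▸ hq')
        rw [map_sub, identify, aeval_X, aeval_X, sub_ne_zero]
        intro heq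
        by_cases e1 : q'.2 = q.2 <;> by_cases e2 : q'.1 = q.2
        · exact hlt.ne (e2.trans e1.symm)
        · rw [e1, Function.update_self, Function.update_of_ne e2] at heq
          exact hne (Prod.ext (X_injective heq).symm e1)
        · rw [e2, Function.update_self, Function.update_of_ne e1] at heq
          have := X_injective heq
          omega
        · rw [Function.update_of_ne e1, Function.update_of_ne e2] at heq
          exact hlt.ne (X_injective heq).symm
      obtain ⟨Q', hQ'⟩ := X_sub_X_dvd ((mul_eq_zero.1 h1).resolve_left h2)
      rw [prod_insert hq, hQ, hQ']
      exact ⟨Q', by ring⟩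
  exact key _ subset_rfl

/-- Multiplication by the Vandermonde determinant makes the two sides agree at coinciding points
too, so they agree on a product of infinite sets. -/
theorem MvPolynomial.eq_of_eval_injective {P Q : MvPolynomial (Fin n) ℝ}
    (h : ∀ p : Fin n → ℝ, (∀ i, 0 < p i) → Function.Injective p → eval p P = eval p Q) :
    P = Q := by
  have hV : (Matrix.vandermonde (X : Fin n → MvPolynomial (Fin n) ℝ)).det ≠ 0 :=
    Matrix.det_vandermonde_ne_zero_iff.2 X_injective
  apply mul_right_cancel₀ hV
  refine funext_set (fun _ => Set.Ioi (0 : ℝ)) (fun _ => Set.Ioi_infinite 0) fun p hp => ?_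
  rw [map_mul, map_mul]
  by_cases hi : Function.Injective p
  · rw [h p (fun i => hp i trivial) hi]
  · have : eval p (Matrix.vandermonde (X : Fin n → MvPolynomial (Fin n) ℝ)).det = 0 := by
      rw [Matrix.det_vandermonde, map_prod]
      simp only [map_prod, map_sub, eval_X]
      rw [← Matrix.det_vandermonde]
      by_contra h0
      exact hi (Matrix.det_vandermonde_ne_zero_iff.1 h0)
    rw [this, mul_zero, mul_zero]

theorem MvPolynomial.prod_ltPairs_dvd_of_antisymm {P : MvPolynomial (Fin n) ℝ}
    (h : ∀ i j, i ≠ j → rename (Equiv.swap i j) P = -P) :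
    ∏ q ∈ ltPairs n, (X q.2 - X q.1) ∣ P := by
  refine prod_ltPairs_dvd fun i j hij => ?_
  have h1 : (identify j i).comp (rename (Equiv.swap i j)) = identify (n := n) j i := by
    apply algHom_ext
    intro k
    rw [AlgHom.comp_apply, rename_X, identify, aeval_X, aeval_X]
    by_cases hki : k = i
    · subst hki
      rw [Equiv.swap_apply_left, Function.update_self, Function.update_of_ne hij.ne]
    · by_cases hkj : k = j
      · subst hkj
        rw [Equiv.swap_apply_right, Function.update_self, Function.update_of_ne hij.ne]
      · rw [Equiv.swap_apply_of_ne_of_ne hki hkj]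
  have h2 := DFunLike.congr_fun h1 P
  rw [AlgHom.comp_apply, h i j hij.ne, map_neg] at h2
  exact self_eq_neg.1 h2.symm

end Antisymmetric

/-! ### Cancellation of the poles at coinciding points -/

namespace AiryFormal
open PowerSeries

/-- The numerator of the kernel, in terms of the variables `x ^ (-1/2)`. -/
def kNum {n : ℕ} (i j : Fin n) : (MvPolynomial (Fin n) ℝ)⟦X⟧ :=
  C (MvPolynomial.X i * MvPolynomial.X j ^ 2) *
    (rescale (MvPolynomial.X j ^ 3) (PowerSeries.map MvPolynomial.C phi) *
      (C (MvPolynomial.X i) * rescale (MvPolynomial.X j ^ 3) (PowerSeries.map MvPolynomial.C beta) -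
        C (MvPolynomial.X j) *
          rescale (MvPolynomial.X i ^ 3) (PowerSeries.map MvPolynomial.C alpha)))

theorem map_rescale_map {n : ℕ} (p : Fin n → ℝ) (i : Fin n) (s : ℝ⟦X⟧) :
    PowerSeries.map (MvPolynomial.eval p)
      (rescale (MvPolynomial.X i ^ 3) (PowerSeries.map MvPolynomial.C s)) =
      rescale (p i ^ 3) s := by
  ext k
  rw [coeff_map, coeff_rescale, coeff_rescale, coeff_map, map_mul, map_pow, map_pow,
    MvPolynomial.eval_X, MvPolynomial.eval_C]

/-- In the variables p = x^(-1/2) all coefficients become polynomial except for the leading power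
p⁻¹ of a and b, which the factor 1/(x - y) = p² q²/(q² - p²) clears. The only remaining denominator
is q² - p². -/
theorem kHat_eq {n : ℕ} {x : Fin n → ℝ} (hx : ∀ i, 0 < x i) {i j : Fin n} :
    kHat (x i) (x j) = ((x j ^ (-1 / 2 : ℝ)) ^ 2 - (x i ^ (-1 / 2 : ℝ)) ^ 2)⁻¹ •
      PowerSeries.map (MvPolynomial.eval fun i => x i ^ (-1 / 2 : ℝ)) (kNum i j) := by
  rw [kNum]
  simp only [map_mul, map_sub, map_rescale_map, map_C, MvPolynomial.eval_X, map_pow]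
  have h3 : ∀ y : ℝ, 0 < y → (y ^ (-1 / 2 : ℝ)) ^ 3 = y ^ (-3 / 2 : ℝ) := fun y hy => by
    rw [← Real.rpow_mul_natCast hy.le]; norm_num
  have h2 : ∀ y : ℝ, 0 < y → (y ^ (-1 / 2 : ℝ)) ^ 2 = y⁻¹ := fun y hy => by
    rw [← Real.rpow_mul_natCast hy.le, ← Real.rpow_neg_one]; norm_num
  have h1 : ∀ y : ℝ, 0 < y → y ^ (1 / 2 : ℝ) = (y ^ (-1 / 2 : ℝ))⁻¹ := fun y hy => by
    rw [← Real.rpow_neg hy.le]; norm_num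
  have hi := Real.rpow_pos_of_pos (hx i) (-1 / 2)
  have hj := Real.rpow_pos_of_pos (hx j) (-1 / 2)
  have e2i := h2 _ (hx i)
  have e2j := h2 _ (hx j)
  have c0 : (x i - x j)⁻¹ = ((x j ^ (-1 / 2 : ℝ)) ^ 2 - (x i ^ (-1 / 2 : ℝ)) ^ 2)⁻¹ *
      ((x i ^ (-1 / 2 : ℝ)) ^ 2 * (x j ^ (-1 / 2 : ℝ)) ^ 2) := by
    have hxi := (hx i).ne'
    have hxj := (hx j).ne'
    rw [e2i, e2j, show (x j)⁻¹ - (x i)⁻¹ = (x i - x j) / (x i * x j) by field_simp, inv_div]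
    field_simp
  rw [h3 _ (hx i), h3 _ (hx j), kHat, fHat, bHat, aHat, hat, hat, hat, h1 _ (hx i), h1 _ (hx j), c0]
  simp only [PowerSeries.smul_eq_C_mul]
  generalize x i ^ (-1 / 2 : ℝ) = p at *
  generalize x j ^ (-1 / 2 : ℝ) = q at *
  have c2 : (C p⁻¹ : ℝ⟦X⟧) * C p = 1 := by rw [← map_mul, inv_mul_cancel₀ hi.ne', map_one]
  have c3 : (C q⁻¹ : ℝ⟦X⟧) * C q = 1 := by rw [← map_mul, inv_mul_cancel₀ hj.ne', map_one]
  rw [map_mul, map_mul, map_pow, map_pow]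
  generalize rescale _ phi = F
  generalize rescale _ beta = B
  generalize rescale _ alpha = A
  linear_combination C ((q ^ 2 - p ^ 2)⁻¹) * C p * C q ^ 2 * F *
    (C p * B * c3 - C q * A * c2)

/-- For a cycle of length at least 3 the edges {i, σ i} are distinct unordered pairs, so each
difference occurs only once. For n = 2 the single edge is used twice, which is the double pole. -/
theorem prod_dvd_vandermonde {n : ℕ} (hn : 3 ≤ n) {σ : Equiv.Perm (Fin n)}
    (hσ : σ.IsCycle ∧ σ.support = univ) :
    ∏ i, (MvPolynomial.X (σ i) ^ 2 - MvPolynomial.X i ^ 2 : MvPolynomial (Fin n) ℝ) ∣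
      ∏ q ∈ ltPairs n, (MvPolynomial.X q.2 ^ 2 - MvPolynomial.X q.1 ^ 2) := by
  have h0 : ∀ i, σ i ≠ i := fun i => Equiv.Perm.mem_support.1 (hσ.2 ▸ mem_univ i)
  have h2 : ∀ i, σ (σ i) ≠ i := by
    intro i hi
    have hsq : (σ ^ 2) i = i := by rw [sq]; exact hi
    have h1 := hσ.1.pow_eq_one_iff (n := 2) |>.2 ⟨i, h0 i, hsq⟩
    have h3 := orderOf_dvd_of_pow_eq_one h1
    rw [hσ.1.orderOf, hσ.2, card_univ, Fintype.card_fin] at h3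
    have := Nat.le_of_dvd two_pos h3
    omega
  let m : Fin n → Fin n × Fin n := fun i => if i < σ i then (i, σ i) else (σ i, i)
  have hm : Function.Injective m := by
    intro i j hij
    simp only [m] at hij
    split_ifs at hij with a b b <;> simp only [Prod.mk.injEq] at hij
    · exact hij.1
    · exact absurd (by rw [hij.2, ← hij.1] : σ (σ i) = i) (by
        rw [hij.2]
        intro h
        exact h2 i (by rw [hij.2, h]))
    · exact absurd (by rw [hij.1, ← hij.2]) (h2 i)
    · exact hij.2
  have hmem : univ.image m ⊆ ltPairs n := by
    intro q hq
    obtain ⟨i, -, rfl⟩ := mem_image.1 hq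
    refine mem_filter.2 ⟨mem_univ _, ?_⟩
    simp only [m]
    split_ifs with a
    · exact a
    · exact lt_of_le_of_ne (not_lt.1 a) (h0 i)
  refine Dvd.dvd.trans ?_ (prod_dvd_prod_of_subset _ _ _ hmem)
  rw [prod_image fun i _ j _ h => hm h]
  refine prod_dvd_prod_of_dvd _ _ fun i _ => ?_
  simp only [m]
  split_ifs with a
  · exact dvd_rfl
  · rw [← neg_sub]; exact neg_dvd.2 dvd_rfl

/-- Multiplying by V, the product of the p_j² - p_i², gives a polynomial P. The cycle sum is
symmetric and V is antisymmetric, so P is antisymmetric and divisible by the product of the p_j -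
p_i. What is left of V is the product of the p_j + p_i, positive on the orthant. -/
theorem exists_extension_cycleSum {n : ℕ} (hn : 3 ≤ n) (k : ℕ) :
    ∃ g : (Fin n → ℝ) → ℝ, ContinuousOn g {x | ∀ i, 0 < x i} ∧
      ∀ x : Fin n → ℝ, (∀ i, 0 < x i) → Function.Injective x →
        coeff k (cycleSum fun i j => kHat (x i) (x j)) = g x := by
  classical
  let V : MvPolynomial (Fin n) ℝ :=
    ∏ q ∈ ltPairs n, (MvPolynomial.X q.2 ^ 2 - MvPolynomial.X q.1 ^ 2)
  have hQ : ∀ σ : Equiv.Perm (Fin n), ∃ Q : MvPolynomial (Fin n) ℝ,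
      σ.IsCycle ∧ σ.support = univ →
        V = (∏ i, (MvPolynomial.X (σ i) ^ 2 - MvPolynomial.X i ^ 2)) * Q := by
    intro σ
    by_cases hσ : σ.IsCycle ∧ σ.support = univ
    · obtain ⟨Q, hQ⟩ := prod_dvd_vandermonde hn hσ
      exact ⟨Q, fun _ => hQ⟩
    · exact ⟨0, fun h => absurd h hσ⟩
  choose Q hQ using hQ
  let P : MvPolynomial (Fin n) ℝ := ∑ σ : Equiv.Perm (Fin n) with σ.IsCycle ∧ σ.support = univ,
    coeff k (∏ i, kNum i (σ i)) * Q σ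
  let pt : (Fin n → ℝ) → Fin n → ℝ := fun x i => x i ^ (-1 / 2 : ℝ)
  have hpt : ∀ x : Fin n → ℝ, (∀ i, 0 < x i) → Function.Injective x → Function.Injective (pt x) := by
    intro x hx hi i j hij
    apply hi
    have := congrArg (fun t : ℝ => t ^ (-2 : ℝ)) hij
    simp only [pt] at this
    rw [← Real.rpow_mul (hx i).le, ← Real.rpow_mul (hx j).le] at this
    norm_num at this
    exact this
  have hsq : ∀ p : Fin n → ℝ, (∀ i, 0 < p i) → Function.Injective p →
      Function.Injective fun i => p i ^ 2 := by
    intro p hp hi i j hij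
    exact hi ((sq_eq_sq₀ (hp i).le (hp j).le).1 hij)
  have hV : ∀ p : Fin n → ℝ, MvPolynomial.eval p V = (Matrix.vandermonde fun i => p i ^ 2).det := by
    intro p
    rw [det_vandermonde_eq_prod_ltPairs]
    simp [V]
  have hP : ∀ x : Fin n → ℝ, (∀ i, 0 < x i) → Function.Injective x →
      MvPolynomial.eval (pt x) P = MvPolynomial.eval (pt x) V *
        coeff k (cycleSum fun i j => kHat (x i) (x j)) := by
    intro x hx hi
    rw [cycleSum, map_sum, map_sum, mul_sum]
    refine sum_congr rfl fun σ hσ => ?_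
    have hσ' := (mem_filter.1 hσ).2
    have e1 : ∏ i, kHat (x i) (x (σ i)) =
        (∏ i, (pt x (σ i) ^ 2 - pt x i ^ 2)⁻¹) • PowerSeries.map (MvPolynomial.eval (pt x))
          (∏ i, kNum i (σ i)) := by
      rw [map_prod, ← Finset.prod_smul]
      exact prod_congr rfl fun i _ => kHat_eq hx
    have e2 : ∏ i, (pt x (σ i) ^ 2 - pt x i ^ 2) ≠ 0 := by
      refine prod_ne_zero_iff.2 fun i _ => sub_ne_zero.2 fun h => ?_
      have h0 : σ i ≠ i := Equiv.Perm.mem_support.1 (hσ'.2 ▸ mem_univ i)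
      exact h0 (hsq _ (fun i => Real.rpow_pos_of_pos (hx i) _) (hpt x hx hi) h)
    have e3 := congrArg (MvPolynomial.eval (pt x)) (hQ σ hσ')
    simp only [map_mul, map_prod, map_sub, map_pow, MvPolynomial.eval_X] at e3
    rw [e1, coeff_smul, coeff_map, map_mul, e3, prod_inv_distrib, smul_eq_mul]
    field_simp
  have hanti : ∀ i j, i ≠ j → MvPolynomial.rename (Equiv.swap i j) P = -P := by
    intro i j hij
    refine MvPolynomial.eq_of_eval_injective fun p hp hi => ?_
    -- The point at which the variables x^(-1/2) take the prescribed values p.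
    set x : Fin n → ℝ := fun i => p i ^ (-2 : ℝ) with hxdef
    have hx : ∀ i, 0 < x i := fun i => Real.rpow_pos_of_pos (hp i) _
    have hxp : pt x = p := by
      funext i
      simp only [pt, hxdef]
      rw [← Real.rpow_mul (hp i).le]
      norm_num
    have hxi : Function.Injective x := by
      intro i j h
      apply hi
      rw [← hxp]
      simp only [pt, h]
    have hx' : ∀ k, 0 < (x ∘ Equiv.swap i j) k := fun k => hx _
    have e1 := hP _ hx' (hxi.comp (Equiv.injective _))
    have e2 := hP _ hx hxi
    have e3 : pt (x ∘ Equiv.swap i j) = p ∘ Equiv.swap i j := by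
      rw [← hxp]; rfl
    rw [e3, hV] at e1
    rw [hxp, hV] at e2
    have e4 : (Matrix.vandermonde fun k => (p ∘ Equiv.swap i j) k ^ 2).det =
        -(Matrix.vandermonde fun k => p k ^ 2).det := by
      have := Matrix.det_permute (Equiv.swap i j) (Matrix.vandermonde fun k => p k ^ 2)
      rw [Equiv.Perm.sign_swap hij] at this
      rw [show (Matrix.vandermonde fun k => (p ∘ Equiv.swap i j) k ^ 2) =
        (Matrix.vandermonde fun k => p k ^ 2).submatrix (Equiv.swap i j) id from rfl, this]
      simp
    have e5 := cycleSum_reindex (Equiv.swap i j) fun i j => kHat (x i) (x j)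
    rw [MvPolynomial.eval_rename, e1, map_neg, e2, e4]
    simp only [Function.comp] at e5 ⊢
    rw [e5, neg_mul]
  obtain ⟨M, hM⟩ := MvPolynomial.prod_ltPairs_dvd_of_antisymm hanti
  refine ⟨fun x => MvPolynomial.eval (pt x) M / ∏ q ∈ ltPairs n, (pt x q.2 + pt x q.1), ?_, ?_⟩
  · have hc : ContinuousOn pt {x | ∀ i, 0 < x i} := by
      refine continuousOn_pi.2 fun i => ?_
      intro x hx
      have : ContinuousAt (fun y : Fin n → ℝ => y i ^ (-1 / 2 : ℝ)) x :=
        (continuous_apply i).continuousAt.rpow_const (Or.inl (hx i).ne')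
      exact this.continuousWithinAt
    refine ContinuousOn.div ?_ ?_ ?_
    · exact (MvPolynomial.continuous_eval M).comp_continuousOn hc
    · refine continuousOn_finsetProd _ fun q _ => ?_
      exact (continuousOn_pi.1 hc _).add (continuousOn_pi.1 hc _)
    · intro x hx
      refine prod_ne_zero_iff.2 fun q _ => ?_
      have h1 : 0 < pt x q.2 := Real.rpow_pos_of_pos (hx _) _
      have h2 : 0 < pt x q.1 := Real.rpow_pos_of_pos (hx _) _
      positivity
  · intro x hx hi
    have e1 := hP x hx hi
    have h1 : ∏ q ∈ ltPairs n, (pt x q.2 + pt x q.1) ≠ 0 := by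
      refine prod_ne_zero_iff.2 fun q _ => ?_
      have h1 : 0 < pt x q.2 := Real.rpow_pos_of_pos (hx _) _
      have h2 : 0 < pt x q.1 := Real.rpow_pos_of_pos (hx _) _
      positivity
    have h2 : ∏ q ∈ ltPairs n, (pt x q.2 - pt x q.1) ≠ 0 := by
      rw [← det_vandermonde_eq_prod_ltPairs]
      exact Matrix.det_vandermonde_ne_zero_iff.2 (hpt x hx hi)
    have e2 : MvPolynomial.eval (pt x) V = (∏ q ∈ ltPairs n, (pt x q.2 - pt x q.1)) *
        ∏ q ∈ ltPairs n, (pt x q.2 + pt x q.1) := by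
      rw [← prod_mul_distrib, map_prod]
      refine prod_congr rfl fun q _ => ?_
      simp only [map_sub, map_pow, MvPolynomial.eval_X]
      ring
    rw [hM, map_mul, e2, map_prod] at e1
    simp only [map_sub, MvPolynomial.eval_X] at e1
    rw [eq_div_iff h1]
    apply mul_left_cancel₀ h2
    linear_combination -e1

end AiryFormal

/-! ### Tuples of distinct points -/

theorem eventually_injective_add_mul {n : ℕ} (p : Fin n → ℝ) :
    ∀ᶠ t in nhdsWithin (0 : ℝ) (Set.Ioi 0),
      Function.Injective fun i : Fin n => p i + t * (i : ℕ) := by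
  have h : ∀ q : Fin n × Fin n, ∀ᶠ t in nhdsWithin (0 : ℝ) (Set.Ioi 0),
      q.1 ≠ q.2 → p q.1 + t * (q.1 : ℕ) ≠ p q.2 + t * (q.2 : ℕ) := by
    rintro ⟨i, j⟩
    by_cases hij : i = j
    · exact Eventually.of_forall fun _ h => absurd hij h
    by_cases hp : p i = p j
    · filter_upwards [self_mem_nhdsWithin] with t ht _ h
      rw [hp] at h
      have h1 := mul_left_cancel₀ (ne_of_gt ht) (add_left_cancel h)
      exact hij (Fin.ext (by exact_mod_cast h1))
    · have hc : ContinuousAt (fun t : ℝ => p i + t * (i : ℕ) - (p j + t * (j : ℕ))) 0 := by fun_prop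
      have := hc.eventually_ne (y := (0 : ℝ)) (by simpa [sub_eq_zero] using hp)
      filter_upwards [nhdsWithin_le_nhds this] with t ht _ h
      exact ht (sub_eq_zero.2 h)
  filter_upwards [eventually_all.2 h] with t ht i j hij
  by_contra hne
  exact ht (i, j) hne hij

theorem isOpen_orthant (n : ℕ) : IsOpen {x : Fin n → ℝ | ∀ i, 0 < x i} := by
  simp only [Set.ofPred_forall]
  exact isOpen_iInter_of_finite fun i => isOpen_lt continuous_const (continuous_apply i)

/-- Points with distinct coordinates are dense: approach x along x_i + t i with t decreasing to 0.
-/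
theorem eqOn_orthant {n : ℕ} {g g' : (Fin n → ℝ) → ℝ} (hg : ContinuousOn g {x | ∀ i, 0 < x i})
    (hg' : ContinuousOn g' {x | ∀ i, 0 < x i})
    (h : ∀ x : Fin n → ℝ, (∀ i, 0 < x i) → Function.Injective x → g x = g' x)
    {x : Fin n → ℝ} (hx : ∀ i, 0 < x i) : g x = g' x := by
  have hopen := (isOpen_orthant n).mem_nhds hx
  have ht : Tendsto (fun t : ℝ => fun i : Fin n => x i + t * (i : ℕ))
      (nhdsWithin (0 : ℝ) (Set.Ioi 0)) (nhds x) := by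
    have : Continuous (fun t : ℝ => fun i : Fin n => x i + t * (i : ℕ)) := by fun_prop
    have h1 := this.tendsto 0
    simp only [zero_mul, add_zero] at h1
    exact h1.mono_left nhdsWithin_le_nhds
  have h1 := (hg.continuousAt hopen).tendsto.comp ht
  have h2 := (hg'.continuousAt hopen).tendsto.comp ht
  refine tendsto_nhds_unique h1 (h2.congr' ?_)
  filter_upwards [eventually_injective_add_mul x, ht.eventually hopen] with t hi hp
  exact (h _ hp hi).symm

namespace AiryFormal
open PowerSeries

/-! ### Continuity of the formal correlation functions -/

/-- The coefficients extend continuously from the distinct positive tuples. -/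
def Extends {n : ℕ} (s : (Fin n → ℝ) → ℝ⟦X⟧) : Prop :=
  ∀ k, ∃ g : (Fin n → ℝ) → ℝ, ContinuousOn g {x | ∀ i, 0 < x i} ∧
    ∀ x : Fin n → ℝ, (∀ i, 0 < x i) → Function.Injective x → coeff k (s x) = g x

theorem Extends.mul {n : ℕ} {s t : (Fin n → ℝ) → ℝ⟦X⟧} (hs : Extends s) (ht : Extends t) :
    Extends fun x => s x * t x := by
  intro k
  choose g hg hg' using hs
  choose f hf hf' using ht
  refine ⟨fun x => ∑ i ∈ antidiagonal k, g i.1 x * f i.2 x,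
    continuousOn_finsetSum _ fun i _ => (hg i.1).mul (hf i.2), fun x hx hi => ?_⟩
  rw [coeff_mul]
  exact sum_congr rfl fun i _ => by rw [hg' _ x hx hi, hf' _ x hx hi]

theorem Extends.sub {n : ℕ} {s t : (Fin n → ℝ) → ℝ⟦X⟧} (hs : Extends s) (ht : Extends t) :
    Extends fun x => s x - t x := by
  intro k
  obtain ⟨g, hg, hg'⟩ := hs k
  obtain ⟨f, hf, hf'⟩ := ht k
  exact ⟨_, hg.sub hf, fun x hx hi => by rw [map_sub, hg' x hx hi, hf' x hx hi, Pi.sub_apply]⟩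

theorem Extends.neg {n : ℕ} {s : (Fin n → ℝ) → ℝ⟦X⟧} (hs : Extends s) :
    Extends fun x => -s x := by
  intro k
  obtain ⟨g, hg, hg'⟩ := hs k
  exact ⟨_, hg.neg, fun x hx hi => by rw [map_neg, hg' x hx hi, Pi.neg_apply]⟩

theorem continuousOn_apply_rpow {n : ℕ} (i : Fin n) (e : ℝ) :
    ContinuousOn (fun x : Fin n → ℝ => x i ^ e) {x | ∀ i, 0 < x i} := by
  intro x hx
  have : ContinuousAt (fun y : Fin n → ℝ => y i ^ e) x :=
    (continuous_apply i).continuousAt.rpow_const (Or.inl (hx i).ne')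
  exact this.continuousWithinAt

theorem extends_hat {n : ℕ} (e : ℝ) (s : ℝ⟦X⟧) (i : Fin n) : Extends fun x => hat e s (x i) :=
  fun k => ⟨fun x => coeff k s * x i ^ (e - 3 / 2 * k),
    continuousOn_const.mul (continuousOn_apply_rpow i _), fun _ hx _ => coeff_hat _ _ (hx i) k⟩

theorem extends_C {n : ℕ} (i : Fin n) : Extends fun x => C (x i) :=
  fun k => ⟨fun x => if k = 0 then x i else 0, by
    split_ifs
    · exact (continuous_apply i).continuousOn
    · exact continuousOn_const, fun x _ _ => coeff_C k _⟩

/-- With p = x^(-1/2) the coefficients are powers of p, and p^m - q^m is divisible by p - q through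
the geometric sum. The index 0 is separate because the power there is p⁻¹. -/
theorem extends_divided_difference {n : ℕ} (s : ℝ⟦X⟧) (i j : Fin n) (hij : i ≠ j) :
    Extends fun x => (x i - x j)⁻¹ • (hat (1 / 2) s (x i) - hat (1 / 2) s (x j)) := by
  intro k
  have e2 : ∀ y : ℝ, 0 < y → (y ^ (-1 / 2 : ℝ)) ^ 2 = y⁻¹ := fun y hy => by
    rw [← Real.rpow_mul_natCast hy.le, ← Real.rpow_neg_one]; norm_num
  have hdiff : ∀ x y : ℝ, 0 < x → 0 < y → (x - y)⁻¹ =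
      ((y ^ (-1 / 2 : ℝ)) ^ 2 - (x ^ (-1 / 2 : ℝ)) ^ 2)⁻¹ *
      ((x ^ (-1 / 2 : ℝ)) ^ 2 * (y ^ (-1 / 2 : ℝ)) ^ 2) := by
    intro x y hx hy
    rw [e2 _ hx, e2 _ hy, show y⁻¹ - x⁻¹ = (x - y) / (x * y) by field_simp, inv_div]
    field_simp
  have hne : ∀ x y : ℝ, 0 < x → 0 < y → x ≠ y → y ^ (-1 / 2 : ℝ) - x ^ (-1 / 2 : ℝ) ≠ 0 := by
    intro x y hx hy hxy h
    apply hxy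
    have h1 := congrArg (· ^ 2) (sub_eq_zero.1 h)
    simp only [e2 _ hx, e2 _ hy] at h1
    exact (inv_injective h1).symm
  have cont := fun (i : Fin n) => continuousOn_apply_rpow i (-1 / 2 : ℝ)
  have hpos : ∀ x ∈ {x : Fin n → ℝ | ∀ i, 0 < x i},
      x i ^ (-1 / 2 : ℝ) + x j ^ (-1 / 2 : ℝ) ≠ 0 := fun x hx => by
    have h1 := Real.rpow_pos_of_pos (hx i) (-1 / 2)
    have h2 := Real.rpow_pos_of_pos (hx j) (-1 / 2)
    positivity
  cases k with
  | zero =>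
    refine ⟨fun x => coeff 0 s * (x i ^ (-1 / 2 : ℝ) * x j ^ (-1 / 2 : ℝ)) /
      (x i ^ (-1 / 2 : ℝ) + x j ^ (-1 / 2 : ℝ)), ?_, ?_⟩
    · exact (continuousOn_const.mul ((cont i).mul (cont j))).div ((cont i).add (cont j)) hpos
    · intro x hx hi
      beta_reduce
      have h0 := hpos x hx
      rw [coeff_smul, map_sub, coeff_hat _ _ (hx i), coeff_hat _ _ (hx j), smul_eq_mul,
        hdiff _ _ (hx i) (hx j)]
      have h1 : ∀ y : ℝ, 0 < y → y ^ (1 / 2 - 3 / 2 * (0 : ℕ) : ℝ) = (y ^ (-1 / 2 : ℝ))⁻¹ :=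
        fun y hy => by rw [← Real.rpow_neg hy.le]; norm_num
      rw [h1 _ (hx i), h1 _ (hx j)]
      have h2 := hne _ _ (hx i) (hx j) (fun h => hij (hi h))
      have h3 := (Real.rpow_pos_of_pos (hx i) (-1 / 2)).ne'
      have h4 := (Real.rpow_pos_of_pos (hx j) (-1 / 2)).ne'
      generalize x i ^ (-1 / 2 : ℝ) = p at *
      generalize x j ^ (-1 / 2 : ℝ) = q at *
      rw [show q ^ 2 - p ^ 2 = (q - p) * (p + q) by ring]
      field_simp
  | succ k =>
    refine ⟨fun x => -(coeff (k + 1) s * ((x i ^ (-1 / 2 : ℝ)) ^ 2 * (x j ^ (-1 / 2 : ℝ)) ^ 2) *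
      ∑ l ∈ range (3 * k + 2), (x i ^ (-1 / 2 : ℝ)) ^ l * (x j ^ (-1 / 2 : ℝ)) ^ (3 * k + 2 - 1 - l)) /
      (x i ^ (-1 / 2 : ℝ) + x j ^ (-1 / 2 : ℝ)), ?_, ?_⟩
    · refine ContinuousOn.div (ContinuousOn.neg ((continuousOn_const.mul
        (((cont i).pow 2).mul ((cont j).pow 2))).mul ?_)) ((cont i).add (cont j)) hpos
      exact continuousOn_finsetSum _ fun l _ => ((cont i).pow l).mul ((cont j).pow _)
    · intro x hx hi
      beta_reduce
      have h0 := hpos x hx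
      rw [coeff_smul, map_sub, coeff_hat _ _ (hx i), coeff_hat _ _ (hx j), smul_eq_mul,
        hdiff _ _ (hx i) (hx j)]
      have h1 : ∀ y : ℝ, 0 < y → y ^ (1 / 2 - 3 / 2 * (k + 1 : ℕ) : ℝ) =
          (y ^ (-1 / 2 : ℝ)) ^ (3 * k + 2) :=
        fun y hy => by
          rw [← Real.rpow_mul_natCast hy.le]
          congr 1
          push_cast
          ring
      rw [h1 _ (hx i), h1 _ (hx j)]
      have h2 := hne _ _ (hx i) (hx j) (fun h => hij (hi h))
      have h3 := (Commute.all (x i ^ (-1 / 2 : ℝ)) (x j ^ (-1 / 2 : ℝ))).geom_sum₂_mul (3 * k + 2)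
      generalize x i ^ (-1 / 2 : ℝ) = p at *
      generalize x j ^ (-1 / 2 : ℝ) = q at *
      rw [← mul_sub, ← h3, show q ^ 2 - p ^ 2 = (q - p) * (p + q) by ring]
      generalize ∑ l ∈ range (3 * k + 2), p ^ l * q ^ (3 * k + 2 - 1 - l) = G
      field_simp
      ring

/-- For two points the pole is removed by `w_eq` rather than by antisymmetry. -/
theorem connHat_two {x : Fin 2 → ℝ} (hx : ∀ i, 0 < x i) (hi : Function.Injective x) :
    connHat 2 x = -(fHat (x 0) * fHat (x 1) *
      ((x 0 - x 1)⁻¹ • (aHat (x 0) - aHat (x 1))) * ((x 0 - x 1)⁻¹ • (bHat (x 0) - bHat (x 1)))) := by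
  have hne : x 0 ≠ x 1 := fun h => absurd (hi h) (by decide)
  have h := X_pow_mul_evS_topCoeff_w (L := []) (x := x 0) (y := x 1) (by simpa using hne)
    (by simp [hx])
  rw [List.nil_append, show [x 0, x 1] = List.ofFn x by simp, onList_ofFn, List.length_nil,
    pow_zero, one_mul] at h
  rw [← h]
  change evS (-(system.f (x 0) * system.f (x 1) * system.da (x 0) (x 1) *
    system.db (x 0) (x 1))) = _
  rw [map_neg, map_mul, map_mul, map_mul, evS_f (hx 0), evS_f (hx 1), AirySystem.da, AirySystem.db,
    evS_smul, evS_smul, map_sub, map_sub, evS_a (hx 0), evS_a (hx 1), evS_b (hx 0), evS_b (hx 1)]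

theorem extends_connHat {n : ℕ} (hn : 1 ≤ n) : Extends (connHat n) := by
  match n with
  | 1 =>
    exact (extends_hat _ _ 0).mul (((extends_hat _ _ 0).mul (extends_hat _ _ 0)).sub (extends_C 0))
  | 2 =>
    intro k
    have h : Extends fun x : Fin 2 → ℝ => -(fHat (x 0) * fHat (x 1) *
        ((x 0 - x 1)⁻¹ • (aHat (x 0) - aHat (x 1))) *
        ((x 0 - x 1)⁻¹ • (bHat (x 0) - bHat (x 1)))) :=
      ((((extends_hat _ _ 0).mul (extends_hat _ _ 1)).mul
        (extends_divided_difference _ 0 1 (by decide))).mul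
        (extends_divided_difference _ 0 1 (by decide))).neg
    obtain ⟨g, hg, hg'⟩ := h k
    exact ⟨g, hg, fun x hx hi => by rw [connHat_two hx hi, hg' x hx hi]⟩
  | m + 3 =>
    intro k
    obtain ⟨g, hg, hg'⟩ := exists_extension_cycleSum (n := m + 3) (by omega) k
    refine ⟨fun x => -((-1) ^ (m + 3) * g x), (continuousOn_const.mul hg).neg, fun x hx hi => ?_⟩
    have e : ((-1 : ℝ⟦X⟧)) ^ (m + 3) = C ((-1) ^ (m + 3)) := by simp
    change coeff k (-C (if m + 1 = 0 then 1 / (x 0 - x 1) ^ 2 else 0) - (-1) ^ (m + 3) *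
      cycleSum fun i j => kHat (x i) (x j)) = _
    rw [if_neg (Nat.succ_ne_zero m), map_zero, neg_zero, zero_sub, map_neg,
      e, coeff_C_mul]
    exact congrArg (fun t => -((-1) ^ (m + 3) * t)) (hg' x hx hi)

/-- The coefficients of the correlation functions, extended continuously. -/
def corr (j : ℕ) (n : ℕ) : (Fin n → ℝ) → ℝ :=
  -- Truncated subtraction is intended: the offset n - 2 is 0 also for n = 1, because the series for
  -- W_1 is normalised by an extra factor 1/N.
  if h : 1 ≤ n then (extends_connHat h (n - 2 + j)).choose else 0

theorem continuousOn_corr (j n : ℕ) : ContinuousOn (corr j n) {x | ∀ i, 0 < x i} := by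
  rw [corr]
  split_ifs with h
  · exact (extends_connHat h (n - 2 + j)).choose_spec.1
  · exact continuousOn_const

theorem corr_eq {j n : ℕ} {x : Fin n → ℝ} (hx : ∀ i, 0 < x i) (hi : Function.Injective x) :
    corr j n x = coeff (n - 2 + j) (connHat n x) := by
  rw [corr]
  split_ifs with h
  · exact ((extends_connHat h (n - 2 + j)).choose_spec.2 x hx hi).symm
  · obtain rfl : n = 0 := by omega
    exact (map_zero _).symm

theorem continuousOn_comp_perm {n : ℕ} {g : (Fin n → ℝ) → ℝ}
    (hg : ContinuousOn g {x | ∀ i, 0 < x i}) (e : Equiv.Perm (Fin n)) :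
    ContinuousOn (fun x => g (x ∘ e)) {x | ∀ i, 0 < x i} :=
  hg.comp (Continuous.continuousOn (by fun_prop)) fun _ hx i => hx (e i)

theorem corr_comp {j n : ℕ} {x : Fin n → ℝ} (hx : ∀ i, 0 < x i) (e : Equiv.Perm (Fin n)) :
    corr j n (x ∘ e) = corr j n x := by
  refine eqOn_orthant (continuousOn_comp_perm (continuousOn_corr j n) e) (continuousOn_corr j n)
    (fun x hx hi => ?_) hx
  rw [corr_eq hx hi, corr_eq (x := x ∘ e) (fun i => hx (e i)) (hi.comp e.injective), connHat_comp]

theorem corr_of_odd {j n : ℕ} (hj : Odd j) {x : Fin n → ℝ} (hx : ∀ i, 0 < x i) :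
    corr j n x = 0 :=
  eqOn_orthant (g' := fun _ => 0) (continuousOn_corr j n) continuousOn_const
    (fun x hx hi => by rw [corr_eq hx hi, coeff_connHat_of_odd hx hj]) hx

end AiryFormal

/-! ### Iterated integrals -/

theorem hasFDerivAt_smul_one {f : ℝ → ℝ} {f' x : ℝ} (h : HasDerivAt f f' x) :
    HasFDerivAt f (f' • (1 : ℝ →L[ℝ] ℝ)) x := by
  refine h.hasFDerivAt.congr_fderiv ?_
  ext
  simp

/-- The derivative of an integral over a square of varying size. -/
theorem hasDerivAt_integral_square {ψ : ℝ → ℝ → ℝ} (hψ : Continuous (Function.uncurry ψ))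
    (y x : ℝ) : HasDerivAt (fun x => ∫ t in y..x, ∫ s in y..x, ψ s t)
      ((∫ t in y..x, ψ x t) + ∫ s in y..x, ψ s x) x := by
  have hψ' : Continuous (Function.uncurry fun t s => ψ s t) := hψ.comp continuous_swap
  have c1 : Continuous fun q : ℝ × ℝ => ∫ s in y..q.2, ψ s q.1 :=
    intervalIntegral.continuous_parametric_intervalIntegral_of_continuous
      (f := fun (q : ℝ × ℝ) s => ψ s q.1)
      (hψ.comp (continuous_snd.prodMk (continuous_fst.comp continuous_fst))) continuous_snd
  have c2 : Continuous fun q : ℝ × ℝ => ∫ t in y..q.1, ψ q.2 t :=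
    intervalIntegral.continuous_parametric_intervalIntegral_of_continuous
      (f := fun (q : ℝ × ℝ) t => ψ q.2 t)
      (hψ.comp ((continuous_snd.comp continuous_fst).prodMk continuous_snd)) continuous_fst
  have swap : ∀ u v, ∫ t in y..u, ∫ s in y..v, ψ s t = ∫ s in y..v, ∫ t in y..u, ψ s t := by
    intro u v
    refine MeasureTheory.intervalIntegral_intervalIntegral_swap ?_
    have : MeasureTheory.IntegrableOn (Function.uncurry fun t s => ψ s t)
        (Set.uIcc y u ×ˢ Set.uIcc y v) :=
      hψ'.continuousOn.integrableOn_compact (isCompact_uIcc.prod isCompact_uIcc)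
    exact this.mono_set (Set.prod_mono Set.uIoc_subset_uIcc Set.uIoc_subset_uIcc)
  -- Treat the two upper limits as independent variables u, v. Both partial derivatives exist and
  -- are continuous, the one in v after exchanging the integrals; then restrict to the diagonal.
  have key := hasStrictFDerivAt_uncurry_coprod (𝕜 := ℝ) (u := (x, x))
    (f := fun u v => ∫ t in y..u, ∫ s in y..v, ψ s t)
    (f₁ := fun u v => (∫ s in y..v, ψ s u) • (1 : ℝ →L[ℝ] ℝ))
    (f₂ := fun u v => (∫ t in y..u, ψ v t) • (1 : ℝ →L[ℝ] ℝ))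
    (Eventually.of_forall fun q => by
      refine hasFDerivAt_smul_one ?_
      have : Continuous fun t => ∫ s in y..q.2, ψ s t := c1.comp (by fun_prop : Continuous fun t => (t, q.2))
      exact this.integral_hasStrictDerivAt y q.1 |>.hasDerivAt)
    (Eventually.of_forall fun q => by
      refine hasFDerivAt_smul_one ?_
      simp only [swap]
      have : Continuous fun s => ∫ t in y..q.1, ψ s t := c2.comp (by fun_prop : Continuous fun t => (q.1, t))
      exact this.integral_hasStrictDerivAt y q.2 |>.hasDerivAt)
    (c1.smul continuous_const).continuousAt (c2.smul continuous_const).continuousAt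
  have h1 := HasFDerivAt.comp_hasDerivAt (f := fun x : ℝ => (id x, id x)) x key.hasFDerivAt ((hasDerivAt_id x).prodMk (hasDerivAt_id x))
  refine h1.congr_deriv ?_
  simp [Function.HasUncurry.uncurry, add_comm]

/-- The iterated integral of a function of lists. -/
def listIntegral (y x : ℝ) (n : ℕ) (H : List ℝ → ℝ) : ℝ :=
  iteratedIntegral y x n fun v => H (List.ofFn v)

theorem listIntegral_zero (y x : ℝ) (H : List ℝ → ℝ) : listIntegral y x 0 H = H [] := rfl

theorem listIntegral_succ (y x : ℝ) (n : ℕ) (H : List ℝ → ℝ) :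
    listIntegral y x (n + 1) H = ∫ t in y..x, listIntegral y x n fun l => H (t :: l) := by
  rw [listIntegral, iteratedIntegral]
  simp only [List.ofFn_cons]
  rfl

theorem listIntegral_self (y : ℝ) (n : ℕ) (H : List ℝ → ℝ) : listIntegral y y (n + 1) H = 0 := by
  rw [listIntegral_succ, intervalIntegral.integral_same]

/-- The parameter space is arbitrary so that, in the induction, the first integration variable can
be moved among the parameters. -/
theorem continuous_listIntegral {P : Type} [TopologicalSpace P] [FirstCountableTopology P] (y : ℝ)
    (n : ℕ) {H : P → List ℝ → ℝ}
    (hH : ∀ n, Continuous fun q : P × (Fin n → ℝ) => H q.1 (List.ofFn q.2)) :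
    Continuous fun q : P × ℝ => listIntegral y q.2 n (H q.1) := by
  induction n generalizing P with
  | zero =>
    simp only [listIntegral_zero]
    have h := (hH 0).comp (by fun_prop : Continuous fun q : P × ℝ => (q.1, (Fin.elim0 : Fin 0 → ℝ)))
    exact h
  | succ n ih =>
    simp only [listIntegral_succ]
    have h1 := ih (P := P × ℝ) (H := fun q l => H q.1 (q.2 :: l)) (fun m => by
      have h2 := (hH (m + 1)).comp (by fun_prop : Continuous fun q : (P × ℝ) × (Fin m → ℝ) =>
        (q.1.1, (Fin.cons q.1.2 q.2 : Fin (m + 1) → ℝ)))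
      simpa only [Function.comp_def, List.ofFn_cons] using h2)
    exact intervalIntegral.continuous_parametric_intervalIntegral_of_continuous
      (f := fun (q : P × ℝ) t => listIntegral y q.2 n fun l => H q.1 (t :: l))
      (h1.comp (by fun_prop : Continuous fun z : (P × ℝ) × ℝ => ((z.1.1, z.2), z.1.2)))
      continuous_snd

theorem continuous_cons {H : List ℝ → ℝ} (hH : ∀ n, Continuous fun v : Fin n → ℝ => H (List.ofFn v))
    (n : ℕ) : Continuous fun q : ℝ × (Fin n → ℝ) => H (q.1 :: List.ofFn q.2) := by
  have h2 := (hH (n + 1)).comp (by fun_prop : Continuous fun q : ℝ × (Fin n → ℝ) =>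
    (Fin.cons q.1 q.2 : Fin (n + 1) → ℝ))
  simpa only [Function.comp_def, List.ofFn_cons] using h2

theorem continuous_cons_const {H : List ℝ → ℝ}
    (hH : ∀ n, Continuous fun v : Fin n → ℝ => H (List.ofFn v)) (t : ℝ)
    (n : ℕ) : Continuous fun v : Fin n → ℝ => H (t :: List.ofFn v) :=
  (continuous_cons hH n).comp (by fun_prop : Continuous fun v : Fin n → ℝ => (t, v))

/-- The derivative of the iterated integral of a symmetric function. -/
theorem hasDerivAt_listIntegral (y : ℝ) (n : ℕ) {H : List ℝ → ℝ}
    (hH : ∀ n, Continuous fun v : Fin n → ℝ => H (List.ofFn v))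
    (hs : ∀ l l', l.Perm l' → H l = H l') (x : ℝ) :
    HasDerivAt (fun x => listIntegral y x (n + 1) H)
      ((n + 1) * listIntegral y x n fun l => H (x :: l)) x := by
  induction n generalizing H x with
  | zero =>
    simp only [listIntegral_succ, listIntegral_zero]
    have h1 : Continuous fun t => H [t] := by
      have := (continuous_cons hH 0).comp
        (by fun_prop : Continuous fun t : ℝ => (t, (Fin.elim0 : Fin 0 → ℝ)))
      simpa [Function.comp_def] using this
    simpa using (h1.integral_hasStrictDerivAt y x).hasDerivAt
  | succ n ih =>
    have hH2 : ∀ m, Continuous fun q : (ℝ × ℝ) × (Fin m → ℝ) =>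
        H (q.1.2 :: q.1.1 :: List.ofFn q.2) := fun m => by
      have h2 := (hH (m + 2)).comp (by fun_prop : Continuous fun q : (ℝ × ℝ) × (Fin m → ℝ) =>
        (Fin.cons q.1.2 (Fin.cons q.1.1 q.2 : Fin (m + 1) → ℝ) : Fin (m + 2) → ℝ))
      simpa only [Function.comp_def, List.ofFn_cons] using h2
    -- By the induction hypothesis ψ(s, t) is the derivative at s of the inner (n+1)-fold integral
    -- with first entry t, so the whole is an integral of ψ over a square. By symmetry both boundary
    -- contributions are integrals with one entry frozen at x, giving the coefficients 1 and n + 1.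
    let ψ : ℝ → ℝ → ℝ := fun s t => (n + 1) * listIntegral y s n fun l => H (t :: s :: l)
    have hψ : Continuous (Function.uncurry ψ) := by
      have h1 := continuous_listIntegral y n (H := fun (q : ℝ × ℝ) l => H (q.2 :: q.1 :: l)) hH2
      exact continuous_const.mul (h1.comp (by fun_prop : Continuous fun q : ℝ × ℝ => (q, q.1)))
    have e1 : ∀ t x, listIntegral y x (n + 1) (fun l => H (t :: l)) = ∫ s in y..x, ψ s t := by
      intro t x
      have h1 := intervalIntegral.integral_eq_sub_of_hasDerivAt (a := y) (b := x)
        (fun s _ => ih (H := fun l => H (t :: l)) (continuous_cons_const hH t)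
          (fun l l' h => hs _ _ (h.cons t)) s)
        ((hψ.comp (by fun_prop : Continuous fun s : ℝ => (s, t))).intervalIntegrable y x)
      rw [listIntegral_self, sub_zero] at h1
      exact h1.symm
    have e2 : (fun x => listIntegral y x (n + 1 + 1) H) =
        fun x => ∫ t in y..x, ∫ s in y..x, ψ s t := by
      funext x
      rw [listIntegral_succ]
      simp only [e1]
    rw [e2]
    refine (hasDerivAt_integral_square hψ y x).congr_deriv ?_
    have e3 : ∀ t, ψ x t = (n + 1) * listIntegral y x n fun l => H (x :: t :: l) := by
      intro t
      simp only [ψ]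
      congr 2
      funext l
      exact hs _ _ (List.Perm.swap _ _ _)
    simp only [e3]
    rw [intervalIntegral.integral_const_mul, ← listIntegral_succ y x n fun l => H (x :: l), ← e1 x x]
    push_cast
    ring

/-! ### Correlation coefficients as symmetric functions of lists -/

namespace AiryFormal
open PowerSeries

theorem onList_corr_perm {j : ℕ} {l l' : List ℝ} (h : l.Perm l') (hl : ∀ x ∈ l, 0 < x) :
    onList (corr j) l = onList (corr j) l' := by
  obtain ⟨n, p, rfl⟩ : ∃ n, ∃ p : Fin n → ℝ, l = List.ofFn p := ⟨_, l.get, (List.ofFn_get l).symm⟩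
  obtain ⟨m, q, rfl⟩ : ∃ n, ∃ p : Fin n → ℝ, l' = List.ofFn p :=
    ⟨_, l'.get, (List.ofFn_get l').symm⟩
  obtain rfl : n = m := by simpa using h.length_eq
  rw [onList_ofFn, onList_ofFn]
  have hp : ∀ i, 0 < p i := fun i => hl _ ((List.mem_ofFn' _ _).2 ⟨i, rfl⟩)
  have hq : ∀ i, 0 < q i := fun i => hl _ (h.mem_iff.2 ((List.mem_ofFn' _ _).2 ⟨i, rfl⟩))
  rw [← corr_comp hp (Tuple.sort p), ← corr_comp hq (Tuple.sort q)]
  congr 1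
  apply List.ofFn_injective
  refine List.Perm.eq_of_sortedLE (List.sortedLE_ofFn_iff.2 (Tuple.monotone_sort p))
    (List.sortedLE_ofFn_iff.2 (Tuple.monotone_sort q)) ?_
  exact (Equiv.Perm.ofFn_comp_perm _ _).trans (h.trans (Equiv.Perm.ofFn_comp_perm _ _).symm)

/-- The coefficients of the correlation functions, as globally continuous functions that are
meaningful on `[δ, ∞)`. -/
def corrList (δ : ℝ) (j : ℕ) (l : List ℝ) : ℝ := onList (corr j) (l.map (max δ))

variable {δ : ℝ}

theorem corrList_perm (hδ : 0 < δ) (j : ℕ) {l l' : List ℝ} (h : l.Perm l') :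
    corrList δ j l = corrList δ j l' := by
  refine onList_corr_perm (h.map _) fun x hx => ?_
  obtain ⟨z, -, rfl⟩ := List.mem_map.1 hx
  exact lt_max_of_lt_left hδ

theorem corrList_ofFn (j : ℕ) {n : ℕ} (v : Fin n → ℝ) :
    corrList δ j (List.ofFn v) = corr j n fun i => max δ (v i) := by
  rw [corrList, List.map_ofFn, onList_ofFn]
  rfl

theorem continuous_corrList (hδ : 0 < δ) (j n : ℕ) :
    Continuous fun v : Fin n → ℝ => corrList δ j (List.ofFn v) := by
  simp only [corrList_ofFn]
  exact (continuousOn_corr j n).comp_continuous (by fun_prop)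
    fun v i => lt_max_of_lt_left hδ

theorem corrList_eq (hδ : 0 < δ) (j : ℕ) {l : List ℝ} (hl : ∀ x ∈ l, δ < x) (hn : l.Nodup) :
    corrList δ j l = coeff (l.length - 2 + j) (onList connHat l) := by
  obtain ⟨n, p, rfl⟩ : ∃ n, ∃ p : Fin n → ℝ, l = List.ofFn p := ⟨_, l.get, (List.ofFn_get l).symm⟩
  have hp : ∀ i, δ < p i := fun i => hl _ ((List.mem_ofFn' _ _).2 ⟨i, rfl⟩)
  have h1 : (fun i => max δ (p i)) = p := funext fun i => max_eq_right (hp i).le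
  rw [corrList_ofFn, onList_ofFn, List.length_ofFn, h1,
    corr_eq (fun i => hδ.trans (hp i)) (List.nodup_ofFn.1 hn)]

theorem continuous_corrList_append (hδ : 0 < δ) (j : ℕ) (M : List ℝ) (n : ℕ) :
    Continuous fun v : Fin n → ℝ => corrList δ j (M ++ List.ofFn v) := by
  have key : ∀ H : List ℝ → ℝ, (∀ n, Continuous fun v : Fin n → ℝ => H (List.ofFn v)) →
      ∀ n, Continuous fun v : Fin n → ℝ => H (M ++ List.ofFn v) := by
    induction M with
    | nil => exact fun H hH => hH
    | cons z M ih => exact fun H hH => ih (fun l => H (z :: l)) (continuous_cons_const hH z)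
  exact key _ (continuous_corrList hδ j) n

/-! ### The formal exponential formula -/

/-- The coefficients of the evaluation, as linear functionals. -/
def evCoeff (k : ℕ) : system.R →ₗ[ℝ] ℝ where
  toFun p := coeff k (evS p)
  map_add' p q := by rw [map_add, map_add]
  map_smul' c p := by rw [evS_smul, coeff_smul]; rfl

open scoped PowerSeries.WithPiTopology in
theorem continuous_evCoeff (k : ℕ) : Continuous (evCoeff k) :=
  (PowerSeries.WithPiTopology.continuous_constantCoeff ℝ).comp
    (PowerSeries.WithPiTopology.continuous_coeff ℝ⟦X⟧ k)

/-- The coefficients of `τ`. -/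
def tauCoeff (k : ℕ) (L : List ℝ) (w x y : ℝ) : ℝ :=
  evCoeff k (AirySystem.topCoeff L system ((AirySystem.insertList L system).tau w x y))

/-- The coefficients of the diagonal limit of `τ`. -/
def tauDiagCoeff (k : ℕ) (M : List ℝ) (x y : ℝ) : ℝ :=
  evCoeff k (AirySystem.topCoeff M system ((AirySystem.insertList M system).tauDiag x y))

theorem tauDiag_self (S : AirySystem) (y : ℝ) : S.tauDiag y y = 0 := by
  rw [AirySystem.tauDiag, AirySystem.f]
  ring

theorem mem_G {L : List ℝ} (hL : L.Nodup) (hp : ∀ z ∈ L, 0 < z) {x : ℝ} (hx : 0 < x)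
    (hxL : x ∉ L) : x ∈ (AirySystem.insertList L system).G :=
  AirySystem.mem_insertList_G.2 ⟨hx, hxL, hL, hp⟩

/-- The coefficient form of `tendsto_slope_tau`. The factor h in front of the varied diagonal term
lowers the order from k to k - 1 while one more point is inserted; this is the recursion to be
solved. -/
theorem hasDerivAt_tauCoeff {k : ℕ} {L : List ℝ} {w x y : ℝ} (hn : (L ++ [w]).Nodup)
    (hp : ∀ z ∈ L ++ [w], 0 < z) (hx : 0 < x) (hy : 0 < y) (hxM : x ∉ L ++ [w])
    (hyM : y ∉ L ++ [w]) :
    HasDerivAt (fun x => tauCoeff k L w x y) (coeff (L.length + k) (onList connHat (L ++ [w, x])) +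
      if k = 0 then 0 else tauDiagCoeff (k - 1) (L ++ [w]) x y) x := by
  obtain ⟨hL, -, hw⟩ := List.nodup_append.1 hn
  have hwL : w ∉ L := fun h => hw w h w (by simp) rfl
  have hpL : ∀ z ∈ L, 0 < z := fun z hz => hp z (by simp [hz])
  have hxL : x ∉ L := fun h => hxM (by simp [h])
  have hyL : y ∉ L := fun h => hyM (by simp [h])
  have hxw : x ≠ w := fun h => hxM (by simp [h])
  have hyw : y ≠ w := fun h => hyM (by simp [h])
  have h1 := AirySystem.tendsto_slope_tau (mem_G hL hpL (hp w (by simp)) hwL)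
    (mem_G hL hpL hx hxL) (mem_G hL hpL hy hyL) hxw hyw
  have h2 := (((continuous_evCoeff k).comp
    (AirySystem.continuous_topCoeff L system)).tendsto _).comp h1
  rw [hasDerivAt_iff_tendsto_slope]
  have e1 : (evCoeff k) (AirySystem.topCoeff L system
      ((AirySystem.insertList L system).w w x + (AirySystem.insertList L system).h *
        (AirySystem.insertList L system).im w
          (((AirySystem.insertList L system).step w).tauDiag x y))) =
      coeff (L.length + k) (onList connHat (L ++ [w, x])) +
      if k = 0 then 0 else tauDiagCoeff (k - 1) (L ++ [w]) x y := by
    have hn' : (L ++ [w, x]).Nodup := by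
      rw [show L ++ [w, x] = (L ++ [w]) ++ [x] by simp]
      exact List.nodup_append.2 ⟨hn, by simp, fun a ha b hb => by
        rw [List.mem_singleton.1 hb]; rintro rfl; exact hxM ha⟩
    have hp' : ∀ z ∈ L ++ [w, x], 0 < z := by
      intro z hz
      simp only [List.mem_append, List.mem_cons, List.not_mem_nil, or_false] at hz
      rcases hz with h | rfl | rfl
      · exact hpL z h
      · exact hp _ (by simp)
      · exact hx
    rw [map_add, map_add, AirySystem.topCoeff_h_mul, ← AirySystem.topCoeff_append_singleton L system w
      fun S => S.tauDiag x y]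
    congr 1
    · exact coeff_evS_topCoeff_w hn' hp' k
    · change coeff k (evS (_ * _)) = _
      rw [map_mul, evS_h]
      cases k with
      | zero => rw [coeff_zero_X_mul, if_pos rfl]
      | succ k =>
        rw [coeff_succ_X_mul, if_neg (Nat.succ_ne_zero k)]
        rfl
  rw [← e1]
  refine h2.congr fun x' => ?_
  simp only [Function.comp, slope, vsub_eq_sub, map_smul, map_sub]
  rfl

/-- The value of `τ` in terms of the correlation functions. -/
def tauSum (δ : ℝ) (k : ℕ) (M : List ℝ) (x y : ℝ) : ℝ :=
  ∑ l ∈ range (k + 1), 1 / ((l + 1).factorial : ℝ) *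
    listIntegral y x (l + 1) fun v => corrList δ (k - l) (M ++ v)

/-- Differentiating an (l+1)-fold integral of a symmetric function freezes one entry at x and gives
a factor l + 1, which turns 1/(l+1)! into 1/l!. The term l = 0 is the correlation function; the
others are the sum of order k - 1 with x appended. -/
theorem hasDerivAt_tauSum (hδ : 0 < δ) (k : ℕ) (M : List ℝ) (x y : ℝ) :
    HasDerivAt (fun x => tauSum δ k M x y) (corrList δ k (M ++ [x]) +
      if k = 0 then 0 else tauSum δ (k - 1) (M ++ [x]) x y) x := by
  have h1 : HasDerivAt (fun x => tauSum δ k M x y) (∑ l ∈ range (k + 1),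
      1 / ((l + 1).factorial : ℝ) * ((l + 1) * listIntegral y x l fun v =>
        corrList δ (k - l) (M ++ x :: v))) x :=
    HasDerivAt.fun_sum fun l _ => (hasDerivAt_listIntegral y l
      (continuous_corrList_append hδ (k - l) M)
      (fun l l' h => corrList_perm hδ _ (h.append_left M)) x).const_mul _
  refine h1.congr_deriv ?_
  rw [sum_range_succ', add_comm]
  congr 1
  · simp [listIntegral_zero]
  · cases k with
    | zero => simp
    | succ k =>
      rw [if_neg (Nat.succ_ne_zero k), tauSum, Nat.add_sub_cancel]
      refine sum_congr rfl fun l _ => ?_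
      rw [Nat.factorial_succ (l + 1), show k + 1 - (l + 1) = k - l by omega]
      have : ((l + 1 : ℕ) : ℝ) + 1 ≠ 0 := by positivity
      simp only [List.append_assoc, List.cons_append, List.nil_append]
      push_cast
      field_simp

theorem tauSum_self (k : ℕ) (M : List ℝ) (y : ℝ) : tauSum δ k M y y = 0 :=
  sum_eq_zero fun l _ => by rw [listIntegral_self, mul_zero]

theorem continuous_tauSum_append (hδ : 0 < δ) (k : ℕ) (M : List ℝ) (x y : ℝ) :
    Continuous fun z => tauSum δ k (M ++ [z]) x y := by
  refine continuous_finsetSum _ fun l _ => continuous_const.mul ?_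
  have h := continuous_listIntegral y (l + 1) (H := fun z v => corrList δ (k - l) (M ++ z :: v))
    (fun n => continuous_cons (H := fun v => corrList δ (k - l) (M ++ v))
      (continuous_corrList_append hδ (k - l) M) n)
  have h2 := h.comp (by fun_prop : Continuous fun z : ℝ => (z, x))
  simpa [Function.comp_def] using h2

theorem nhdsWithin_compl_uIcc_neBot {x y : ℝ} : (nhdsWithin x (Set.uIcc y x)ᶜ).NeBot := by
  rcases le_total y x with h | h
  · rw [Set.uIcc_of_le h]
    exact nhdsWithin_Ioi_neBot le_rfl |>.mono (nhdsWithin_mono _ fun z hz hz' => not_le.2 hz hz'.2)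
  · rw [Set.uIcc_of_ge h]
    exact nhdsWithin_Iio_neBot le_rfl |>.mono (nhdsWithin_mono _ fun z hz hz' => not_le.2 hz hz'.1)

/-- Let z tend to x in the identity for τ at z. The limit is taken from outside the segment from y
to x, where z does not obstruct integration along the segment. For x = y both sides vanish. -/
theorem tauDiagCoeff_eq_tauSum (hδ : 0 < δ) (k : ℕ) {M : List ℝ} {x y : ℝ}
    (ih : ∀ z, (M ++ [z]).Nodup → (∀ t ∈ M ++ [z], δ < t) →
      (∀ t ∈ M ++ [z], t ∉ Set.uIcc y x) → tauCoeff k M z x y = tauSum δ k (M ++ [z]) x y)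
    (hn : M.Nodup) (hp : ∀ z ∈ M, δ < z) (hx : δ < x) (hy : δ < y)
    (hM : ∀ z ∈ M, z ∉ Set.uIcc y x) :
    tauDiagCoeff k M x y = tauSum δ k (M ++ [x]) x y := by
  have hpM : ∀ z ∈ M, 0 < z := fun z hz => hδ.trans (hp z hz)
  have hxM : x ∉ M := fun h => hM x h Set.right_mem_uIcc
  have hyM : y ∉ M := fun h => hM y h Set.left_mem_uIcc
  by_cases hxy : x = y
  · subst hxy
    rw [tauSum_self, tauDiagCoeff, tauDiag_self, map_zero, map_zero]
  have hsub : (Set.uIcc y x)ᶜ ⊆ {x}ᶜ := fun z hz h => hz (by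
    rw [Set.mem_singleton_iff.1 h]; exact Set.right_mem_uIcc)
  have h1 := (AirySystem.tendsto_tau (mem_G hn hpM (hδ.trans hx) hxM)
    (mem_G hn hpM (hδ.trans hy) hyM) hxy).mono_left (nhdsWithin_mono x hsub)
  have h2 := (((continuous_evCoeff k).comp
    (AirySystem.continuous_topCoeff M system)).tendsto _).comp h1
  have h3 := ((continuous_tauSum_append hδ k M x y).tendsto x).mono_left
    (nhdsWithin_le_nhds (s := (Set.uIcc y x)ᶜ))
  have := nhdsWithin_compl_uIcc_neBot (x := x) (y := y)
  refine tendsto_nhds_unique h2 (h3.congr' ?_)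
  have hfin : {z | z ∈ M}ᶜ ∈ nhds x := (M.finite_toSet.isClosed.isOpen_compl).mem_nhds hxM
  filter_upwards [self_mem_nhdsWithin, nhdsWithin_le_nhds hfin,
    nhdsWithin_le_nhds (lt_mem_nhds hx)] with z hz hzM hzδ
  refine (ih z ?_ ?_ ?_).symm
  · exact List.nodup_append.2 ⟨hn, by simp, fun a ha b hb => by
      rw [List.mem_singleton.1 hb]; rintro rfl; exact hzM ha⟩
  · intro t ht
    rcases List.mem_append.1 ht with h | h
    · exact hp t h
    · rw [List.mem_singleton.1 h]; exact hzδ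
  · intro t ht
    rcases List.mem_append.1 ht with h | h
    · exact hM t h
    · rw [List.mem_singleton.1 h]; exact hz

theorem eq_of_hasDerivAt_uIcc {g g' D : ℝ → ℝ} {x y : ℝ}
    (hg : ∀ t ∈ Set.uIcc y x, HasDerivAt g (D t) t)
    (hg' : ∀ t ∈ Set.uIcc y x, HasDerivAt g' (D t) t) (h0 : g y = g' y) : g x = g' x := by
  have h := (convex_uIcc y x).norm_image_sub_le_of_norm_hasDerivWithin_le (f := fun t => g t - g' t)
    (f' := fun t => D t - D t) (C := 0)
    (fun t ht => ((hg t ht).sub (hg' t ht)).hasDerivWithinAt)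
    (fun t _ => by simp) Set.left_mem_uIcc Set.right_mem_uIcc
  rw [zero_mul, norm_le_zero_iff] at h
  linarith

/-- The formal exponential formula for the primitives `τ`. -/
theorem tauCoeff_eq_tauSum (hδ : 0 < δ) (k : ℕ) {L : List ℝ} {w x y : ℝ} (hn : (L ++ [w]).Nodup)
    (hp : ∀ z ∈ L ++ [w], δ < z) (hx : δ < x) (hy : δ < y)
    (hM : ∀ z ∈ L ++ [w], z ∉ Set.uIcc y x) :
    tauCoeff k L w x y = tauSum δ k (L ++ [w]) x y := by
  induction k using Nat.strong_induction_on generalizing L w x with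
  | _ k ih =>
    -- Both sides vanish at x = y and satisfy the same differential recursion, with order k driven
    -- by order k - 1 and one more inserted point. The induction therefore runs over all lists of
    -- inserted points.
    refine eq_of_hasDerivAt_uIcc (y := y) (g := fun x => tauCoeff k L w x y)
      (g' := fun x => tauSum δ k (L ++ [w]) x y) (D := fun x => corrList δ k (L ++ [w] ++ [x]) +
        if k = 0 then 0 else tauSum δ (k - 1) (L ++ [w] ++ [x]) x y) ?_
      (fun t _ => hasDerivAt_tauSum hδ k _ t y) ?_
    · intro t ht
      have hsub : Set.uIcc y t ⊆ Set.uIcc y x := Set.uIcc_subset_uIcc_left ht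
      have htδ : δ < t := lt_of_lt_of_le (lt_inf_iff.2 ⟨hy, hx⟩) ht.1
      have htM : t ∉ L ++ [w] := fun h => hM t h ht
      have hyM : y ∉ L ++ [w] := fun h => hM y h Set.left_mem_uIcc
      have hn' : (L ++ [w] ++ [t]).Nodup := List.nodup_append.2 ⟨hn, by simp, fun a ha b hb => by
        rw [List.mem_singleton.1 hb]; rintro rfl; exact htM ha⟩
      refine (hasDerivAt_tauCoeff hn (fun z hz => hδ.trans (hp z hz)) (hδ.trans htδ) (hδ.trans hy)
        htM hyM).congr_deriv ?_
      congr 1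
      · rw [corrList_eq hδ k (fun z hz => ?_) hn']
        · simp
        · rcases List.mem_append.1 hz with h | h
          · exact hp z h
          · rw [List.mem_singleton.1 h]; exact htδ
      · split_ifs with hk
        · rfl
        · exact tauDiagCoeff_eq_tauSum hδ (k - 1)
            (fun z h1 h2 h3 => ih (k - 1) (by omega) h1 h2 htδ h3) hn hp htδ hy
            fun z hz h => hM z hz (hsub h)
    · rw [tauSum_self, tauCoeff, AirySystem.tau_self, map_zero, map_zero]

/-- The formal series of the logarithmic derivative of the numerator of the kernel, times `ħ`. -/
def logDerivHat (x y : ℝ) : ℝ⟦X⟧ :=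
  fHat x * (aHat x * bHat x - C x) + X * evS (system.tauDiag x y)

theorem evS_r {x y : ℝ} (hx : 0 < x) (hy : 0 < y) :
    evS (system.r x y) * (bHat y - aHat x) = 1 := by
  rw [← evS_a hx, ← evS_b hy, ← map_sub, ← map_mul, AirySystem.r_mul (S := system) hx hy, map_one]

theorem riccati_evS {x : ℝ} (hx : 0 < x) : X * evS (system.a' x) + aHat x ^ 2 = C x := by
  have h := congrArg evS (system.riccati_a x hx)
  rw [map_add, map_add, map_mul, map_pow, evS_h, evS_a hx] at h
  have h1 : evS (algebraMap ℝ system.R x) = C x := by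
    rw [Algebra.algebraMap_eq_smul_one, evS_smul, map_one, PowerSeries.smul_eq_C_mul, mul_one]
  have h2 : evS system.u = 0 := by
    refine (PowerSeries.map_C _ _).trans ?_
    rw [constantCoeff_X, map_zero]
  rw [h1, h2, add_zero] at h
  exact h

/-- The logarithmic derivative of A(x)(b(y) - a(x)), times ħ, is a - ħa'/(b(y) - a), and ħa' = x -
a². Thus the series W_1 + ħ τ(x;x,y) equals (a(x) b(y) - x)/(b(y) - a(x)), the form recovered
analytically in `logDerivScaled`. -/
theorem logDerivHat_mul {x y : ℝ} (hx : 0 < x) (hy : 0 < y) :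
    (aHat x - logDerivHat x y) * (bHat y - aHat x) = C x - aHat x ^ 2 := by
  have h1 := evS_r hx hy
  have h2 := riccati_evS hx
  have h3 := fHat_mul hx
  rw [logDerivHat, AirySystem.tauDiag, map_sub, map_mul, map_mul, evS_f hx]
  linear_combination (C x - aHat x ^ 2) * h1 + (evS (system.r x y) - fHat x) *
    (bHat y - aHat x) * h2 - aHat x * (bHat y - aHat x) * h3

/-- The exponents, in terms of the globally continuous correlation functions. -/
def expSum (δ : ℝ) (j : ℕ) (x y : ℝ) : ℝ :=
  ∑ l ∈ range (j + 1), 1 / ((l + 1).factorial : ℝ) *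
    listIntegral y x (l + 1) fun v => corrList δ (j - l) v

/-- The case of no inserted points of `hasDerivAt_tauSum`: the first term is W_1 and the second is
the diagonal value of τ, by `tauCoeff_eq_tauSum`. -/
theorem hasDerivAt_expSum (hδ : 0 < δ) (j : ℕ) {x y : ℝ} (hx : δ < x) (hy : δ < y) :
    HasDerivAt (fun x => expSum δ j x y) (coeff j (logDerivHat x y)) x := by
  refine (hasDerivAt_tauSum hδ j [] x y).congr_deriv ?_
  rw [logDerivHat, map_add]
  congr 1
  · rw [corrList_eq hδ j (by simpa using hx) (by simp)]
    simp [onList, connHat]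
  · cases j with
    | zero => rw [if_pos rfl, coeff_zero_X_mul]
    | succ j =>
      rw [if_neg (Nat.succ_ne_zero j), coeff_succ_X_mul, Nat.add_sub_cancel,
        ← tauDiagCoeff_eq_tauSum hδ j (fun z h1 h2 h3 => tauCoeff_eq_tauSum hδ j h1 h2 hx hy h3)
          List.nodup_nil (by simp) hx hy (by simp)]
      rfl

theorem expSum_self (j : ℕ) (y : ℝ) : expSum δ j y y = 0 := tauSum_self j [] y

end AiryFormal

/-! ### The Airy functions -/

/-- Coefficients of an entire series. -/
def EntireBound (c : ℕ → ℝ) : Prop := ∃ C A : ℝ, 0 ≤ C ∧ 0 ≤ A ∧ ∀ k, |c k| ≤ C * A ^ k / k.factorial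

theorem EntireBound.mul_exponent {c : ℕ → ℝ} (h : EntireBound c) {e : ℕ → ℕ}
    (he : ∀ k, e k ≤ 3 * k + 1) : EntireBound fun k => c k * e k := by
  obtain ⟨C, A, hC, hA, h⟩ := h
  refine ⟨C, 4 * A, hC, by positivity, fun k => ?_⟩
  have h4 : ∀ k : ℕ, 3 * k + 1 ≤ 4 ^ k := by
    intro k
    induction k with
    | zero => norm_num
    | succ k ih => rw [pow_succ]; omega
  have h1 : (e k : ℝ) ≤ 4 ^ k := by exact_mod_cast (he k).trans (h4 k)
  rw [abs_mul, Nat.abs_cast, mul_pow]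
  calc |c k| * e k ≤ (C * A ^ k / k.factorial) * 4 ^ k :=
        mul_le_mul (h k) h1 (by positivity) (by positivity)
    _ = _ := by ring

theorem EntireBound.norm_term_le {c : ℕ → ℝ} {C A : ℝ}
    (hC : 0 ≤ C) (hA : 0 ≤ A) (h : ∀ k, |c k| ≤ C * A ^ k / k.factorial) {e : ℕ → ℕ}
    (he : ∀ k, e k ≤ 3 * k + 1) {x r : ℝ} (hr : 1 ≤ r) (hx : |x| ≤ r) (k : ℕ) :
    ‖c k * x ^ e k‖ ≤ C * r * ((A * r ^ 3) ^ k / k.factorial) := by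
  rw [norm_mul, norm_pow, Real.norm_eq_abs, Real.norm_eq_abs]
  have h1 : |x| ^ e k ≤ r ^ (3 * k + 1) :=
    (pow_le_pow_left₀ (abs_nonneg x) hx _).trans (pow_le_pow_right₀ hr (he k))
  calc |c k| * |x| ^ e k ≤ (C * A ^ k / k.factorial) * r ^ (3 * k + 1) :=
        mul_le_mul (h k) h1 (by positivity) (by positivity)
    _ = _ := by rw [pow_succ, pow_mul, mul_pow]; ring

theorem EntireBound.summable {c : ℕ → ℝ} (h : EntireBound c) {e : ℕ → ℕ}
    (he : ∀ k, e k ≤ 3 * k + 1) (x : ℝ) : Summable fun k => c k * x ^ e k := by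
  obtain ⟨C, A, hC, hA, h⟩ := h
  exact Summable.of_norm_bounded ((Real.summable_pow_div_factorial _).mul_left _)
    (EntireBound.norm_term_le hC hA h he (r := max 1 |x|) (le_max_left _ _) (le_max_right _ _))

/-- Termwise differentiation, dominated on a ball slightly larger than |x|; the factor e k is at
most 4^k and is absorbed in the constant A. -/
theorem EntireBound.hasDerivAt {c : ℕ → ℝ} (h : EntireBound c) {e : ℕ → ℕ}
    (he : ∀ k, e k ≤ 3 * k + 1) (x : ℝ) :
    HasDerivAt (fun x => ∑' k, c k * x ^ e k) (∑' k, c k * e k * x ^ (e k - 1)) x := by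
  have hs := h.summable he x
  obtain ⟨C, A, hC, hA, h'⟩ := h.mul_exponent he
  refine hasDerivAt_tsum_of_isPreconnected (t := Metric.ball 0 (|x| + 1))
    (g := fun k x => c k * x ^ e k) (g' := fun k x => c k * e k * x ^ (e k - 1))
    ((Real.summable_pow_div_factorial (A * (|x| + 1) ^ 3)).mul_left (C * (|x| + 1)))
    Metric.isOpen_ball (convex_ball _ _).isPreconnected ?_ ?_ (y₀ := x) ?_ hs ?_
  · intro k y _
    exact ((hasDerivAt_pow (e k) y).const_mul (c k)).congr_deriv (by ring)
  · intro k y hy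
    refine EntireBound.norm_term_le hC hA h' (e := fun k => e k - 1)
      (fun k => (Nat.sub_le _ _).trans (he k)) ?_ ?_ k
    · have := abs_nonneg x
      linarith
    · have := mem_ball_zero_iff.1 hy
      exact this.le
  · rw [mem_ball_zero_iff, Real.norm_eq_abs]; linarith
  · rw [mem_ball_zero_iff, Real.norm_eq_abs]; linarith

/-- The Maclaurin coefficients of `airyF`. -/
def fCoeff (k : ℕ) : ℝ := (∏ i ∈ range k, (3 * (i : ℝ) + 1)) / ((3 * k).factorial : ℝ)

/-- The Maclaurin coefficients of `airyG`. -/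
def gCoeff (k : ℕ) : ℝ := (∏ i ∈ range k, (3 * (i : ℝ) + 2)) / ((3 * k + 1).factorial : ℝ)

theorem fCoeff_succ (k : ℕ) : fCoeff (k + 1) * ((3 * k + 2) * (3 * k + 3)) = fCoeff k := by
  rw [fCoeff, fCoeff, prod_range_succ, show 3 * (k + 1) = 3 * k + 1 + 1 + 1 by ring,
    Nat.factorial_succ, Nat.factorial_succ, Nat.factorial_succ]
  have h1 : ((3 * k).factorial : ℝ) ≠ 0 := by positivity
  push_cast
  field_simp
  ring

theorem gCoeff_succ (k : ℕ) : gCoeff (k + 1) * ((3 * k + 3) * (3 * k + 4)) = gCoeff k := by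
  rw [gCoeff, gCoeff, prod_range_succ, show 3 * (k + 1) + 1 = 3 * k + 1 + 1 + 1 + 1 by ring,
    Nat.factorial_succ (3 * k + 1 + 1 + 1), Nat.factorial_succ (3 * k + 1 + 1),
    Nat.factorial_succ (3 * k + 1)]
  have h1 : ((3 * k + 1).factorial : ℝ) ≠ 0 := by positivity
  push_cast
  field_simp
  ring

theorem fCoeff_pos (k : ℕ) : 0 < fCoeff k :=
  div_pos (prod_pos fun i _ => by positivity) (by positivity)

theorem gCoeff_pos (k : ℕ) : 0 < gCoeff k :=
  div_pos (prod_pos fun i _ => by positivity) (by positivity)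

theorem entireBound_fCoeff : EntireBound fCoeff := by
  refine ⟨1, 1, zero_le_one, zero_le_one, fun k => ?_⟩
  rw [abs_of_pos (fCoeff_pos k)]
  induction k with
  | zero => simp [fCoeff]
  | succ k ih =>
    have h := fCoeff_succ k
    have h1 := fCoeff_pos (k + 1)
    rw [one_pow, one_mul, le_div_iff₀ (by positivity)] at *
    rw [Nat.factorial_succ]
    push_cast
    rw [← h] at ih
    refine le_trans ?_ ih
    rw [mul_assoc, ← mul_assoc]
    have h2 : (0 : ℝ) < k.factorial := by positivity
    have h3 : ((k : ℝ) + 1) ≤ (3 * k + 2) * (3 * k + 3) := by nlinarith [(Nat.cast_nonneg k : (0 : ℝ) ≤ k)]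
    calc fCoeff (k + 1) * (k + 1) * k.factorial ≤
        fCoeff (k + 1) * ((3 * k + 2) * (3 * k + 3)) * k.factorial := by gcongr
      _ = _ := by ring

theorem entireBound_gCoeff : EntireBound gCoeff := by
  refine ⟨1, 1, zero_le_one, zero_le_one, fun k => ?_⟩
  rw [abs_of_pos (gCoeff_pos k)]
  induction k with
  | zero => simp [gCoeff]
  | succ k ih =>
    have h := gCoeff_succ k
    have h1 := gCoeff_pos (k + 1)
    rw [one_pow, one_mul, le_div_iff₀ (by positivity)] at *
    rw [Nat.factorial_succ]
    push_cast
    rw [← h] at ih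
    refine le_trans ?_ ih
    rw [mul_assoc, ← mul_assoc]
    have h2 : (0 : ℝ) < k.factorial := by positivity
    have h3 : ((k : ℝ) + 1) ≤ (3 * k + 3) * (3 * k + 4) := by nlinarith [(Nat.cast_nonneg k : (0 : ℝ) ≤ k)]
    calc gCoeff (k + 1) * (k + 1) * k.factorial ≤
        gCoeff (k + 1) * ((3 * k + 3) * (3 * k + 4)) * k.factorial := by gcongr
      _ = _ := by ring

theorem airyF_eq (x : ℝ) : airyF x = ∑' k, fCoeff k * x ^ (3 * k) := by
  rw [airyF]
  exact tsum_congr fun k => by rw [fCoeff]; ring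

theorem airyG_eq (x : ℝ) : airyG x = ∑' k, gCoeff k * x ^ (3 * k + 1) := by
  rw [airyG]
  exact tsum_congr fun k => by rw [gCoeff]; ring

/-- The derivative of `airyF`. -/
def airyF' (x : ℝ) : ℝ := ∑' k, fCoeff k * (3 * k : ℕ) * x ^ (3 * k - 1)

/-- The derivative of `airyG`. -/
def airyG' (x : ℝ) : ℝ := ∑' k, gCoeff k * (3 * k + 1 : ℕ) * x ^ (3 * k)

theorem hasDerivAt_airyF (x : ℝ) : HasDerivAt airyF (airyF' x) x := by
  rw [funext airyF_eq]
  exact entireBound_fCoeff.hasDerivAt (e := fun k => 3 * k) (fun k => by omega) x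

theorem hasDerivAt_airyG (x : ℝ) : HasDerivAt airyG (airyG' x) x := by
  rw [funext airyG_eq]
  exact entireBound_gCoeff.hasDerivAt (e := fun k => 3 * k + 1) (fun k => le_rfl) x

theorem hasDerivAt_airyF' (x : ℝ) : HasDerivAt airyF' (x * airyF x) x := by
  have hb := entireBound_fCoeff.mul_exponent (e := fun k => 3 * k) (fun k => by omega)
  refine (hb.hasDerivAt (e := fun k => 3 * k - 1) (fun k => by omega) x).congr_deriv ?_
  have hs : Summable fun k => fCoeff k * (3 * k : ℕ) * (3 * k - 1 : ℕ) * x ^ (3 * k - 1 - 1) :=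
    (hb.mul_exponent (e := fun k => 3 * k - 1) (fun k => by omega)).summable
      (e := fun k => 3 * k - 1 - 1) (fun k => by omega) x
  rw [hs.tsum_eq_zero_add, airyF_eq, ← tsum_mul_left]
  simp only [mul_zero, Nat.cast_zero, zero_mul, zero_add]
  refine tsum_congr fun k => ?_
  rw [← fCoeff_succ k, show 3 * (k + 1) - 1 - 1 = 3 * k + 1 by omega,
    show 3 * (k + 1) - 1 = 3 * k + 2 by omega]
  push_cast
  ring

theorem hasDerivAt_airyG' (x : ℝ) : HasDerivAt airyG' (x * airyG x) x := by
  have hb := entireBound_gCoeff.mul_exponent (e := fun k => 3 * k + 1) (fun k => by omega)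
  refine (hb.hasDerivAt (e := fun k => 3 * k) (fun k => by omega) x).congr_deriv ?_
  have hs : Summable fun k => gCoeff k * (3 * k + 1 : ℕ) * (3 * k : ℕ) * x ^ (3 * k - 1) :=
    (hb.mul_exponent (e := fun k => 3 * k) (fun k => by omega)).summable
      (e := fun k => 3 * k - 1) (fun k => by omega) x
  rw [hs.tsum_eq_zero_add, airyG_eq, ← tsum_mul_left]
  simp only [mul_zero, Nat.cast_zero, zero_mul, zero_add]
  refine tsum_congr fun k => ?_
  rw [← gCoeff_succ k, show 3 * (k + 1) - 1 = 3 * k + 2 by omega]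
  push_cast
  ring

theorem airyF_zero : airyF 0 = 1 := by
  rw [airyF_eq, tsum_eq_single 0 (fun k hk => by
    rw [zero_pow (by omega), mul_zero])]
  simp [fCoeff]

theorem airyF'_zero : airyF' 0 = 0 := by
  rw [airyF']
  refine (tsum_congr fun k => ?_).trans tsum_zero
  rcases k with _ | k
  · simp
  · rw [zero_pow (by omega), mul_zero]

theorem airyG'_zero : airyG' 0 = 1 := by
  rw [airyG', tsum_eq_single 0 (fun k hk => by
    rw [zero_pow (by omega), mul_zero])]
  simp [gCoeff]

theorem airyF_mul_airyG' (x : ℝ) : airyF x * airyG' x - airyF' x * airyG x = 1 := by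
  have h : ∀ x, HasDerivAt (fun x => airyF x * airyG' x - airyF' x * airyG x) 0 x := fun x =>
    (((hasDerivAt_airyF x).mul (hasDerivAt_airyG' x)).sub
      ((hasDerivAt_airyF' x).mul (hasDerivAt_airyG x))).congr_deriv (by ring)
  have h1 := is_const_of_deriv_eq_zero (fun x => (h x).differentiableAt) (fun x => (h x).deriv) x 0
  rw [airyF_zero, airyG'_zero, airyF'_zero] at h1
  linarith

theorem one_le_airyF {x : ℝ} (hx : 0 ≤ x) : 1 ≤ airyF x := by
  have h := (entireBound_fCoeff.summable (e := fun k => 3 * k) (fun k => by omega) x).le_tsum 0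
    fun k _ => mul_nonneg (fCoeff_pos k).le (by positivity)
  rw [airyF_eq]
  simpa [fCoeff] using h

theorem self_le_airyG {x : ℝ} (hx : 0 ≤ x) : x ≤ airyG x := by
  have h := (entireBound_gCoeff.summable (e := fun k => 3 * k + 1) (fun k => le_rfl) x).le_tsum 0
    fun k _ => mul_nonneg (gCoeff_pos k).le (by positivity)
  rw [airyG_eq]
  simpa [gCoeff] using h

theorem airyF'_nonneg {x : ℝ} (hx : 0 ≤ x) : 0 ≤ airyF' x :=
  tsum_nonneg fun k => mul_nonneg (mul_nonneg (fCoeff_pos k).le (by positivity)) (by positivity)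

theorem one_le_airyG' {x : ℝ} (hx : 0 ≤ x) : 1 ≤ airyG' x := by
  have h := ((entireBound_gCoeff.mul_exponent (e := fun k => 3 * k + 1) fun k => le_rfl).summable
    (e := fun k => 3 * k) (fun k => by omega) x).le_tsum 0
    fun k _ => mul_nonneg (mul_nonneg (gCoeff_pos k).le (by positivity)) (by positivity)
  rw [airyG']
  simpa [gCoeff] using h

/-- The quantity w'² - x w² has derivative -w², so it does not increase. -/
theorem energy_le {w w' : ℝ → ℝ} (h : ∀ x, HasDerivAt w (w' x) x)
    (h' : ∀ x, HasDerivAt w' (x * w x) x) {x : ℝ} (hx : 0 ≤ x) :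
    w' x ^ 2 ≤ x * w x ^ 2 + w' 0 ^ 2 := by
  have hd : ∀ x, HasDerivAt (fun x => w' x ^ 2 - x * w x ^ 2) (-(w x ^ 2)) x := fun x =>
    (((h' x).pow 2).sub ((hasDerivAt_id x).mul ((h x).pow 2))).congr_deriv (by
      simp only [id, Nat.cast_ofNat, Pi.pow_apply]; ring)
  have h1 : Antitone fun x => w' x ^ 2 - x * w x ^ 2 :=
    antitone_of_hasDerivAt_nonpos hd fun x => neg_nonpos.2 (sq_nonneg _)
  have h2 := h1 hx
  simp only [zero_mul, sub_zero] at h2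
  linarith

theorem airyF'_le {x : ℝ} (hx : 0 ≤ x) : airyF' x ≤ √x * airyF x := by
  have h := energy_le hasDerivAt_airyF hasDerivAt_airyF' hx
  rw [airyF'_zero] at h
  have h1 := one_le_airyF hx
  refine abs_le_of_sq_le_sq' ?_ (by positivity) |>.2
  rw [mul_pow, Real.sq_sqrt hx]
  linarith

theorem airyG'_le {x : ℝ} (hx : 0 ≤ x) : airyG' x ≤ √x * airyG x + 1 := by
  have h := energy_le hasDerivAt_airyG hasDerivAt_airyG' hx
  rw [airyG'_zero] at h
  have h1 : 0 ≤ airyG x := hx.trans (self_le_airyG hx)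
  refine abs_le_of_sq_le_sq' ?_ (by positivity) |>.2
  have h2 : 0 ≤ √x * airyG x := by positivity
  have h3 : (√x * airyG x) ^ 2 = x * airyG x ^ 2 := by rw [mul_pow, Real.sq_sqrt hx]
  nlinarith

/-- For n = 3k the weight (n + 2)(n + 3) equals n(n - 1) + 6n + 6, so the sum is x² F'' + 6x F' + 6F
with F'' = xF. The weight is chosen to match the recursion of the coefficients. -/
theorem hasSum_airyF {x : ℝ} :
    HasSum (fun k : ℕ => fCoeff k * x ^ (3 * k) * ((3 * k + 2) * (3 * k + 3)))
      (x ^ 3 * airyF x + 6 * (x * airyF' x) + 6 * airyF x) := by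
  have h0 := (entireBound_fCoeff.summable (e := fun k => 3 * k) (fun k => by omega) x).hasSum
  rw [← airyF_eq] at h0
  have hb := entireBound_fCoeff.mul_exponent (e := fun k => 3 * k) (fun k => by omega)
  have h1 := ((hb.summable (e := fun k => 3 * k - 1) (fun k => by omega) x).hasSum).mul_left x
  have h2 := (((hb.mul_exponent (e := fun k => 3 * k - 1) (fun k => by omega)).summable
      (e := fun k => 3 * k - 1 - 1) (fun k => by omega) x).hasSum).mul_left (x ^ 2)
  have e2 : ∑' k : ℕ, fCoeff k * (3 * k : ℕ) * (3 * k - 1 : ℕ) * x ^ (3 * k - 1 - 1) =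
      x * airyF x := (hb.hasDerivAt (e := fun k => 3 * k - 1) (fun k => by omega) x).unique
    (hasDerivAt_airyF' x)
  rw [e2] at h2
  have h3 := (h2.add (h1.mul_left 6)).add (h0.mul_left 6)
  have e3 : x ^ 3 * airyF x + 6 * (x * airyF' x) + 6 * airyF x =
      x ^ 2 * (x * airyF x) + 6 * (x * airyF' x) + 6 * airyF x := by ring
  rw [e3]
  refine h3.congr_fun fun k => ?_
  · cases k with
    | zero => simp; ring
    | succ k =>
      rw [show 3 * (k + 1) - 1 - 1 = 3 * k + 1 by omega, show 3 * (k + 1) - 1 = 3 * k + 2 by omega]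
      push_cast
      ring

theorem hasSum_airyG {x : ℝ} :
    HasSum (fun k : ℕ => gCoeff k * x ^ (3 * k + 1) * ((3 * k + 3) * (3 * k + 4)))
      (x ^ 3 * airyG x + 6 * (x * airyG' x) + 6 * airyG x) := by
  have h0 := (entireBound_gCoeff.summable (e := fun k => 3 * k + 1) (fun k => by omega) x).hasSum
  rw [← airyG_eq] at h0
  have hb := entireBound_gCoeff.mul_exponent (e := fun k => 3 * k + 1) (fun k => by omega)
  have h1 := ((hb.summable (e := fun k => 3 * k) (fun k => by omega) x).hasSum).mul_left x
  have h2 := (((hb.mul_exponent (e := fun k => 3 * k) (fun k => by omega)).summable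
      (e := fun k => 3 * k - 1) (fun k => by omega) x).hasSum).mul_left (x ^ 2)
  have e2 : ∑' k : ℕ, gCoeff k * (3 * k + 1 : ℕ) * (3 * k : ℕ) * x ^ (3 * k - 1) =
      x * airyG x := (hb.hasDerivAt (e := fun k => 3 * k) (fun k => by omega) x).unique
    (hasDerivAt_airyG' x)
  rw [e2] at h2
  have h3 := (h2.add (h1.mul_left 6)).add (h0.mul_left 6)
  have e3 : x ^ 3 * airyG x + 6 * (x * airyG' x) + 6 * airyG x =
      x ^ 2 * (x * airyG x) + 6 * (x * airyG' x) + 6 * airyG x := by ring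
  rw [e3]
  refine h3.congr_fun fun k => ?_
  · cases k with
    | zero => simp; ring
    | succ k =>
      rw [show 3 * (k + 1) - 1 = 3 * k + 2 by omega]
      push_cast
      ring

/-- The value at `0` of the classical Airy function. -/
def airyP : ℝ := 1 / ((3 : ℝ) ^ (2 / 3 : ℝ) * Real.Gamma (2 / 3))

/-- The negative of the derivative at `0` of the classical Airy function. -/
def airyQ : ℝ := 1 / ((3 : ℝ) ^ (1 / 3 : ℝ) * Real.Gamma (1 / 3))

theorem airyP_pos : 0 < airyP := by
  have := Real.Gamma_pos_of_pos (show (0 : ℝ) < 2 / 3 by norm_num)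
  rw [airyP]; positivity

theorem airyQ_pos : 0 < airyQ := by
  have := Real.Gamma_pos_of_pos (show (0 : ℝ) < 1 / 3 by norm_num)
  rw [airyQ]; positivity

/-- The reflection formula at 1/3. It normalises the Wronskian. -/
theorem airyP_mul_airyQ : airyP * airyQ * (2 * √3 * Real.pi) = 1 := by
  have h1 := Real.Gamma_mul_Gamma_one_sub (1 / 3)
  rw [show (1 : ℝ) - 1 / 3 = 2 / 3 by norm_num, show Real.pi * (1 / 3) = Real.pi / 3 by ring,
    Real.sin_pi_div_three] at h1
  have h2 : (3 : ℝ) ^ (2 / 3 : ℝ) * (3 : ℝ) ^ (1 / 3 : ℝ) = 3 := by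
    rw [← Real.rpow_add (by norm_num)]; norm_num
  have h3 : airyP * airyQ = 1 / (3 * (Real.pi / (√3 / 2))) := by
    rw [airyP, airyQ, ← h1, div_mul_div_comm, one_mul]
    congr 1
    linear_combination (Real.Gamma (2 / 3) * Real.Gamma (1 / 3)) * h2
  have h4 : √3 * √3 = 3 := Real.mul_self_sqrt (by norm_num)
  have h5 : √3 ≠ 0 := by positivity
  have h6 := Real.pi_ne_zero
  rw [h3]
  field_simp
  linarith

theorem airyAi_eq (x : ℝ) : airyAi x = √(2 * Real.pi) * (airyP * airyF x - airyQ * airyG x) := by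
  rw [airyAi, airyP, airyQ]; ring

theorem airyBi_eq (x : ℝ) :
    airyBi x = √(Real.pi / 2) * √3 * (airyP * airyF x + airyQ * airyG x) := by
  have h1 : (3 : ℝ) ^ (1 / 6 : ℝ) * √3 = 3 ^ (2 / 3 : ℝ) := by
    rw [Real.sqrt_eq_rpow, ← Real.rpow_add (by norm_num)]; norm_num
  have h2 : (3 : ℝ) ^ (1 / 6 : ℝ) * 3 ^ (1 / 3 : ℝ) = √3 := by
    rw [Real.sqrt_eq_rpow, ← Real.rpow_add (by norm_num)]; norm_num
  have h3 : (0 : ℝ) < 3 ^ (1 / 6 : ℝ) := by positivity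
  have h4 : (0 : ℝ) < 3 ^ (1 / 3 : ℝ) := by positivity
  have h5 : (0 : ℝ) < √3 := by positivity
  have h6 := Real.Gamma_pos_of_pos (show (0 : ℝ) < 2 / 3 by norm_num)
  have h7 := Real.Gamma_pos_of_pos (show (0 : ℝ) < 1 / 3 by norm_num)
  have e1 : airyP * √3 = 1 / (3 ^ (1 / 6 : ℝ) * Real.Gamma (2 / 3)) := by
    rw [airyP, ← h1]; field_simp
  have e2 : airyQ * √3 = 3 ^ (1 / 6 : ℝ) / Real.Gamma (1 / 3) := by
    rw [airyQ, ← h2]; field_simp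
  rw [airyBi]
  linear_combination -√(Real.pi / 2) * airyF x * e1 - √(Real.pi / 2) * airyG x * e2

theorem deriv_airyAi :
    deriv airyAi = fun x => √(2 * Real.pi) * (airyP * airyF' x - airyQ * airyG' x) := by
  funext x
  rw [funext airyAi_eq]
  exact ((((hasDerivAt_airyF x).const_mul _).sub ((hasDerivAt_airyG x).const_mul _)).const_mul
    _).deriv

theorem deriv_airyBi :
    deriv airyBi = fun x => √(Real.pi / 2) * √3 * (airyP * airyF' x + airyQ * airyG' x) := by
  funext x
  rw [funext airyBi_eq]
  exact ((((hasDerivAt_airyF x).const_mul _).add ((hasDerivAt_airyG x).const_mul _)).const_mul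
    _).deriv

theorem hasDerivAt_airyAi (x : ℝ) : HasDerivAt airyAi (deriv airyAi x) x := by
  refine DifferentiableAt.hasDerivAt ?_
  rw [funext airyAi_eq]
  exact ((((hasDerivAt_airyF x).const_mul _).sub ((hasDerivAt_airyG x).const_mul _)).const_mul
    _).differentiableAt

theorem hasDerivAt_airyBi (x : ℝ) : HasDerivAt airyBi (deriv airyBi x) x := by
  refine DifferentiableAt.hasDerivAt ?_
  rw [funext airyBi_eq]
  exact ((((hasDerivAt_airyF x).const_mul _).add ((hasDerivAt_airyG x).const_mul _)).const_mul
    _).differentiableAt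

theorem hasDerivAt_deriv_airyAi (x : ℝ) : HasDerivAt (deriv airyAi) (x * airyAi x) x := by
  rw [deriv_airyAi, airyAi_eq]
  exact ((((hasDerivAt_airyF' x).const_mul _).sub ((hasDerivAt_airyG' x).const_mul _)).const_mul
    _).congr_deriv (by ring)

theorem hasDerivAt_deriv_airyBi (x : ℝ) : HasDerivAt (deriv airyBi) (x * airyBi x) x := by
  rw [deriv_airyBi, airyBi_eq]
  exact ((((hasDerivAt_airyF' x).const_mul _).add ((hasDerivAt_airyG' x).const_mul _)).const_mul
    _).congr_deriv (by ring)

theorem airy_wronskian (x : ℝ) : airyAi x * deriv airyBi x - deriv airyAi x * airyBi x = 1 := by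
  have h1 : √(2 * Real.pi) * √(Real.pi / 2) = Real.pi := by
    rw [← Real.sqrt_mul (by positivity), show 2 * Real.pi * (Real.pi / 2) = Real.pi ^ 2 by ring,
      Real.sqrt_sq Real.pi_pos.le]
  rw [deriv_airyAi, deriv_airyBi, airyAi_eq, airyBi_eq]
  linear_combination 2 * √(2 * Real.pi) * √(Real.pi / 2) * √3 * airyP * airyQ *
    airyF_mul_airyG' x + 2 * √3 * airyP * airyQ * h1 + airyP_mul_airyQ

theorem le_airyBi : ∃ c > 0, ∀ x, 0 ≤ x → c * (1 + x) ≤ airyBi x := by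
  have hp := airyP_pos
  have hq := airyQ_pos
  have hm : 0 < min airyP airyQ := lt_min hp hq
  have := Real.pi_pos
  refine ⟨√(Real.pi / 2) * √3 * min airyP airyQ, by positivity, fun x hx => ?_⟩
  rw [airyBi_eq, mul_assoc _ (min _ _)]
  refine mul_le_mul_of_nonneg_left ?_ (by positivity)
  rw [mul_add, mul_one]
  refine add_le_add ?_ ?_
  · calc min airyP airyQ ≤ airyP * 1 := by rw [mul_one]; exact min_le_left _ _
      _ ≤ _ := mul_le_mul_of_nonneg_left (one_le_airyF hx) hp.le
  · exact mul_le_mul (min_le_right _ _) (self_le_airyG hx) hx hq.le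

theorem airyBi_pos {x : ℝ} (hx : 0 ≤ x) : 0 < airyBi x := by
  obtain ⟨c, hc, h⟩ := le_airyBi
  exact lt_of_lt_of_le (by positivity) (h x hx)

theorem tendsto_airyBi : Tendsto airyBi atTop atTop := by
  obtain ⟨c, hc, h⟩ := le_airyBi
  refine tendsto_atTop_mono' _ ?_ ((tendsto_id (α := ℝ)).const_mul_atTop hc)
  filter_upwards [eventually_ge_atTop 0] with x hx
  exact le_trans (mul_le_mul_of_nonneg_left (by simp) hc.le) (h x hx)

theorem deriv_airyBi_nonneg {x : ℝ} (hx : 0 ≤ x) : 0 ≤ deriv airyBi x := by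
  have hp := airyP_pos
  have hq := airyQ_pos
  have h1 := airyF'_nonneg hx
  have h2 := one_le_airyG' hx
  rw [deriv_airyBi]
  positivity

/-! ### The recessive solution -/

/-- Log-convexity of Γ between s and s + 1, cubed to remove the fractional powers. -/
theorem gamma_add_two_thirds_pow {s : ℝ} (hs : 0 < s) :
    Real.Gamma (s + 2 / 3) ^ 3 ≤ s ^ 2 * Real.Gamma s ^ 3 := by
  have h := Real.Gamma_mul_add_mul_le_rpow_Gamma_mul_rpow_Gamma (s := s) (t := s + 1)
    (a := 1 / 3) (b := 2 / 3) hs (by linarith) (by norm_num) (by norm_num) (by norm_num)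
  rw [show 1 / 3 * s + 2 / 3 * (s + 1) = s + 2 / 3 by ring] at h
  have hg := Real.Gamma_pos_of_pos hs
  have hg1 := Real.Gamma_pos_of_pos (show 0 < s + 1 by linarith)
  have hg2 := Real.Gamma_pos_of_pos (show 0 < s + 2 / 3 by linarith)
  calc Real.Gamma (s + 2 / 3) ^ 3 ≤
      (Real.Gamma s ^ (1 / 3 : ℝ) * Real.Gamma (s + 1) ^ (2 / 3 : ℝ)) ^ 3 :=
        pow_le_pow_left₀ hg2.le h 3
    _ = Real.Gamma s * Real.Gamma (s + 1) ^ 2 := by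
        rw [mul_pow, ← Real.rpow_natCast, ← Real.rpow_natCast, ← Real.rpow_mul hg.le,
          ← Real.rpow_mul hg1.le]
        norm_num
    _ = _ := by rw [Real.Gamma_add_one hs.ne']; ring

/-- The ratio of consecutive coefficients is rational in k, so the quotient of the two coefficient
sequences is a quotient of Gamma values. -/
theorem gCoeff_mul_gamma (k : ℕ) : gCoeff k * (Real.Gamma (2 / 3) * Real.Gamma (k + 4 / 3)) =
    fCoeff k * (Real.Gamma (4 / 3) * Real.Gamma (k + 2 / 3)) := by
  induction k with
  | zero => simp [gCoeff, fCoeff]; ring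
  | succ k ih =>
    have h1 := fCoeff_succ k
    have h2 := gCoeff_succ k
    have h3 := Real.Gamma_add_one (s := k + 4 / 3) (by positivity)
    have h4 := Real.Gamma_add_one (s := k + 2 / 3) (by positivity)
    push_cast
    rw [show (k : ℝ) + 1 + 4 / 3 = k + 4 / 3 + 1 by ring,
      show (k : ℝ) + 1 + 2 / 3 = k + 2 / 3 + 1 by ring, h3, h4]
    rw [← h1, ← h2] at ih
    have h5 : (3 * (k : ℝ) + 3) ≠ 0 := by positivity
    refine mul_right_cancel₀ (mul_ne_zero three_ne_zero h5) ?_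
    linear_combination ih

/-- The limit of `airyG / airyF` at infinity. -/
def airyRatio : ℝ := airyP / airyQ

theorem airyRatio_pos : 0 < airyRatio := div_pos airyP_pos airyQ_pos

theorem airyRatio_pow : (airyRatio * Real.Gamma (2 / 3)) ^ 3 = 9 * Real.Gamma (4 / 3) ^ 3 := by
  have h6 := Real.Gamma_pos_of_pos (show (0 : ℝ) < 2 / 3 by norm_num)
  have h7 := Real.Gamma_pos_of_pos (show (0 : ℝ) < 1 / 3 by norm_num)
  have h2 : (3 : ℝ) ^ (1 / 3 : ℝ) * (3 : ℝ) ^ (1 / 3 : ℝ) = 3 ^ (2 / 3 : ℝ) := by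
    rw [← Real.rpow_add (by norm_num)]; norm_num
  have h3 : ((3 : ℝ) ^ (1 / 3 : ℝ)) ^ 3 = 3 := by
    rw [← Real.rpow_natCast, ← Real.rpow_mul (by norm_num)]; norm_num
  have h4 : (0 : ℝ) < 3 ^ (1 / 3 : ℝ) := by positivity
  have h5 : airyRatio * Real.Gamma (2 / 3) * 3 ^ (1 / 3 : ℝ) = Real.Gamma (1 / 3) := by
    rw [airyRatio, airyP, airyQ, ← h2]; field_simp
  have h8 : Real.Gamma (4 / 3) = 1 / 3 * Real.Gamma (1 / 3) := by
    rw [← Real.Gamma_add_one (by norm_num)]; norm_num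
  have h9 : (airyRatio * Real.Gamma (2 / 3)) ^ 3 * 3 = Real.Gamma (1 / 3) ^ 3 := by
    rw [← h5, mul_pow _ (3 ^ (1 / 3 : ℝ) : ℝ), h3]
  rw [h8]
  linear_combination (1 / 3) * h9

theorem pow_three_gCoeff (k : ℕ) :
    9 * (gCoeff k * Real.Gamma (k + 4 / 3)) ^ 3 =
      (airyRatio * fCoeff k * Real.Gamma (k + 2 / 3)) ^ 3 := by
  have h6 := Real.Gamma_pos_of_pos (show (0 : ℝ) < 2 / 3 by norm_num)
  have h := congrArg (· ^ 3) (gCoeff_mul_gamma k)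
  have h1 := airyRatio_pow
  refine mul_right_cancel₀ (pow_ne_zero 3 h6.ne') ?_
  linear_combination 9 * h - (fCoeff k * Real.Gamma (k + 2 / 3)) ^ 3 * h1

/-- With ρ = `airyRatio`, the term ρ f_k x^(3k) is at most about g_k x^(3k+1) when x³ is about
(3k+2)(3k+3), which is where the series concentrate. The companion `gCoeff_pow_le` compares in the
other direction, with f_(k+1). -/
theorem airyRatio_mul_fCoeff_pow_le (k : ℕ) :
    (airyRatio * fCoeff k) ^ 3 ≤ gCoeff k ^ 3 * ((3 * k + 2) * (3 * k + 3)) := by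
  have h := gamma_add_two_thirds_pow (s := k + 2 / 3) (by positivity)
  rw [show (k : ℝ) + 2 / 3 + 2 / 3 = k + 4 / 3 by ring] at h
  have hg := Real.Gamma_pos_of_pos (s := k + 2 / 3) (by positivity)
  have hc := gCoeff_pos k
  have h1 := pow_three_gCoeff k
  refine le_of_mul_le_mul_right ?_ (pow_pos hg 3)
  calc (airyRatio * fCoeff k) ^ 3 * Real.Gamma (k + 2 / 3) ^ 3 =
      9 * (gCoeff k ^ 3 * Real.Gamma (k + 4 / 3) ^ 3) := by rw [← mul_pow, ← mul_pow, h1]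
    _ ≤ 9 * (gCoeff k ^ 3 * ((k + 2 / 3) ^ 2 * Real.Gamma (k + 2 / 3) ^ 3)) := by gcongr
    _ = gCoeff k ^ 3 * ((3 * k + 2) * (3 * k + 2)) * Real.Gamma (k + 2 / 3) ^ 3 := by ring
    _ ≤ _ := by gcongr; norm_num

theorem gCoeff_pow_le (k : ℕ) :
    gCoeff k ^ 3 ≤ (airyRatio * fCoeff (k + 1)) ^ 3 * ((3 * k + 3) * (3 * k + 4)) ^ 2 := by
  have h := gamma_add_two_thirds_pow (s := k + 1) (by positivity)
  have h' := gamma_add_two_thirds_pow (s := k + 4 / 3) (by positivity)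
  rw [show (k : ℝ) + 1 + 2 / 3 = k + 2 / 3 + 1 by ring,
    Real.Gamma_add_one (by positivity)] at h
  rw [show (k : ℝ) + 4 / 3 + 2 / 3 = k + 1 + 1 by ring, Real.Gamma_add_one (by positivity)] at h'
  have hg := Real.Gamma_pos_of_pos (s := k + 4 / 3) (by positivity)
  have hc := fCoeff_pos (k + 1)
  have hr := airyRatio_pos
  have h1 := pow_three_gCoeff k
  rw [← fCoeff_succ k] at h1
  have hk : (0 : ℝ) < k + 1 := by positivity
  refine le_of_mul_le_mul_right ?_ (pow_pos hg 3)
  have h2 : ((k : ℝ) + 1) * ((k + 2 / 3) * Real.Gamma (k + 2 / 3)) ^ 3 ≤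
      (k + 4 / 3) ^ 2 * Real.Gamma (k + 4 / 3) ^ 3 := by
    refine le_trans ?_ h'
    calc _ ≤ ((k : ℝ) + 1) * ((k + 1) ^ 2 * Real.Gamma (k + 1) ^ 3) := by gcongr
      _ = _ := by ring
  calc gCoeff k ^ 3 * Real.Gamma (k + 4 / 3) ^ 3 =
      81 * (airyRatio * fCoeff (k + 1)) ^ 3 * (k + 1) ^ 2 *
        ((k + 1) * ((k + 2 / 3) * Real.Gamma (k + 2 / 3)) ^ 3) := by linear_combination h1 / 9
    _ ≤ 81 * (airyRatio * fCoeff (k + 1)) ^ 3 * (k + 1) ^ 2 *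
        ((k + 4 / 3) ^ 2 * Real.Gamma (k + 4 / 3) ^ 3) := by gcongr
    _ = _ := by ring

/-- With u = t v the hypothesis is t³ ≤ q, and 4t - t⁴ ≤ 3 by tangency at t = 1. This replaces a
cube root by an expression affine in q, which can be summed over k. -/
theorem mul_four_sub_le {u v q : ℝ} (hu : 0 < u) (hv : 0 < v) (h : u ^ 3 ≤ v ^ 3 * q) :
    u * (4 - q) / 3 ≤ v := by
  obtain ⟨t, ht, rfl⟩ : ∃ t, 0 < t ∧ u = t * v := ⟨u / v, div_pos hu hv, by field_simp⟩
  have h1 : t ^ 3 ≤ q := by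
    rw [mul_pow, mul_comm (v ^ 3)] at h
    exact le_of_mul_le_mul_right h (pow_pos hv 3)
  have h2 : t * (4 - q) ≤ 3 := by
    nlinarith [mul_nonneg (sq_nonneg (t - 1)) (show 0 ≤ t ^ 2 + 2 * t + 3 by positivity),
      mul_le_mul_of_nonneg_left h1 ht.le]
  nlinarith

/-- With v = t² u the hypothesis gives t³ ≤ q, and 5t² - 2t⁵ ≤ 3, again with equality at t = 1. -/
theorem mul_five_sub_le {u v q : ℝ} (hu : 0 < u) (hv : 0 < v) (hq : 0 ≤ q)
    (h : v ^ 3 ≤ u ^ 3 * q ^ 2) : v * (5 - 2 * q) / 3 ≤ u := by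
  obtain ⟨t, ht, rfl⟩ : ∃ t, 0 < t ∧ v = t ^ 2 * u := ⟨√(v / u), by positivity, by
    rw [Real.sq_sqrt (by positivity)]; field_simp⟩
  have h1 : t ^ 3 ≤ q := by
    have h2 : (t ^ 3) ^ 2 ≤ q ^ 2 := by
      rw [mul_pow, mul_comm (u ^ 3)] at h
      have := le_of_mul_le_mul_right h (pow_pos hu 3)
      linarith [show (t ^ 2) ^ 3 = (t ^ 3) ^ 2 by ring]
    exact le_of_sq_le_sq h2 hq
  have h2 : t ^ 2 * (5 - 2 * q) ≤ 3 := by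
    nlinarith [mul_nonneg (sq_nonneg (t - 1))
      (show 0 ≤ 2 * t ^ 3 + 4 * t ^ 2 + 6 * t + 3 by positivity),
      mul_le_mul_of_nonneg_left h1 (sq_nonneg t)]
  nlinarith

/-- Compare term by term with q = (3k+2)(3k+3)/x³; the part affine in q sums to derivatives of F by
`hasSum_airyF`. -/
theorem airyRatio_mul_airyF_le {x : ℝ} (hx : 0 < x) :
    airyRatio * (airyF x - 2 * airyF' x / x ^ 2 - 2 * airyF x / x ^ 3) ≤ airyG x := by
  have h0 := (entireBound_fCoeff.summable (e := fun k => 3 * k) (fun k => by omega) x).hasSum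
  have h1 := (entireBound_gCoeff.summable (e := fun k => 3 * k + 1) (fun k => le_rfl) x).hasSum
  rw [← airyF_eq] at h0
  rw [← airyG_eq] at h1
  have h2 := ((h0.mul_left 4).sub ((hasSum_airyF (x := x)).mul_left (1 / x ^ 3))).mul_left
    (airyRatio / 3)
  refine le_trans (le_of_eq ?_) (hasSum_le (fun k => ?_) h2 h1)
  · field_simp; ring
  · have hf := fCoeff_pos k
    have hg := gCoeff_pos k
    have hr := airyRatio_pos
    have := mul_four_sub_le (u := airyRatio * fCoeff k) (v := x * gCoeff k)
      (q := (3 * k + 2) * (3 * k + 3) / x ^ 3) (by positivity) (by positivity) (by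
        refine (airyRatio_mul_fCoeff_pow_le k).trans (le_of_eq ?_)
        field_simp)
    have h3 := mul_le_mul_of_nonneg_right this (pow_nonneg hx.le (3 * k))
    refine le_trans (le_of_eq ?_) (h3.trans (le_of_eq ?_)) <;> ring

theorem airyG_le_airyRatio_mul {x : ℝ} (hx : 0 < x) :
    airyG x - 4 * airyG' x / x ^ 2 - 4 * airyG x / x ^ 3 ≤ airyRatio * airyF x := by
  have h0 := (entireBound_fCoeff.summable (e := fun k => 3 * k) (fun k => by omega) x).hasSum
  have h1 := (entireBound_gCoeff.summable (e := fun k => 3 * k + 1) (fun k => le_rfl) x).hasSum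
  rw [← airyF_eq] at h0
  rw [← airyG_eq] at h1
  have h2 := ((h1.mul_left 5).sub ((hasSum_airyG (x := x)).mul_left (2 / x ^ 3))).mul_left (1 / 3)
  have h4 := ((hasSum_nat_add_iff' 1).2 h0).mul_left airyRatio
  refine le_trans (le_of_eq ?_) ((hasSum_le (fun k => ?_) h2 h4).trans ?_)
  · field_simp; ring
  · have hf := fCoeff_pos (k + 1)
    have hg := gCoeff_pos k
    have hr := airyRatio_pos
    have := mul_five_sub_le (u := airyRatio * fCoeff (k + 1) * x ^ 2) (v := gCoeff k)
      (q := (3 * k + 3) * (3 * k + 4) / x ^ 3) (by positivity) (by positivity) (by positivity) (by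
        refine (gCoeff_pow_le k).trans (le_of_eq ?_)
        field_simp)
    have h3 := mul_le_mul_of_nonneg_right this (pow_nonneg hx.le (3 * k + 1))
    refine le_trans (le_of_eq ?_) (h3.trans (le_of_eq ?_)) <;> ring
  · have hr := airyRatio_pos
    refine mul_le_mul_of_nonneg_left ?_ hr.le
    simp [fCoeff]

/-- The two termwise comparisons leave errors of relative size 1/x, since the energy estimate bounds
F'/F by √x and G' by √x G + 1. -/
theorem abs_airyRatio_mul_airyF_sub_airyG_le {x : ℝ} (hx : 1 ≤ x) :
    |airyRatio * airyF x - airyG x| ≤ 12 / x * (airyRatio * airyF x + airyG x) := by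
  have hx0 : 0 < x := by linarith
  have hr := airyRatio_pos
  have hF := one_le_airyF hx0.le
  have hG := self_le_airyG hx0.le
  have hG0 : 0 < airyG x := hx0.trans_le hG
  have hs : √x ≤ x := Real.sqrt_le_iff.2 ⟨hx0.le, by nlinarith⟩
  have h1 := airyRatio_mul_airyF_le hx0
  have h2 := airyG_le_airyRatio_mul hx0
  have hF' : airyF' x ≤ x * airyF x := (airyF'_le hx0.le).trans (by gcongr)
  have hG' : airyG' x ≤ 2 * (x * airyG x) := (airyG'_le hx0.le).trans (by
    have : √x * airyG x ≤ x * airyG x := by gcongr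
    nlinarith)
  have e1 : 2 * airyF' x / x ^ 2 ≤ 2 * airyF x / x := by
    rw [div_le_div_iff₀ (by positivity) hx0]; nlinarith
  have e2 : 2 * airyF x / x ^ 3 ≤ 2 * airyF x / x :=
    div_le_div_of_nonneg_left (by positivity) hx0 (le_self_pow₀ hx (by norm_num))
  have e3 : 4 * airyG' x / x ^ 2 ≤ 8 * airyG x / x := by
    rw [div_le_div_iff₀ (by positivity) hx0]; nlinarith
  have e4 : 4 * airyG x / x ^ 3 ≤ 4 * airyG x / x :=
    div_le_div_of_nonneg_left (by positivity) hx0 (le_self_pow₀ hx (by norm_num))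
  have p1 : 0 ≤ airyRatio * airyF x / x := by positivity
  have p2 : 0 ≤ airyG x / x := by positivity
  have e5 : 12 / x * (airyRatio * airyF x + airyG x) =
      12 * (airyRatio * airyF x / x) + 12 * (airyG x / x) := by ring
  rw [e5, abs_le]
  constructor
  · have : 8 * airyG x / x + 4 * airyG x / x = 12 * (airyG x / x) := by ring
    linarith
  · have h3 : airyRatio * (airyF x - 2 * airyF x / x - 2 * airyF x / x) ≤ airyG x :=
      le_trans (mul_le_mul_of_nonneg_left (by linarith) hr.le) h1
    have : airyRatio * (airyF x - 2 * airyF x / x - 2 * airyF x / x) =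
      airyRatio * airyF x - 4 * (airyRatio * airyF x / x) := by ring
    linarith

/-- Ai and Bi are proportional to ρF - G and ρF + G with the same ρ. The Gamma values in the
definition make ρ the limit of G/F, so the leading growth cancels in Ai. -/
theorem tendsto_airyAi_div_airyBi : Tendsto (fun x => airyAi x / airyBi x) atTop (nhds 0) := by
  have hq := airyQ_pos
  have hpi := Real.pi_pos
  set A := √(2 * Real.pi) with hA
  set B := √(Real.pi / 2) * √3 with hB
  have hA0 : 0 < A := by positivity
  have hB0 : 0 < B := by positivity
  have h0 : Tendsto (fun x : ℝ => A / B * (12 / x)) atTop (nhds 0) := by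
    have := ((tendsto_const_nhds (x := (12 : ℝ))).div_atTop tendsto_id).const_mul (A / B)
    simpa using this
  refine squeeze_zero_norm' ?_ h0
  filter_upwards [eventually_ge_atTop 1] with x hx
  have h := abs_airyRatio_mul_airyF_sub_airyG_le hx
  have hx0 : 0 < x := by linarith
  have e1 : airyAi x = A * airyQ * (airyRatio * airyF x - airyG x) := by
    rw [airyAi_eq, airyRatio, ← hA]; field_simp
  have e2 : airyBi x = B * airyQ * (airyRatio * airyF x + airyG x) := by
    rw [airyBi_eq, airyRatio, ← hB]; field_simp
  have hb := airyBi_pos hx0.le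
  rw [Real.norm_eq_abs, abs_div, abs_of_pos hb, div_le_iff₀ hb, e1, e2, abs_mul,
    abs_of_pos (by positivity : 0 < A * airyQ)]
  calc A * airyQ * |airyRatio * airyF x - airyG x| ≤
      A * airyQ * (12 / x * (airyRatio * airyF x + airyG x)) := by gcongr
    _ = _ := by field_simp

namespace AiryFormal

open PowerSeries

/-! ### Asymptotics of the logarithmic derivative and of the product of the Airy functions -/

theorem X_pow_dvd_trunc_sub (m : ℕ) (s : ℝ⟦X⟧) :
    (X : ℝ⟦X⟧) ^ m ∣ ((trunc m s : Polynomial ℝ) : ℝ⟦X⟧) - s := by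
  rw [X_pow_dvd_iff]
  intro k hk
  rw [map_sub, Polynomial.coeff_coe, coeff_trunc, if_pos hk, sub_self]

theorem X_pow_dvd_X_sq_mul_derivative {m : ℕ} {s : ℝ⟦X⟧} (h : (X : ℝ⟦X⟧) ^ m ∣ s) :
    (X : ℝ⟦X⟧) ^ m ∣ X ^ 2 * d⁄dX ℝ s := by
  rw [X_pow_dvd_iff] at h ⊢
  intro k hk
  rw [coeff_X_pow_mul']
  split_ifs with h2
  · rw [coeff_derivative, h _ (by omega), zero_mul]
  · rfl

/-- The function `x ^ e * p (x ^ (-3/2))`. -/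
def polyRpow (e : ℝ) (p : Polynomial ℝ) (x : ℝ) : ℝ := x ^ e * p.eval (x ^ (-3 / 2 : ℝ))

theorem rpow_neg_three_halves_le_one {x : ℝ} (hx : 1 ≤ x) : x ^ (-3 / 2 : ℝ) ≤ 1 :=
  Real.rpow_le_one_of_one_le_of_nonpos hx (by norm_num)

theorem hasDerivAt_polyRpow (e : ℝ) (p : Polynomial ℝ) {x : ℝ} (hx : 0 < x) :
    HasDerivAt (polyRpow e p) (x ^ (e - 1) * (e * p.eval (x ^ (-3 / 2 : ℝ)) -
      3 / 2 * x ^ (-3 / 2 : ℝ) * p.derivative.eval (x ^ (-3 / 2 : ℝ)))) x := by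
  have h1 := Real.hasDerivAt_rpow_const (x := x) (p := e) (Or.inl hx.ne')
  have h2 := Real.hasDerivAt_rpow_const (x := x) (p := (-3 / 2 : ℝ)) (Or.inl hx.ne')
  have h3 := (p.hasDerivAt (x ^ (-3 / 2 : ℝ))).comp x h2
  refine (h1.mul h3).congr_deriv ?_
  have e1 : x ^ e * x ^ (-3 / 2 - 1 : ℝ) = x ^ (e - 1) * x ^ (-3 / 2 : ℝ) := by
    rw [← Real.rpow_add hx, ← Real.rpow_add hx]; ring_nf
  simp only [Function.comp_apply]
  linear_combination (-3 / 2) * p.derivative.eval (x ^ (-3 / 2 : ℝ)) * e1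

theorem exists_abs_eval_le {m : ℕ} {p : Polynomial ℝ} (h : (X : ℝ⟦X⟧) ^ m ∣ (p : ℝ⟦X⟧)) :
    ∃ C, 0 ≤ C ∧ ∀ x : ℝ, 1 ≤ x → |p.eval (x ^ (-3 / 2 : ℝ))| ≤ C * x ^ (-3 / 2 * m : ℝ) := by
  have h1 : (Polynomial.X : Polynomial ℝ) ^ m ∣ p := by
    rw [Polynomial.X_pow_dvd_iff]
    rw [X_pow_dvd_iff] at h
    exact fun k hk => by rw [← Polynomial.coeff_coe]; exact h k hk
  obtain ⟨q, rfl⟩ := h1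
  obtain ⟨C, hC⟩ := isCompact_Icc.exists_bound_of_continuousOn (s := Set.Icc (0 : ℝ) 1)
    q.continuous.continuousOn
  have hC0 : 0 ≤ C := (norm_nonneg _).trans (hC 0 ⟨le_rfl, zero_le_one⟩)
  refine ⟨C, hC0, fun x hx => ?_⟩
  have hx0 : 0 < x := by linarith
  have hh : 0 < x ^ (-3 / 2 : ℝ) := Real.rpow_pos_of_pos hx0 _
  rw [Polynomial.eval_mul, Polynomial.eval_pow, Polynomial.eval_X, abs_mul,
    abs_of_nonneg (pow_nonneg hh.le m), mul_comm, Real.rpow_mul hx0.le, Real.rpow_natCast]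
  exact mul_le_mul_of_nonneg_right (hC _ ⟨hh.le, rpow_neg_three_halves_le_one hx⟩) (by positivity)

/-- The residual of a polynomial in the Riccati equation. -/
def residualB (p : Polynomial ℝ) : Polynomial ℝ :=
  p ^ 2 + Polynomial.C (1 / 2) * (Polynomial.X * p) -
    Polynomial.C (3 / 2) * (Polynomial.X ^ 2 * p.derivative) - 1

/-- The truncation agrees with an exact solution modulo X^m, and s ↦ X² s' preserves divisibility by
X^m. -/
theorem X_pow_dvd_residualB (m : ℕ) :
    (X : ℝ⟦X⟧) ^ m ∣ (residualB (trunc m beta) : ℝ⟦X⟧) := by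
  have h := X_pow_dvd_trunc_sub m beta
  have h1 := X_pow_dvd_X_sq_mul_derivative h
  set p := trunc m beta
  have e : ((residualB p : Polynomial ℝ) : ℝ⟦X⟧) = ((p : ℝ⟦X⟧) - beta) * ((p : ℝ⟦X⟧) + beta + C (1 / 2) * X) -
      C (3 / 2) * (X ^ 2 * d⁄dX ℝ ((p : ℝ⟦X⟧) - beta)) := by
    have h2 := riccati_beta
    rw [residualB, map_sub, derivative_coe]
    push_cast
    linear_combination h2
  rw [e]
  exact dvd_sub (h.mul_right _) (h1.mul_left _)

/-- The residual in the equation `f' = 2 b f - 1`. -/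
def residualF (p q : Polynomial ℝ) : Polynomial ℝ :=
  Polynomial.C 2 * p * q - 1 + Polynomial.C (1 / 2) * (Polynomial.X * q) +
    Polynomial.C (3 / 2) * (Polynomial.X ^ 2 * q.derivative)

theorem X_pow_dvd_residualF (m : ℕ) :
    (X : ℝ⟦X⟧) ^ m ∣ (residualF (trunc m beta) (trunc m phi) : ℝ⟦X⟧) := by
  have h := X_pow_dvd_trunc_sub m beta
  have h' := X_pow_dvd_trunc_sub m phi
  have h1 := X_pow_dvd_X_sq_mul_derivative h'
  set p := trunc m beta
  set q := trunc m phi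
  have e : ((residualF p q : Polynomial ℝ) : ℝ⟦X⟧) =
      ((p : ℝ⟦X⟧) - beta) * (C 2 * (q : ℝ⟦X⟧)) + ((q : ℝ⟦X⟧) - phi) * (C 2 * beta + C (1 / 2) * X) +
      C (3 / 2) * (X ^ 2 * d⁄dX ℝ ((q : ℝ⟦X⟧) - phi)) := by
    have h2 := beta_mul
    rw [phi'] at h2
    rw [residualF, map_sub, derivative_coe]
    push_cast
    linear_combination h2
  rw [e]
  exact dvd_add (dvd_add (h.mul_right _) (h'.mul_right _)) (h1.mul_left _)

/-- M x^s is a barrier: at a contact point the damping gives v' < -(M/4) x^(s+1/2), while the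
barrier decreases no faster than that beyond X₀. -/
theorem le_rpow_of_decay {v c r : ℝ → ℝ} {X₀ C s : ℝ} (hX : 1 ≤ X₀) (hs : s ≤ 0)
    (hsX : -1 / 4 ≤ s * X₀ ^ (-3 / 2 : ℝ))
    (hv : ∀ x, X₀ ≤ x → HasDerivAt v (-c x * v x + r x) x)
    (hc : ∀ x, X₀ ≤ x → x ^ (1 / 2 : ℝ) / 2 ≤ c x)
    (hr : ∀ x, X₀ ≤ x → |r x| ≤ C * x ^ (s + 1 / 2)) {M : ℝ} (hM : 0 < M) (hCM : 4 * C < M)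
    (h0 : v X₀ ≤ M * X₀ ^ s) {x : ℝ} (hx : X₀ ≤ x) : v x ≤ M * x ^ s := by
  have hd : ∀ y, X₀ ≤ y → HasDerivAt (fun y => M * y ^ s) (M * (s * y ^ (s - 1))) y := fun y hy =>
    (Real.hasDerivAt_rpow_const (Or.inl (by linarith : (0 : ℝ) < y).ne')).const_mul M
  refine image_le_of_deriv_right_lt_deriv_boundary' (f := v) (f' := fun y => -c y * v y + r y)
    (a := X₀) (b := x) (B := fun y => M * y ^ s) (B' := fun y => M * (s * y ^ (s - 1)))
    (fun y hy => (hv y hy.1).continuousAt.continuousWithinAt)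
    (fun y hy => (hv y hy.1).hasDerivWithinAt) h0
    (fun y hy => (hd y hy.1).continuousAt.continuousWithinAt)
    (fun y hy => (hd y hy.1).hasDerivWithinAt) ?_ ⟨hx, le_rfl⟩
  intro y hy hvy
  have hy0 : 0 < y := by linarith [hy.1]
  have h1 := (le_abs_self _).trans (hr y hy.1)
  have h2 := hc y hy.1
  have e1 : y ^ (s - 1) = y ^ (s + 1 / 2) * y ^ (-3 / 2 : ℝ) := by
    rw [← Real.rpow_add hy0]; ring_nf
  have e2 : y ^ (1 / 2 : ℝ) * y ^ s = y ^ (s + 1 / 2) := by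
    rw [← Real.rpow_add hy0]; ring_nf
  have hp : 0 < y ^ (s + 1 / 2) := Real.rpow_pos_of_pos hy0 _
  have hps : 0 < y ^ s := Real.rpow_pos_of_pos hy0 _
  have h3 : -1 / 4 ≤ s * y ^ (-3 / 2 : ℝ) := hsX.trans <| mul_le_mul_of_nonpos_left
    (Real.rpow_le_rpow_of_nonpos (by linarith) hy.1 (by norm_num)) hs
  have h4 : y ^ (1 / 2 : ℝ) / 2 * (M * y ^ s) ≤ c y * (M * y ^ s) :=
    mul_le_mul_of_nonneg_right h2 (by positivity)
  have h5 : M * y ^ (s + 1 / 2) * (-1 / 4) ≤ M * y ^ (s + 1 / 2) * (s * y ^ (-3 / 2 : ℝ)) :=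
    mul_le_mul_of_nonneg_left h3 (by positivity)
  have h6 : 4 * C * y ^ (s + 1 / 2) < M * y ^ (s + 1 / 2) := mul_lt_mul_of_pos_right hCM hp
  have e3 : y ^ (1 / 2 : ℝ) / 2 * (M * y ^ s) = M * y ^ (s + 1 / 2) / 2 := by rw [← e2]; ring
  have e4 : M * (s * y ^ (s - 1)) = M * y ^ (s + 1 / 2) * (s * y ^ (-3 / 2 : ℝ)) := by
    rw [e1]; ring
  rw [hvy, e4]
  linarith

theorem isBigO_of_decay {v c r : ℝ → ℝ} {C s : ℝ} (hs : s ≤ 0)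
    (hv : ∀ᶠ x in atTop, HasDerivAt v (-c x * v x + r x) x)
    (hc : ∀ᶠ x in atTop, x ^ (1 / 2 : ℝ) / 2 ≤ c x)
    (hr : ∀ᶠ x in atTop, |r x| ≤ C * x ^ (s + 1 / 2)) : v =O[atTop] fun x => x ^ s := by
  have h0 : Tendsto (fun x : ℝ => s * x ^ (-3 / 2 : ℝ)) atTop (nhds (s * 0)) :=
    (by simpa [neg_div] using tendsto_rpow_neg_atTop (show (0 : ℝ) < 3 / 2 by norm_num) :
      Tendsto (fun x : ℝ => x ^ (-3 / 2 : ℝ)) atTop (nhds 0)).const_mul s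
  have h1 : ∀ᶠ x : ℝ in atTop, -1 / 4 ≤ s * x ^ (-3 / 2 : ℝ) :=
    h0.eventually (Filter.Eventually.mono (lt_mem_nhds (by norm_num)) fun _ h => le_of_lt h)
  obtain ⟨X₀, hX⟩ := eventually_atTop.1 (hv.and (hc.and (hr.and (h1.and (eventually_ge_atTop 1)))))
  have hX1 := (hX X₀ le_rfl).2.2.2.2
  have hp : 0 < X₀ ^ s := Real.rpow_pos_of_pos (by linarith) _
  -- Large enough for the barrier condition and for the initial value at X₀, for both v and -v.
  set M := 4 * |C| + 1 + |v X₀| / X₀ ^ s with hM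
  have hM0 : 0 < M := by positivity
  have hCM : 4 * C < M := by
    have h2 : 0 ≤ |v X₀| / X₀ ^ s := by positivity
    linarith [le_abs_self C]
  have hM1 : |v X₀| ≤ M * X₀ ^ s := by
    have : |v X₀| = |v X₀| / X₀ ^ s * X₀ ^ s := by field_simp
    rw [this]
    exact mul_le_mul_of_nonneg_right (by rw [hM]; linarith [abs_nonneg C]) hp.le
  refine IsBigO.of_bound M ?_
  filter_upwards [eventually_ge_atTop X₀] with x hx
  have hx0 : 0 < x := by linarith
  rw [Real.norm_eq_abs, Real.norm_eq_abs, abs_of_pos (Real.rpow_pos_of_pos hx0 _), abs_le]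
  constructor
  · rw [neg_le]
    refine le_rpow_of_decay (v := fun x => -v x) (r := fun x => -r x) hX1 hs
      (hX X₀ le_rfl).2.2.2.1 (fun y hy => ((hX y hy).1.neg).congr_deriv (by ring))
      (fun y hy => (hX y hy).2.1) (fun y hy => ?_) hM0 hCM ((neg_le_abs _).trans hM1) hx
    rw [abs_neg]
    exact (hX y hy).2.2.1
  · exact le_rpow_of_decay hX1 hs (hX X₀ le_rfl).2.2.2.1 (fun y hy => (hX y hy).1)
      (fun y hy => (hX y hy).2.1) (fun y hy => (hX y hy).2.2.1) hM0 hCM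
      ((le_abs_self _).trans hM1) hx

/-- For an equation with growth the estimate is propagated from infinity: (C x^s - v)/E, with E the
homogeneous solution, is nonincreasing and tends to 0, hence is nonnegative. -/
theorem le_rpow_of_growth {v c r E : ℝ → ℝ} {X₀ C s : ℝ} (hX : 0 < X₀) (hs : s ≤ 0)
    (hv : ∀ x, X₀ ≤ x → HasDerivAt v (c x * v x + r x) x)
    (hE : ∀ x, X₀ ≤ x → HasDerivAt E (c x * E x) x) (hE0 : ∀ x, X₀ ≤ x → 0 < E x)
    (hc : ∀ x, X₀ ≤ x → x ^ (1 / 2 : ℝ) ≤ c x)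
    (hr : ∀ x, X₀ ≤ x → |r x| ≤ C * x ^ (s + 1 / 2)) (hC : 0 ≤ C)
    (h0 : Tendsto (fun x => (C * x ^ s - v x) / E x) atTop (nhds 0)) {x : ℝ} (hx : X₀ ≤ x) :
    v x ≤ C * x ^ s := by
  have hd : ∀ y, X₀ ≤ y → HasDerivAt (fun x => (C * x ^ s - v x) / E x)
      ((C * (s * y ^ (s - 1)) - C * c y * y ^ s - r y) / E y) y := fun y hy => by
    have hy0 : 0 < y := by linarith
    refine ((((Real.hasDerivAt_rpow_const (Or.inl hy0.ne')).const_mul C).sub (hv y hy)).div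
      (hE y hy) (hE0 y hy).ne').congr_deriv ?_
    have := (hE0 y hy).ne'
    simp only [Pi.sub_apply]
    field_simp
    ring
  have hanti : AntitoneOn (fun x => (C * x ^ s - v x) / E x) (Set.Ici X₀) := by
    refine antitoneOn_of_hasDerivWithinAt_nonpos (convex_Ici _)
      (f' := fun y => (C * (s * y ^ (s - 1)) - C * c y * y ^ s - r y) / E y)
      (fun y hy => (hd y hy).continuousAt.continuousWithinAt)
      (fun y hy => (hd y (interior_subset hy)).hasDerivWithinAt) (fun y hy => ?_)
    have hy := interior_subset hy
    have hy1 : X₀ ≤ y := hy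
    have hy0 : 0 < y := by linarith
    refine div_nonpos_of_nonpos_of_nonneg ?_ (hE0 y hy).le
    have h1 := (neg_abs_le (r y))
    have h2 := hr y hy
    have hp : 0 < y ^ s := Real.rpow_pos_of_pos hy0 _
    have e2 : y ^ (1 / 2 : ℝ) * y ^ s = y ^ (s + 1 / 2) := by
      rw [← Real.rpow_add hy0]; ring_nf
    have h3 : C * (y ^ (1 / 2 : ℝ) * y ^ s) ≤ C * (c y * y ^ s) :=
      mul_le_mul_of_nonneg_left (mul_le_mul_of_nonneg_right (hc y hy) hp.le) hC
    have h4 : C * (s * y ^ (s - 1)) ≤ 0 := mul_nonpos_of_nonneg_of_nonpos hC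
      (mul_nonpos_of_nonpos_of_nonneg hs (Real.rpow_pos_of_pos hy0 _).le)
    rw [e2] at h3
    linarith
  have h1 : 0 ≤ (C * x ^ s - v x) / E x := by
    refine le_of_tendsto h0 ?_
    filter_upwards [eventually_ge_atTop x] with y hy
    exact hanti hx (hx.trans hy : X₀ ≤ y) hy
  have h2 := mul_nonneg h1 (hE0 x hx).le
  rw [div_mul_cancel₀ _ (hE0 x hx).ne'] at h2
  linarith

theorem isBigO_of_growth {v c r E : ℝ → ℝ} {C s : ℝ} (hs : s ≤ 0) (hC : 0 ≤ C)
    (hv : ∀ᶠ x in atTop, HasDerivAt v (c x * v x + r x) x)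
    (hE : ∀ᶠ x in atTop, HasDerivAt E (c x * E x) x) (hE0 : ∀ᶠ x in atTop, 0 < E x)
    (hc : ∀ᶠ x in atTop, x ^ (1 / 2 : ℝ) ≤ c x)
    (hr : ∀ᶠ x in atTop, |r x| ≤ C * x ^ (s + 1 / 2))
    (hEt : Tendsto E atTop atTop) (h0 : Tendsto (fun x => v x / E x) atTop (nhds 0)) :
    v =O[atTop] fun x => x ^ s := by
  obtain ⟨X₀, hX⟩ := eventually_atTop.1
    (hv.and (hE.and (hE0.and (hc.and (hr.and (eventually_ge_atTop 1))))))
  have h1 : Tendsto (fun x => C * x ^ s / E x) atTop (nhds 0) := by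
    have h2 : Tendsto (fun x => C / E x) atTop (nhds 0) := tendsto_const_nhds.div_atTop hEt
    refine squeeze_zero_norm' ?_ h2
    filter_upwards [eventually_ge_atTop 1, hE0] with x hx hx'
    rw [Real.norm_eq_abs, abs_of_nonneg (by positivity)]
    refine div_le_div_of_nonneg_right ?_ hx'.le
    exact mul_le_of_le_one_right hC (Real.rpow_le_one_of_one_le_of_nonpos hx hs)
  have hX1 : 0 < X₀ := by linarith [(hX X₀ le_rfl).2.2.2.2.2]
  refine IsBigO.of_bound C ?_
  filter_upwards [eventually_ge_atTop X₀] with x hx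
  have hx0 : 0 < x := by linarith
  rw [Real.norm_eq_abs, Real.norm_eq_abs, abs_of_pos (Real.rpow_pos_of_pos hx0 _), abs_le]
  constructor
  · rw [neg_le]
    refine le_rpow_of_growth (v := fun x => -v x) (r := fun x => -r x) (c := c) (E := E) hX1 hs
      (fun y hy => ((hX y hy).1.neg).congr_deriv (by ring)) (fun y hy => (hX y hy).2.1)
      (fun y hy => (hX y hy).2.2.1) (fun y hy => (hX y hy).2.2.2.1) (fun y hy => ?_) hC ?_ hx
    · rw [abs_neg]; exact (hX y hy).2.2.2.2.1
    · simpa [add_div] using h1.add h0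
  · refine le_rpow_of_growth (c := c) (E := E) (r := r) hX1 hs
      (fun y hy => (hX y hy).1) (fun y hy => (hX y hy).2.1)
      (fun y hy => (hX y hy).2.2.1) (fun y hy => (hX y hy).2.2.2.1)
      (fun y hy => (hX y hy).2.2.2.2.1) hC ?_ hx
    simpa [sub_div] using h1.sub h0

/-- The logarithmic derivative of `airyBi`. -/
def logDerivBi (x : ℝ) : ℝ := deriv airyBi x / airyBi x

/-- The product of the two Airy functions. -/
def airyProd (x : ℝ) : ℝ := airyAi x * airyBi x

theorem logDerivBi_nonneg {x : ℝ} (hx : 0 ≤ x) : 0 ≤ logDerivBi x :=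
  div_nonneg (deriv_airyBi_nonneg hx) (airyBi_pos hx).le

theorem hasDerivAt_logDerivBi {x : ℝ} (hx : 0 ≤ x) :
    HasDerivAt logDerivBi (x - logDerivBi x ^ 2) x := by
  have hb := (airyBi_pos hx).ne'
  refine ((hasDerivAt_deriv_airyBi x).div (hasDerivAt_airyBi x) hb).congr_deriv ?_
  rw [logDerivBi]
  field_simp

theorem hasDerivAt_airyProd {x : ℝ} (hx : 0 ≤ x) :
    HasDerivAt airyProd (2 * logDerivBi x * airyProd x - 1) x := by
  have hb := (airyBi_pos hx).ne'
  refine ((hasDerivAt_airyAi x).mul (hasDerivAt_airyBi x)).congr_deriv ?_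
  have := airy_wronskian x
  rw [logDerivBi, airyProd]
  field_simp
  linarith

theorem eventually_half_le_eval {p : Polynomial ℝ} (hp : p.coeff 0 = 1) :
    ∀ᶠ x : ℝ in atTop, 1 / 2 ≤ p.eval (x ^ (-3 / 2 : ℝ)) := by
  have h : Tendsto (fun x : ℝ => x ^ (-3 / 2 : ℝ)) atTop (nhds 0) := by
    simpa [neg_div] using tendsto_rpow_neg_atTop (show (0 : ℝ) < 3 / 2 by norm_num)
  have h1 := (p.continuous.tendsto 0).comp h
  rw [← Polynomial.coeff_zero_eq_eval_zero, hp] at h1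
  exact h1.eventually (Filter.Eventually.mono (lt_mem_nhds (by norm_num)) fun _ h => le_of_lt h)

/-- The difference v between Bi'/Bi and the truncated series P satisfies v' = -(Bi'/Bi + P) v - x ·
residual, and the damping coefficient is at least √x/2 eventually. -/
theorem isBigO_logDerivBi_succ (m : ℕ) :
    (fun x => logDerivBi x - polyRpow (1 / 2) (trunc (m + 1) beta) x) =O[atTop]
      fun x : ℝ => x ^ (1 / 2 - 3 / 2 * (m + 1 : ℕ) : ℝ) := by
  obtain ⟨C, hC, hR⟩ := exists_abs_eval_le (X_pow_dvd_residualB (m + 1))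
  have hp : (trunc (m + 1) beta).coeff 0 = 1 := by
    rw [coeff_trunc, if_pos (by omega), coeff_zero_beta]
  set p := trunc (m + 1) beta
  refine isBigO_of_decay (c := fun x => logDerivBi x + polyRpow (1 / 2) p x)
    (r := fun x => -(x * (residualB p).eval (x ^ (-3 / 2 : ℝ)))) (C := C) ?_ ?_ ?_ ?_
  · have : (0 : ℝ) ≤ m := by positivity
    push_cast
    linarith
  · filter_upwards [eventually_gt_atTop 0] with x hx
    refine ((hasDerivAt_logDerivBi hx.le).sub (hasDerivAt_polyRpow (1 / 2) p hx)).congr_deriv ?_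
    have e1 : x ^ (1 / 2 - 1 : ℝ) = x * x ^ (-3 / 2 : ℝ) := by
      rw [← Real.rpow_one_add' hx.le (by norm_num)]; norm_num
    have e2 : x ^ (1 / 2 : ℝ) * x ^ (1 / 2 : ℝ) = x := by
      rw [← Real.rpow_add hx]; norm_num
    simp only [residualB, polyRpow, Polynomial.eval_sub, Polynomial.eval_add, Polynomial.eval_mul,
      Polynomial.eval_pow, Polynomial.eval_C, Polynomial.eval_X, Polynomial.eval_one]
    rw [e1]
    linear_combination -(p.eval (x ^ (-3 / 2 : ℝ))) ^ 2 * e2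
  · filter_upwards [eventually_half_le_eval hp, eventually_ge_atTop 0] with x hx hx0
    have h1 := logDerivBi_nonneg hx0
    have h2 : x ^ (1 / 2 : ℝ) * (1 / 2) ≤ polyRpow (1 / 2) p x :=
      mul_le_mul_of_nonneg_left hx (Real.rpow_nonneg hx0 _)
    linarith
  · filter_upwards [eventually_ge_atTop 1] with x hx
    have hx0 : 0 < x := by linarith
    rw [abs_neg, abs_mul, abs_of_pos hx0]
    refine (mul_le_mul_of_nonneg_left (hR x hx) hx0.le).trans (le_of_eq ?_)
    rw [mul_left_comm]
    congr 1
    nth_rewrite 1 [← Real.rpow_one x]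
    rw [← Real.rpow_add hx0]
    ring_nf

theorem eventually_rpow_le_two_mul_logDerivBi :
    ∀ᶠ x : ℝ in atTop, x ^ (1 / 2 : ℝ) ≤ 2 * logDerivBi x := by
  obtain ⟨C, hC⟩ := (isBigO_logDerivBi_succ 0).bound
  have h : Tendsto (fun x : ℝ => C * x ^ (-3 / 2 : ℝ)) atTop (nhds (C * 0)) :=
    (by simpa [neg_div] using tendsto_rpow_neg_atTop (show (0 : ℝ) < 3 / 2 by norm_num) :
      Tendsto (fun x : ℝ => x ^ (-3 / 2 : ℝ)) atTop (nhds 0)).const_mul C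
  have h1 : ∀ᶠ x : ℝ in atTop, C * x ^ (-3 / 2 : ℝ) < 1 / 2 :=
    h.eventually (gt_mem_nhds (by norm_num))
  filter_upwards [hC, h1, eventually_gt_atTop 0] with x hx h2 hx0
  have e : polyRpow (1 / 2) (trunc (0 + 1) beta) x = x ^ (1 / 2 : ℝ) := by
    have : trunc (0 + 1) beta = 1 := by
      rw [zero_add, trunc_one_left, coeff_zero_beta, map_one]
    rw [polyRpow, this, Polynomial.eval_one, mul_one]
  have hp : 0 < x ^ (1 / 2 : ℝ) := Real.rpow_pos_of_pos hx0 _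
  have e1 : x ^ (1 / 2 - 3 / 2 * (0 + 1 : ℕ) : ℝ) = x ^ (-3 / 2 : ℝ) * x ^ (1 / 2 : ℝ) := by
    rw [← Real.rpow_add hx0]; push_cast; ring_nf
  rw [e, Real.norm_eq_abs, Real.norm_eq_abs, abs_of_pos (Real.rpow_pos_of_pos hx0 _), e1,
    ← mul_assoc] at hx
  have h3 := mul_le_mul_of_nonneg_right h2.le hp.le
  have := (abs_le.1 (hx.trans h3)).1
  linarith

/-- The product satisfies f' = 2(Bi'/Bi) f - 1, with homogeneous solution Bi². Its growing component
is excluded because Ai Bi / Bi² = Ai/Bi tends to 0. -/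
theorem isBigO_airyProd_succ (m : ℕ) :
    (fun x => airyProd x - polyRpow (-1 / 2) (trunc (m + 1) phi) x) =O[atTop]
      fun x : ℝ => x ^ (-1 / 2 - 3 / 2 * (m + 1 : ℕ) : ℝ) := by
  obtain ⟨C, hC, hR⟩ := exists_abs_eval_le (X_pow_dvd_residualF (m + 1))
  obtain ⟨C₁, hC₁, hB⟩ := (isBigO_logDerivBi_succ m).exists_nonneg
  obtain ⟨C₂, hC₂, hq⟩ := exists_abs_eval_le (m := 0) (p := trunc (m + 1) phi) (by simp)
  set p := trunc (m + 1) beta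
  set q := trunc (m + 1) phi
  have hqb : ∀ x : ℝ, 1 ≤ x → |polyRpow (-1 / 2) q x| ≤ C₂ * x ^ (-1 / 2 : ℝ) := fun x hx => by
    have hp : 0 < x ^ (-1 / 2 : ℝ) := Real.rpow_pos_of_pos (by linarith) _
    rw [polyRpow, abs_mul, abs_of_pos hp, mul_comm]
    refine mul_le_mul_of_nonneg_right ((hq x hx).trans (le_of_eq ?_)) hp.le
    simp
  have hEt : Tendsto (fun x => airyBi x ^ 2) atTop atTop :=
    (tendsto_pow_atTop two_ne_zero).comp tendsto_airyBi
  refine isBigO_of_growth (c := fun x => 2 * logDerivBi x) (E := fun x => airyBi x ^ 2)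
    (r := fun x => 2 * (logDerivBi x - polyRpow (1 / 2) p x) * polyRpow (-1 / 2) q x +
      (residualF p q).eval (x ^ (-3 / 2 : ℝ))) (C := 2 * C₁ * C₂ + C) ?_ (by positivity) ?_ ?_ ?_
      eventually_rpow_le_two_mul_logDerivBi ?_ hEt ?_
  · have : (0 : ℝ) ≤ m := by positivity
    push_cast
    linarith
  · filter_upwards [eventually_gt_atTop 0] with x hx
    refine ((hasDerivAt_airyProd hx.le).sub (hasDerivAt_polyRpow (-1 / 2) q hx)).congr_deriv ?_
    have e1 : x ^ (-1 / 2 - 1 : ℝ) = x ^ (-3 / 2 : ℝ) := by norm_num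
    have e2 : x ^ (1 / 2 : ℝ) * x ^ (-1 / 2 : ℝ) = 1 := by
      rw [← Real.rpow_add hx]; norm_num
    simp only [residualF, polyRpow, Polynomial.eval_sub, Polynomial.eval_add, Polynomial.eval_mul,
      Polynomial.eval_pow, Polynomial.eval_C, Polynomial.eval_X, Polynomial.eval_one]
    rw [e1]
    linear_combination (2 * p.eval (x ^ (-3 / 2 : ℝ)) * q.eval (x ^ (-3 / 2 : ℝ))) * e2
  · filter_upwards [eventually_ge_atTop 0] with x hx
    have hb := (airyBi_pos hx).ne'
    refine ((hasDerivAt_airyBi x).pow 2).congr_deriv ?_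
    rw [logDerivBi]
    field_simp
    push_cast
    ring
  · filter_upwards [eventually_ge_atTop 0] with x hx
    exact pow_pos (airyBi_pos hx) 2
  · filter_upwards [eventually_ge_atTop 1, hB.bound] with x hx hBx
    have hx0 : 0 < x := by linarith
    rw [Real.norm_eq_abs, Real.norm_eq_abs, abs_of_pos (Real.rpow_pos_of_pos hx0 _)] at hBx
    refine (abs_add_le _ _).trans ?_
    rw [add_mul]
    refine add_le_add ?_ ((hR x hx).trans (le_of_eq ?_))
    · rw [abs_mul, abs_mul, abs_two]
      calc 2 * |logDerivBi x - polyRpow (1 / 2) p x| * |polyRpow (-1 / 2) q x| ≤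
          2 * (C₁ * x ^ (1 / 2 - 3 / 2 * (m + 1 : ℕ) : ℝ)) * (C₂ * x ^ (-1 / 2 : ℝ)) := by
            gcongr
            exact hqb x hx
        _ = 2 * C₁ * C₂ * (x ^ (1 / 2 - 3 / 2 * (m + 1 : ℕ) : ℝ) * x ^ (-1 / 2 : ℝ)) := by ring
        _ = _ := by rw [← Real.rpow_add hx0]; ring_nf
    · congr 2; ring
  · have h1 : Tendsto (fun x => polyRpow (-1 / 2) q x / airyBi x ^ 2) atTop (nhds 0) := by
      have h2 : Tendsto (fun x => C₂ / airyBi x ^ 2) atTop (nhds 0) :=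
        tendsto_const_nhds.div_atTop hEt
      refine squeeze_zero_norm' ?_ h2
      filter_upwards [eventually_ge_atTop 1] with x hx
      have hb := airyBi_pos (zero_le_one.trans hx)
      rw [Real.norm_eq_abs, abs_div, abs_of_pos (pow_pos hb 2)]
      refine div_le_div_of_nonneg_right ((hqb x hx).trans ?_) (pow_pos hb 2).le
      exact mul_le_of_le_one_right hC₂ (Real.rpow_le_one_of_one_le_of_nonpos hx (by norm_num))
    have h3 : (fun x => airyAi x / airyBi x) =ᶠ[atTop] fun x => airyProd x / airyBi x ^ 2 := by
      filter_upwards [eventually_ge_atTop 0] with x hx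
      have hb := (airyBi_pos hx).ne'
      rw [airyProd]
      field_simp
    simpa [sub_div] using (tendsto_airyAi_div_airyBi.congr' h3).sub h1

end AiryFormal

namespace AiryFormal

open PowerSeries

/-! ### Uniform asymptotic expansions -/

variable {ι : Type*}

/-- `u` has along `l` the asymptotic expansion `∑ coeff k s * ε ^ k`, uniformly. -/
structure HasExpansion (l : Filter ι) (ε : ι → ℝ) (u : ι → ℝ) (s : ι → ℝ⟦X⟧) : Prop where
  isBigO_coeff : ∀ k, (fun i => coeff k (s i)) =O[l] fun _ => (1 : ℝ)
  isBigO : ∀ m, (fun i => u i - ∑ k ∈ range m, coeff k (s i) * ε i ^ k) =O[l] fun i => ε i ^ m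

namespace HasExpansion

variable {l : Filter ι} {ε u v : ι → ℝ} {s t : ι → ℝ⟦X⟧}

theorem isBigO_one (h : HasExpansion l ε u s) : u =O[l] fun _ => (1 : ℝ) := by
  simpa using h.isBigO 0

theorem congr' (h : HasExpansion l ε u s) (hu : u =ᶠ[l] v) (hs : s =ᶠ[l] t) :
    HasExpansion l ε v t where
  isBigO_coeff k := (h.isBigO_coeff k).congr' (hs.mono fun i hi => by beta_reduce; rw [hi]) EventuallyEq.rfl
  isBigO m := (h.isBigO m).congr' (hu.mp (hs.mono fun i hi hi' => by
    beta_reduce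
    rw [hi, hi'])) EventuallyEq.rfl

theorem comp_tendsto {κ : Type*} {l' : Filter κ} {g : κ → ι} (h : HasExpansion l ε u s)
    (hg : Tendsto g l' l) : HasExpansion l' (ε ∘ g) (u ∘ g) (s ∘ g) where
  isBigO_coeff k := (h.isBigO_coeff k).comp_tendsto hg
  isBigO m := (h.isBigO m).comp_tendsto hg

theorem isBigO_pow_of_le (hε : ε =O[l] fun _ => (1 : ℝ)) {m n : ℕ} (hmn : m ≤ n) :
    (fun i => ε i ^ n) =O[l] fun i => ε i ^ m := by
  obtain ⟨d, rfl⟩ := Nat.exists_eq_add_of_le hmn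
  simpa [pow_add] using (isBigO_refl (fun i => ε i ^ m) l).mul (hε.pow d)

theorem of_succ (hε : ε =O[l] fun _ => (1 : ℝ))
    (h : ∀ k, (fun i => coeff k (s i)) =O[l] fun _ => (1 : ℝ))
    (h' : ∀ m, (fun i => u i - ∑ k ∈ range (m + 1), coeff k (s i) * ε i ^ k) =O[l]
      fun i => ε i ^ (m + 1)) : HasExpansion l ε u s where
  isBigO_coeff := h
  isBigO m := by
    have h1 := (h' m).trans (isBigO_pow_of_le hε m.le_succ)
    have h2 : (fun i => coeff m (s i) * ε i ^ m) =O[l] fun i => ε i ^ m := by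
      simpa using (h m).mul (isBigO_refl (fun i => ε i ^ m) l)
    refine (h1.add h2).congr_left fun i => ?_
    rw [sum_range_succ]
    ring

theorem const {c : ι → ℝ} (h : c =O[l] fun _ => (1 : ℝ)) : HasExpansion l ε c fun i => C (c i) where
  isBigO_coeff k := by
    simp only [coeff_C]
    split_ifs
    · exact h
    · exact isBigO_zero _ _
  isBigO m := by
    cases m with
    | zero => simpa using h
    | succ m => simpa [sum_range_succ', coeff_C] using isBigO_zero _ _

theorem add (h : HasExpansion l ε u s) (h' : HasExpansion l ε v t) :
    HasExpansion l ε (fun i => u i + v i) fun i => s i + t i where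
  isBigO_coeff k := by simpa using (h.isBigO_coeff k).add (h'.isBigO_coeff k)
  isBigO m := by
    refine ((h.isBigO m).add (h'.isBigO m)).congr_left fun i => ?_
    simp only [map_add, add_mul, sum_add_distrib]
    ring

theorem div_eps (hε : ∀ᶠ i in l, ε i ≠ 0) (h : HasExpansion l ε u fun i => X * s i) :
    HasExpansion l ε (fun i => u i / ε i) s where
  isBigO_coeff k := by simpa [coeff_succ_X_mul] using h.isBigO_coeff (k + 1)
  isBigO m := by
    refine ((h.isBigO (m + 1)).mul (isBigO_refl (fun i => (ε i)⁻¹) l)).congr' ?_ ?_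
    · filter_upwards [hε] with i hi
      rw [sum_range_succ', coeff_zero_X_mul, zero_mul, add_zero, sub_mul, sum_mul, div_eq_mul_inv]
      congr 1
      refine sum_congr rfl fun k _ => ?_
      rw [coeff_succ_X_mul, pow_succ]
      field_simp
    · filter_upwards [hε] with i hi
      rw [pow_succ]
      field_simp

theorem sub_coeff_zero (h : HasExpansion l ε u s) :
    HasExpansion l ε (fun i => u i - coeff 0 (s i))
      fun i => X * PowerSeries.mk fun k => coeff (k + 1) (s i) := by
  refine (h.add (const (h.isBigO_coeff 0).neg_left)).congr' (Eventually.of_forall fun i => ?_)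
    (Eventually.of_forall fun i => ?_)
  · simp [sub_eq_add_neg]
  · beta_reduce
    nth_rewrite 1 [eq_X_mul_shift_add_const (s i)]
    simp

/-- Split off the constant coefficient of the first series: that part uses order m + 1 of v, and the
rest is ε times a product known to order m. -/
theorem isBigO_mul (hε : ∀ᶠ i in l, ε i ≠ 0) (h' : HasExpansion l ε v t) (m : ℕ) :
    ∀ {u : ι → ℝ} {s : ι → ℝ⟦X⟧}, HasExpansion l ε u s →
    (fun i => u i * v i - ∑ k ∈ range m, coeff k (s i * t i) * ε i ^ k) =O[l]
      fun i => ε i ^ m := by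
  induction m with
  | zero =>
    intro u s h
    simpa using h.isBigO_one.mul h'.isBigO_one
  | succ m ih =>
    intro u s h
    have h1 := ((ih (h.sub_coeff_zero.div_eps hε)).mul (isBigO_refl ε l))
    have h2 := (h.isBigO_coeff 0).mul (h'.isBigO (m + 1))
    simp only [one_mul, ← pow_succ] at h1 h2
    refine (h2.add h1).congr' ?_ EventuallyEq.rfl
    filter_upwards [hε] with i hi
    have e : ∀ k, coeff (k + 1) (s i * t i) = coeff 0 (s i) * coeff (k + 1) (t i) +
        coeff k ((PowerSeries.mk fun k => coeff (k + 1) (s i)) * t i) := fun k => by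
      nth_rewrite 1 [eq_X_mul_shift_add_const (s i)]
      rw [add_mul, map_add, coeff_C_mul, mul_assoc, coeff_succ_X_mul,
        coeff_zero_eq_constantCoeff_apply]
      ring
    have e0 : coeff 0 (s i * t i) = coeff 0 (s i) * coeff 0 (t i) := by simp
    rw [sum_range_succ', sum_range_succ', e0]
    simp only [e, add_mul, sum_add_distrib, mul_sub, mul_add, mul_sum, sub_mul, sum_mul, pow_succ]
    have e1 : (u i - coeff 0 (s i)) / ε i * v i * ε i = (u i - coeff 0 (s i)) * v i := by
      field_simp
    rw [e1]
    simp only [mul_assoc]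
    ring

theorem mul (hε : ∀ᶠ i in l, ε i ≠ 0) (h : HasExpansion l ε u s) (h' : HasExpansion l ε v t) :
    HasExpansion l ε (fun i => u i * v i) fun i => s i * t i where
  isBigO_coeff k := by
    simp only [coeff_mul]
    refine IsBigO.fun_sum fun p _ => ?_
    simpa using (h.isBigO_coeff p.1).mul (h'.isBigO_coeff p.2)
  isBigO m := isBigO_mul hε h' m h

theorem const_mul (hε : ∀ᶠ i in l, ε i ≠ 0) {c : ι → ℝ} (hc : c =O[l] fun _ => (1 : ℝ))
    (h : HasExpansion l ε u s) : HasExpansion l ε (fun i => c i * u i) fun i => C (c i) * s i :=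
  (const hc).mul hε h

theorem neg (hε : ∀ᶠ i in l, ε i ≠ 0) (h : HasExpansion l ε u s) :
    HasExpansion l ε (fun i => -u i) fun i => -s i := by
  simpa using const_mul (c := fun _ => -1) hε (isBigO_const_const _ one_ne_zero _) h

theorem sub (hε : ∀ᶠ i in l, ε i ≠ 0) (h : HasExpansion l ε u s) (h' : HasExpansion l ε v t) :
    HasExpansion l ε (fun i => u i - v i) fun i => s i - t i := by
  simpa [sub_eq_add_neg] using h.add (h'.neg hε)

theorem zero : HasExpansion l ε (fun _ => 0) fun _ => 0 := by
  simpa using const (l := l) (ε := ε) (isBigO_zero (fun _ => (1 : ℝ)) l)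

theorem one : HasExpansion l ε (fun _ => 1) fun _ => 1 := by
  simpa using const (l := l) (ε := ε) (isBigO_refl (fun _ => (1 : ℝ)) l)

theorem sum {κ : Type*} (S : Finset κ) {u : κ → ι → ℝ} {s : κ → ι → ℝ⟦X⟧}
    (h : ∀ j ∈ S, HasExpansion l ε (u j) (s j)) :
    HasExpansion l ε (fun i => ∑ j ∈ S, u j i) fun i => ∑ j ∈ S, s j i := by
  classical
  induction S using Finset.induction_on with
  | empty => simpa using zero
  | insert a S ha ih =>
    simp only [sum_insert ha]
    exact (h a (mem_insert_self a S)).add (ih fun j hj => h j (mem_insert_of_mem hj))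

theorem prod (hε : ∀ᶠ i in l, ε i ≠ 0) {κ : Type*} (S : Finset κ) {u : κ → ι → ℝ}
    {s : κ → ι → ℝ⟦X⟧} (h : ∀ j ∈ S, HasExpansion l ε (u j) (s j)) :
    HasExpansion l ε (fun i => ∏ j ∈ S, u j i) fun i => ∏ j ∈ S, s j i := by
  classical
  induction S using Finset.induction_on with
  | empty => simpa using one
  | insert a S ha ih =>
    simp only [prod_insert ha]
    exact (h a (mem_insert_self a S)).mul hε (ih fun j hj => h j (mem_insert_of_mem hj))

theorem pow (hε : ∀ᶠ i in l, ε i ≠ 0) (h : HasExpansion l ε u s) (j : ℕ) :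
    HasExpansion l ε (fun i => u i ^ j) fun i => s i ^ j := by
  simpa using prod hε (range j) fun _ _ => h

theorem eps (hε : ε =O[l] fun _ => (1 : ℝ)) : HasExpansion l ε ε fun _ => X := by
  refine of_succ hε (fun k => isBigO_const_const _ one_ne_zero _) fun m => ?_
  cases m with
  | zero => simpa using isBigO_refl ε l
  | succ m =>
    have : ∀ i, ε i - ∑ k ∈ range (m + 1 + 1), coeff k (X : ℝ⟦X⟧) * ε i ^ k = 0 := fun i => by
      rw [sum_eq_single 1 (fun k _ hk => by rw [coeff_X, if_neg hk, zero_mul])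
        (fun h => absurd h (by simp)), coeff_one_X, pow_one, one_mul, sub_self]
    simpa only [this] using isBigO_zero _ _

/-- Partial sums of a power series. -/
theorem coeff_sum_C_mul_X_pow (s : ℝ⟦X⟧) {k m : ℕ} (hk : k < m) :
    coeff k (∑ j ∈ range m, C (coeff j s) * X ^ j) = coeff k s := by
  simp [coeff_X_pow, hk]

theorem coeff_mul_congr {s t t' : ℝ⟦X⟧} {m : ℕ} (h : ∀ k < m, coeff k t = coeff k t') {k : ℕ}
    (hk : k < m) : coeff k (s * t) = coeff k (s * t') := by
  rw [coeff_mul, coeff_mul]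
  refine sum_congr rfl fun p hp => ?_
  rw [h p.2 (by have := mem_antidiagonal.1 hp; omega)]

/-- The constant coefficient is bounded away from 0, hence so is u. If T is a partial sum of t, then
u T = 1 + O(ε^(m+1)), and multiplying by the bounded u⁻¹ gives the expansion. -/
theorem inv (hε0 : Tendsto ε l (nhds 0)) (hε : ∀ᶠ i in l, ε i ≠ 0) (h : HasExpansion l ε u s)
    (ht : ∀ k, (fun i => coeff k (t i)) =O[l] fun _ => (1 : ℝ)) (hst : ∀ᶠ i in l, s i * t i = 1) :
    (∀ᶠ i in l, u i ≠ 0) ∧ HasExpansion l ε (fun i => (u i)⁻¹) t := by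
  have hε1 : ε =O[l] fun _ => (1 : ℝ) := hε0.isBigO_one ℝ
  obtain ⟨c, hc, hct⟩ := (ht 0).exists_pos
  have h0 : Tendsto (fun i => u i - coeff 0 (s i)) l (nhds 0) := by
    refine IsBigO.trans_tendsto ?_ hε0
    simpa using h.isBigO 1
  have hlow : ∀ᶠ i in l, 1 / (2 * c) ≤ |u i| := by
    have h1 : ∀ᶠ i in l, |u i - coeff 0 (s i)| < 1 / (2 * c) := by
      have := h0.abs
      rw [abs_zero] at this
      exact this.eventually (gt_mem_nhds (by positivity))
    filter_upwards [h1, hct.bound, hst] with i h1 h2 h3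
    have h4 : coeff 0 (s i) * coeff 0 (t i) = 1 := by
      have := congrArg (coeff 0) h3
      simpa using this
    rw [norm_one, mul_one, Real.norm_eq_abs] at h2
    have h5 : 1 ≤ |coeff 0 (s i)| * c := by
      calc (1 : ℝ) = |coeff 0 (s i)| * |coeff 0 (t i)| := by rw [← abs_mul, h4, abs_one]
        _ ≤ _ := by gcongr
    have h6 : 1 / c ≤ |coeff 0 (s i)| := by rwa [div_le_iff₀ hc]
    have h7 := abs_sub_abs_le_abs_sub (coeff 0 (s i)) (u i)
    rw [abs_sub_comm] at h7
    have h8 : 1 / c = 1 / (2 * c) + 1 / (2 * c) := by field_simp; norm_num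
    linarith
  have hne : ∀ᶠ i in l, u i ≠ 0 := hlow.mono fun i hi h0 => by
    rw [h0, abs_zero] at hi
    exact absurd hi (not_le.2 (by positivity))
  refine ⟨hne, of_succ hε1 ht fun m => ?_⟩
  have hinv : (fun i => (u i)⁻¹) =O[l] fun _ => (1 : ℝ) := by
    refine IsBigO.of_bound (2 * c) (hlow.mono fun i hi => ?_)
    rw [norm_inv, norm_one, mul_one, Real.norm_eq_abs]
    rw [← inv_inv (2 * c), ← one_div (2 * c)]
    exact inv_anti₀ (by positivity) hi
  have hT : HasExpansion l ε (fun i => ∑ k ∈ range (m + 1), coeff k (t i) * ε i ^ k)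
      fun i => ∑ k ∈ range (m + 1), C (coeff k (t i)) * X ^ k :=
    sum _ fun k _ => const_mul hε (ht k) ((eps hε1).pow hε k)
  have h1 := hinv.mul ((h.mul hε hT).isBigO (m + 1))
  refine (h1.neg_left).congr' ?_ (Eventually.of_forall fun i => one_mul _)
  filter_upwards [hne, hst] with i hi hi'
  have e : ∑ k ∈ range (m + 1), coeff k (s i * ∑ j ∈ range (m + 1), C (coeff j (t i)) * X ^ j) *
      ε i ^ k = 1 := by
    rw [sum_congr rfl fun k hk => by
      rw [coeff_mul_congr (t' := t i) (fun j hj => coeff_sum_C_mul_X_pow _ hj) (mem_range.1 hk),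
        hi'], sum_eq_single 0 (fun k _ hk => by rw [coeff_one, if_neg hk, zero_mul])
      (fun h => absurd h (by simp))]
    simp
  rw [e]
  field_simp
  ring

theorem coeff_exp_subst {s : ℝ⟦X⟧} (hs : coeff 0 s = 0) {k m : ℕ} (hk : k < m) :
    coeff k ((PowerSeries.exp ℝ).subst s) = ∑ j ∈ range m, coeff k (s ^ j) / j.factorial := by
  have hsub : HasSubst s := HasSubst.of_constantCoeff_zero' (by
    rw [← coeff_zero_eq_constantCoeff_apply, hs])
  rw [coeff_subst' hsub, finsum_eq_sum_of_support_subset (s := range m)]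
  · refine sum_congr rfl fun j _ => ?_
    rw [coeff_exp, smul_eq_mul]
    simp [div_eq_inv_mul]
  · intro j hj
    by_contra hjm
    refine hj ?_
    beta_reduce
    have h1 : (X : ℝ⟦X⟧) ^ j ∣ s ^ j := pow_dvd_pow_of_dvd (X_dvd_iff.2 (by
      rw [← coeff_zero_eq_constantCoeff_apply, hs])) j
    rw [X_pow_dvd_iff.1 h1 k (by simp at hjm; omega), smul_zero]

theorem exp (hε0 : Tendsto ε l (nhds 0)) (hε : ∀ᶠ i in l, ε i ≠ 0) (h : HasExpansion l ε u s)
    (hs : ∀ i, coeff 0 (s i) = 0) :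
    HasExpansion l ε (fun i => Real.exp (u i)) fun i => (PowerSeries.exp ℝ).subst (s i) := by
  have hu : u =O[l] ε := by
    have := h.isBigO 1
    simpa [hs] using this
  have hp : ∀ m, HasExpansion l ε (fun i => ∑ j ∈ range m, (1 / (j.factorial : ℝ)) * u i ^ j)
      fun i => ∑ j ∈ range m, C (1 / (j.factorial : ℝ)) * s i ^ j := fun m =>
    sum _ fun j _ => const_mul hε (isBigO_const_const _ one_ne_zero _) (h.pow hε j)
  have hcoeff : ∀ i k m, k < m → coeff k ((PowerSeries.exp ℝ).subst (s i)) =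
      coeff k (∑ j ∈ range m, C (1 / (j.factorial : ℝ)) * s i ^ j) := fun i k m hkm => by
    rw [coeff_exp_subst (hs i) hkm, map_sum]
    refine sum_congr rfl fun j _ => ?_
    rw [coeff_C_mul]
    ring
  refine ⟨fun k => ?_, fun m => ?_⟩
  · simp only [fun i => hcoeff i k (k + 1) k.lt_succ_self]
    exact (hp (k + 1)).isBigO_coeff k
  -- As u = O(ε), the exponential may be replaced by its Taylor polynomial, whose expansion is
  -- known; coefficients below order m do not see the discarded powers.
  · have h1 := ((Real.exp_sub_sum_range_isBigO_pow m).comp_tendsto (hu.trans_tendsto hε0)).trans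
      (hu.pow m)
    refine (h1.add ((hp m).isBigO m)).congr_left fun i => ?_
    have e : ∑ k ∈ range m, coeff k ((PowerSeries.exp ℝ).subst (s i)) * ε i ^ k =
        ∑ k ∈ range m, coeff k (∑ j ∈ range m, C (1 / (j.factorial : ℝ)) * s i ^ j) * ε i ^ k :=
      sum_congr rfl fun k hk => by rw [hcoeff i k m (mem_range.1 hk)]
    rw [e]
    simp only [Function.comp_apply, div_eq_inv_mul, mul_one]
    ring

end HasExpansion

end AiryFormal

namespace AiryFormal

open PowerSeries

/-! ### Scaling -/

/-- The filter for `N → ∞`, uniformly for points in `[δ, R]`. -/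
def unifTop (δ R : ℝ) : Filter (ℝ × ℝ) := atTop ×ˢ 𝓟 (Set.Icc δ R)

/-- The small parameter `1 / N`. -/
def small (p : ℝ × ℝ) : ℝ := p.1⁻¹

variable {δ R : ℝ}

theorem eventually_unifTop {P : ℝ × ℝ → Prop} :
    (∀ᶠ p in unifTop δ R, P p) ↔ ∀ᶠ N in atTop, ∀ x, δ ≤ x → x ≤ R → P (N, x) := by
  rw [unifTop, eventually_prod_principal_iff]
  simp only [Set.mem_Icc, and_imp]

theorem eventually_unifTop_of_forall {P : ℝ × ℝ → Prop}
    (h : ∀ N x, 1 ≤ N → δ ≤ x → x ≤ R → P (N, x)) : ∀ᶠ p in unifTop δ R, P p :=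
  eventually_unifTop.2 ((eventually_ge_atTop 1).mono fun N hN x hx hx' => h N x hN hx hx')

theorem tendsto_fst_unifTop : Tendsto Prod.fst (unifTop δ R) atTop := tendsto_fst

theorem tendsto_small : Tendsto small (unifTop δ R) (nhds 0) :=
  tendsto_inv_atTop_zero.comp tendsto_fst_unifTop

theorem small_ne_zero : ∀ᶠ p in unifTop δ R, small p ≠ 0 :=
  eventually_unifTop_of_forall fun N x hN _ _ => inv_ne_zero (by
    show N ≠ 0
    linarith)

theorem isBigO_continuousOn {g : ℝ → ℝ} (hg : ContinuousOn g (Set.Icc δ R)) :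
    (fun p : ℝ × ℝ => g p.2) =O[unifTop δ R] fun _ => (1 : ℝ) := by
  obtain ⟨C, hC⟩ := isCompact_Icc.exists_bound_of_continuousOn hg
  refine IsBigO.of_bound C (eventually_unifTop_of_forall fun N x _ hx hx' => ?_)
  rw [norm_one, mul_one]
  exact hC x ⟨hx, hx'⟩

theorem isBigO_rpow (hδ : 0 < δ) (r : ℝ) :
    (fun p : ℝ × ℝ => p.2 ^ r) =O[unifTop δ R] fun _ => (1 : ℝ) :=
  isBigO_continuousOn (g := fun x => x ^ r) fun x hx =>
    (Real.continuousAt_rpow_const x r (Or.inl (hδ.trans_le hx.1).ne')).continuousWithinAt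

theorem isBigO_coeff_hat (hδ : 0 < δ) (e : ℝ) (s : ℝ⟦X⟧) (k : ℕ) :
    (fun p : ℝ × ℝ => coeff k (hat e s p.2)) =O[unifTop δ R] fun _ => (1 : ℝ) := by
  refine (((isBigO_rpow hδ (e - 3 / 2 * k)).const_mul_left (coeff k s))).congr' ?_ EventuallyEq.rfl
  exact eventually_unifTop_of_forall fun N x _ hx _ => (coeff_hat e s (hδ.trans_le hx) k).symm

theorem tendsto_scaled (hδ : 0 < δ) :
    Tendsto (fun p : ℝ × ℝ => p.1 ^ (2 / 3 : ℝ) * p.2) (unifTop δ R) atTop := by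
  refine tendsto_atTop_mono' _ (f₁ := fun p : ℝ × ℝ => p.1 ^ (2 / 3 : ℝ) * δ) ?_ ?_
  · exact eventually_unifTop_of_forall fun N x hN hx _ =>
      mul_le_mul_of_nonneg_left hx (Real.rpow_nonneg (by linarith) _)
  · exact ((tendsto_rpow_atTop (by norm_num : (0 : ℝ) < 2 / 3)).comp
      tendsto_fst_unifTop).atTop_mul_const hδ

theorem polyRpow_trunc (e : ℝ) (s : ℝ⟦X⟧) (m : ℕ) {x : ℝ} (hx : 0 < x) :
    polyRpow e (trunc m s) x = ∑ k ∈ range m, coeff k s * x ^ (e - 3 / 2 * k) := by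
  rw [polyRpow, ← Polynomial.eval₂_id, eval₂_trunc_eq_sum_range, mul_sum]
  refine sum_congr rfl fun k _ => ?_
  rw [RingHom.id_apply, ← Real.rpow_mul_natCast hx.le, sub_eq_add_neg, Real.rpow_add hx,
    show (-3 / 2 * k : ℝ) = -(3 / 2 * k) by ring]
  ring

theorem scaling_rpow {N x : ℝ} (hN : 0 < N) (hx : 0 < x) (e : ℝ) (k : ℕ) :
    N ^ (-2 / 3 * e) * (N ^ (2 / 3 : ℝ) * x) ^ (e - 3 / 2 * k) =
      x ^ (e - 3 / 2 * k) * N⁻¹ ^ k := by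
  rw [Real.mul_rpow (by positivity) hx.le, ← Real.rpow_mul hN.le, ← mul_assoc, ← Real.rpow_add hN,
    mul_comm, inv_pow, ← Real.rpow_natCast N k, ← Real.rpow_neg hN.le]
  ring_nf

/-- The scaling of an asymptotic expansion in powers of `x ^ (-3/2)`. -/
theorem hasExpansion_scaled (hδ : 0 < δ) {g : ℝ → ℝ} {e : ℝ} {s : ℝ⟦X⟧}
    (h : ∀ m : ℕ, (fun x => g x - polyRpow e (trunc (m + 1) s) x) =O[atTop]
      fun x : ℝ => x ^ (e - 3 / 2 * (m + 1 : ℕ) : ℝ)) :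
    HasExpansion (unifTop δ R) small
      (fun p => p.1 ^ (-2 / 3 * e) * g (p.1 ^ (2 / 3 : ℝ) * p.2)) fun p => hat e s p.2 := by
  refine HasExpansion.of_succ (tendsto_small.isBigO_one ℝ) (isBigO_coeff_hat hδ e s) fun m => ?_
  have h1 := (isBigO_refl (fun p : ℝ × ℝ => p.1 ^ (-2 / 3 * e)) (unifTop δ R)).mul
    ((h m).comp_tendsto (tendsto_scaled hδ))
  have h2 := (isBigO_rpow (R := R) hδ (e - 3 / 2 * (m + 1 : ℕ))).mul
    (isBigO_refl (fun p => small p ^ (m + 1)) (unifTop δ R))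
  simp only [one_mul] at h2
  refine (h1.congr' ?_ ?_).trans h2
  · refine eventually_unifTop_of_forall fun N x hN hx _ => ?_
    have hN0 : 0 < N := by linarith
    have hx0 := hδ.trans_le hx
    simp only [Function.comp_apply]
    rw [polyRpow_trunc _ _ _ (by positivity), mul_sub, mul_sum]
    congr 1
    refine sum_congr rfl fun k _ => ?_
    rw [mul_left_comm, scaling_rpow hN0 hx0, coeff_hat _ _ hx0, small, mul_assoc]
  · refine eventually_unifTop_of_forall fun N x hN hx _ => ?_
    exact scaling_rpow (by linarith) (hδ.trans_le hx) e (m + 1)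

/-- The scaled logarithmic derivative of `airyAi`. -/
def aScaled (p : ℝ × ℝ) : ℝ :=
  p.1 ^ (-1 / 3 : ℝ) * (deriv airyAi (p.1 ^ (2 / 3 : ℝ) * p.2) / airyAi (p.1 ^ (2 / 3 : ℝ) * p.2))

/-- The scaled logarithmic derivative of `airyBi`. -/
def bScaled (p : ℝ × ℝ) : ℝ := p.1 ^ (-1 / 3 : ℝ) * logDerivBi (p.1 ^ (2 / 3 : ℝ) * p.2)

/-- The scaled product of the Airy functions. -/
def fScaled (p : ℝ × ℝ) : ℝ := p.1 ^ (1 / 3 : ℝ) * airyProd (p.1 ^ (2 / 3 : ℝ) * p.2)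

theorem hasExpansion_bScaled (hδ : 0 < δ) :
    HasExpansion (unifTop δ R) small bScaled fun p => bHat p.2 := by
  have h := hasExpansion_scaled (R := R) hδ (g := logDerivBi) (e := 1 / 2) (s := beta)
    isBigO_logDerivBi_succ
  rwa [show (-2 / 3 * (1 / 2) : ℝ) = -1 / 3 by norm_num] at h

theorem hasExpansion_fScaled (hδ : 0 < δ) :
    HasExpansion (unifTop δ R) small fScaled fun p => fHat p.2 := by
  have h := hasExpansion_scaled (R := R) hδ (g := airyProd) (e := -1 / 2) (s := phi)
    isBigO_airyProd_succ
  rwa [show (-2 / 3 * (-1 / 2) : ℝ) = 1 / 3 by norm_num] at h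

/-- Since 1/f = b - a, this yields the nonvanishing of Ai for large argument and, subtracted from b,
the expansion of Ai'/Ai. -/
theorem hasExpansion_inv_fScaled (hδ : 0 < δ) : (∀ᶠ p in unifTop δ R, fScaled p ≠ 0) ∧
    HasExpansion (unifTop δ R) small (fun p => (fScaled p)⁻¹) fun p => bHat p.2 - aHat p.2 := by
  refine (hasExpansion_fScaled hδ).inv tendsto_small small_ne_zero (fun k => ?_) ?_
  · simp only [map_sub]
    exact (isBigO_coeff_hat hδ _ _ k).sub (isBigO_coeff_hat hδ _ _ k)
  · exact eventually_unifTop_of_forall fun N x _ hx _ => fHat_mul (hδ.trans_le hx)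

theorem eventually_airyAi_ne_zero (hδ : 0 < δ) :
    ∀ᶠ p : ℝ × ℝ in unifTop δ R, airyAi (p.1 ^ (2 / 3 : ℝ) * p.2) ≠ 0 :=
  (hasExpansion_inv_fScaled hδ).1.mono fun p hp h => hp (by
    rw [fScaled, airyProd, h, zero_mul, mul_zero])

theorem bScaled_sub_aScaled {N x : ℝ} (hN : 0 < N) (hx : 0 < x)
    (h : airyAi (N ^ (2 / 3 : ℝ) * x) ≠ 0) :
    bScaled (N, x) - aScaled (N, x) = (fScaled (N, x))⁻¹ := by
  have hb := (airyBi_pos (x := N ^ (2 / 3 : ℝ) * x) (by positivity)).ne'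
  have hw := airy_wronskian (N ^ (2 / 3 : ℝ) * x)
  have e : N ^ (-1 / 3 : ℝ) = (N ^ (1 / 3 : ℝ))⁻¹ := by
    rw [← Real.rpow_neg hN.le]; norm_num
  have hN3 : N ^ (1 / 3 : ℝ) ≠ 0 := (Real.rpow_pos_of_pos hN _).ne'
  simp only [bScaled, aScaled, fScaled, logDerivBi, airyProd, e]
  field_simp
  linarith

theorem hasExpansion_aScaled (hδ : 0 < δ) :
    HasExpansion (unifTop δ R) small aScaled fun p => aHat p.2 := by
  refine ((hasExpansion_bScaled hδ).sub small_ne_zero (hasExpansion_inv_fScaled hδ).2).congr' ?_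
    (Eventually.of_forall fun p => by ring)
  filter_upwards [eventually_airyAi_ne_zero hδ, eventually_unifTop_of_forall (R := R)
    (P := fun p => 0 < p.1 ∧ 0 < p.2) fun N x hN hx _ => ⟨zero_lt_one.trans_le hN, hδ.trans_le hx⟩]
    with p hp hp'
  have := bScaled_sub_aScaled hp'.1 hp'.2 hp
  linarith

/-- Restriction of an expansion to one point. -/
theorem HasExpansion.at_point {u : ℝ × ℝ → ℝ} {s : ℝ → ℝ⟦X⟧}
    (h : ∀ {δ R : ℝ}, 0 < δ → HasExpansion (unifTop δ R) small u fun p => s p.2) {x : ℝ}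
    (hx : 0 < x) : HasExpansion atTop (fun N => N⁻¹) (fun N => u (N, x)) fun _ => s x := by
  have ht : Tendsto (fun N : ℝ => (N, x)) atTop (unifTop x x) :=
    tendsto_id.prodMk (tendsto_principal.2 (Eventually.of_forall fun _ => ⟨le_rfl, le_rfl⟩))
  exact (h hx (R := x)).comp_tendsto ht

theorem inv_ne_zero_atTop : ∀ᶠ N : ℝ in atTop, N⁻¹ ≠ 0 :=
  (eventually_gt_atTop 0).mono fun _ hN => inv_ne_zero hN.ne'

/-- The kernel in terms of the logarithmic derivatives. -/
theorem airyKernel_scaled {N x y : ℝ} (hN : 0 < N) (hy : 0 < y)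
    (h : airyAi (N ^ (2 / 3 : ℝ) * x) ≠ 0) :
    N ^ (2 / 3 : ℝ) * airyKernel (N ^ (2 / 3 : ℝ) * x) (N ^ (2 / 3 : ℝ) * y) =
      (x - y)⁻¹ * (airyAi (N ^ (2 / 3 : ℝ) * x) * airyBi (N ^ (2 / 3 : ℝ) * y) *
        (N ^ (1 / 3 : ℝ) * (bScaled (N, y) - aScaled (N, x)))) := by
  have hb := (airyBi_pos (x := N ^ (2 / 3 : ℝ) * y) (by positivity)).ne'
  have e : N ^ (-1 / 3 : ℝ) = (N ^ (1 / 3 : ℝ))⁻¹ := by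
    rw [← Real.rpow_neg hN.le]; norm_num
  have hN3 : N ^ (1 / 3 : ℝ) ≠ 0 := (Real.rpow_pos_of_pos hN _).ne'
  have hN2 : N ^ (2 / 3 : ℝ) ≠ 0 := (Real.rpow_pos_of_pos hN _).ne'
  simp only [bScaled, aScaled, logDerivBi, e, airyKernel]
  rw [← mul_sub]
  rcases eq_or_ne x y with rfl | hxy
  · simp
  · have := sub_ne_zero.2 hxy
    field_simp

/-- The scaled correlation functions have the expansion `connHat`. -/
theorem hasExpansion_airyW {n : ℕ} {x : Fin (n + 1) → ℝ} (hx : ∀ i, 0 < x i) :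
    HasExpansion atTop (fun N => N⁻¹)
      (fun N => N ^ (2 * ((n + 1 : ℕ) : ℝ) / 3) * airyW (n + 1) (fun i => N ^ (2 / 3 : ℝ) * x i) *
        (if n = 0 then N⁻¹ else 1))
      fun _ => connHat (n + 1) x := by
  have hA : ∀ i, ∀ᶠ N : ℝ in atTop, airyAi (N ^ (2 / 3 : ℝ) * x i) ≠ 0 := fun i =>
    (eventually_unifTop.1 (eventually_airyAi_ne_zero (R := x i) (hx i))).mono fun N hN =>
      hN _ le_rfl le_rfl
  have ha : ∀ i, HasExpansion atTop (fun N => N⁻¹) (fun N => aScaled (N, x i))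
    fun _ => aHat (x i) := fun i => HasExpansion.at_point hasExpansion_aScaled (hx i)
  have hb : ∀ i, HasExpansion atTop (fun N => N⁻¹) (fun N => bScaled (N, x i))
    fun _ => bHat (x i) := fun i => HasExpansion.at_point hasExpansion_bScaled (hx i)
  have hf : ∀ i, HasExpansion atTop (fun N => N⁻¹) (fun N => fScaled (N, x i))
    fun _ => fHat (x i) := fun i => HasExpansion.at_point hasExpansion_fScaled (hx i)
  have hne := inv_ne_zero_atTop
  cases n with
  | zero =>
    refine ((hf 0).mul hne (((ha 0).mul hne (hb 0)).sub hne
      (HasExpansion.const (c := fun _ => x 0) (isBigO_const_const _ one_ne_zero _)))).congr' ?_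
      (Eventually.of_forall fun _ => rfl)
    filter_upwards [hA 0, eventually_gt_atTop 0] with N hN hN0
    have hB := (airyBi_pos (x := N ^ (2 / 3 : ℝ) * x 0) (by have := hx 0; positivity)).ne'
    have e : N ^ (-1 / 3 : ℝ) = (N ^ (1 / 3 : ℝ))⁻¹ := by
      rw [← Real.rpow_neg hN0.le]; norm_num
    have e2 : N ^ (2 / 3 : ℝ) = (N ^ (1 / 3 : ℝ)) ^ 2 := by
      rw [← Real.rpow_mul_natCast hN0.le]; norm_num
    have e3 : N⁻¹ = ((N ^ (1 / 3 : ℝ)) ^ 3)⁻¹ := by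
      rw [← Real.rpow_mul_natCast hN0.le]; norm_num
    have hN3 : N ^ (1 / 3 : ℝ) ≠ 0 := (Real.rpow_pos_of_pos hN0 _).ne'
    rw [if_pos rfl, e3, show 2 * ((0 + 1 : ℕ) : ℝ) / 3 = 2 / 3 by norm_num]
    simp only [bScaled, aScaled, fScaled, logDerivBi, airyProd, airyW, e]
    generalize deriv airyAi (N ^ (2 / 3 : ℝ) * x 0) = A' at *
    generalize deriv airyBi (N ^ (2 / 3 : ℝ) * x 0) = B' at *
    generalize airyAi (N ^ (2 / 3 : ℝ) * x 0) = A at *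
    generalize airyBi (N ^ (2 / 3 : ℝ) * x 0) = B at *
    rw [e2]
    field_simp
  | succ m =>
    have hk : ∀ i j, HasExpansion atTop (fun N => N⁻¹)
        (fun N => (x i - x j)⁻¹ * (fScaled (N, x j) * (bScaled (N, x j) - aScaled (N, x i))))
        fun _ => kHat (x i) (x j) := fun i j => by
      simpa only [kHat, smul_eq_C_mul] using
        ((hf j).mul hne ((hb j).sub hne (ha i))).const_mul hne (c := fun _ => (x i - x j)⁻¹)
          (isBigO_const_const _ one_ne_zero _)
    have hcyc : HasExpansion atTop (fun N => N⁻¹)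
        (fun N => cycleSum fun i j => (x i - x j)⁻¹ *
          (fScaled (N, x j) * (bScaled (N, x j) - aScaled (N, x i))))
        fun _ => cycleSum fun i j => kHat (x i) (x j) :=
      HasExpansion.sum _ fun σ _ => HasExpansion.prod hne _ fun i _ => hk i (σ i)
    refine ((HasExpansion.const (c := fun _ => -(if m = 0 then 1 / (x 0 - x 1) ^ 2 else 0))
      (isBigO_const_const _ one_ne_zero _)).sub hne (hcyc.const_mul hne
        (c := fun _ => (-1) ^ (m + 2)) (isBigO_const_const _ one_ne_zero _))).congr' ?_
      (Eventually.of_forall fun _ => by simp [connHat])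
    filter_upwards [eventually_all.2 hA, eventually_gt_atTop 0] with N hN hN0
    have hB : ∀ j, airyBi (N ^ (2 / 3 : ℝ) * x j) ≠ 0 := fun j =>
      (airyBi_pos (x := N ^ (2 / 3 : ℝ) * x j) (by have := hx j; positivity)).ne'
    have hN2 : N ^ (2 / 3 : ℝ) ≠ 0 := (Real.rpow_pos_of_pos hN0 _).ne'
    have e1 : N ^ (2 * ((m + 1 + 1 : ℕ) : ℝ) / 3) = (N ^ (2 / 3 : ℝ)) ^ (m + 2) := by
      rw [← Real.rpow_mul_natCast hN0.le]; push_cast; ring_nf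
    have e2 : (cycleSum fun i j => (x i - x j)⁻¹ *
          (fScaled (N, x j) * (bScaled (N, x j) - aScaled (N, x i)))) =
        (N ^ (2 / 3 : ℝ)) ^ (m + 2) * cycleSum fun i j =>
          airyKernel (N ^ (2 / 3 : ℝ) * x i) (N ^ (2 / 3 : ℝ) * x j) := by
      have e3 : (N ^ (2 / 3 : ℝ)) ^ (m + 2) * (cycleSum fun i j =>
          airyKernel (N ^ (2 / 3 : ℝ) * x i) (N ^ (2 / 3 : ℝ) * x j)) = cycleSum fun i j =>
          N ^ (2 / 3 : ℝ) * airyKernel (N ^ (2 / 3 : ℝ) * x i) (N ^ (2 / 3 : ℝ) * x j) := by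
        rw [cycleSum, cycleSum, mul_sum]
        refine sum_congr rfl fun σ _ => ?_
        rw [prod_mul_distrib, prod_const, card_univ, Fintype.card_fin]
      rw [e3]
      -- The kernel carries Ai(x_i) Bi(x_(σ i)) where the formal one carries the product at x_(σ i)
      -- alone; over a permutation the products coincide.
      refine cycleSum_congr_of_prod fun σ _ => ?_
      simp only [airyKernel_scaled hN0 (hx _) (hN _), prod_mul_distrib, fScaled, airyProd]
      rw [Equiv.prod_comp σ fun j => airyAi (N ^ (2 / 3 : ℝ) * x j)]
      ring
    rw [if_neg (Nat.succ_ne_zero m), mul_one, e1, airyW, e2, cycleSum]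
    by_cases hm : m = 0
    · subst hm
      rw [if_pos rfl, if_pos rfl, ← mul_sub]
      field_simp
    · rw [if_neg hm, if_neg hm]
      ring

end AiryFormal

namespace AiryFormal

open PowerSeries

/-! ### The topological expansion -/

theorem sum_range_add_two_mul {z : ℝ} {a : ℕ} {f : ℕ → ℝ} (h1 : ∀ k < a, f k = 0)
    (h2 : ∀ j, Odd j → f (a + j) = 0) (G : ℕ) :
    ∑ k ∈ range (a + 2 * G), f k * z ^ k = ∑ g ∈ range G, f (a + 2 * g) * z ^ (a + 2 * g) := by
  induction G with
  | zero =>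
    rw [mul_zero, add_zero, sum_range_zero]
    exact sum_eq_zero fun k hk => by rw [h1 k (mem_range.1 hk), zero_mul]
  | succ G ih =>
    rw [show a + 2 * (G + 1) = a + 2 * G + 1 + 1 by ring, sum_range_succ, sum_range_succ, ih,
      sum_range_succ, add_assoc a, h2 _ ⟨G, rfl⟩]
    ring

/-- The series starts at order n - 2 by divisibility and skips every second order by parity, so its
terms are those of N^(2-2g-n). -/
theorem isTopologicalExpansion_corr : IsTopologicalExpansion fun g => corr (2 * g) := by
  intro n hn
  refine ⟨fun g => continuousOn_corr _ _, fun x hx hi G => ?_⟩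
  obtain ⟨m, rfl⟩ := Nat.exists_eq_add_of_le' hn
  -- For one point the expansion was normalised by 1/N, which is undone here.
  set d : ℕ := if m = 0 then 1 else 0 with hd
  have h := (hasExpansion_airyW hx).isBigO (m + 1 - 2 + 2 * G)
  have h1 := (isBigO_refl (fun N : ℝ => N ^ d) atTop).mul h
  have hz : ∀ N : ℝ, 0 < N → ∀ k : ℕ, N ^ d * N⁻¹ ^ (m + 1 - 2 + 2 * k) =
      N ^ (2 - 2 * (k : ℤ) - ((m + 1 : ℕ) : ℤ)) := fun N hN k => by
    rw [inv_pow, ← zpow_natCast N d, ← zpow_natCast N (_ + _), ← zpow_neg, ← zpow_add₀ hN.ne']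
    congr 1
    rw [hd]
    split_ifs with hm
    · subst hm; push_cast; ring
    · obtain ⟨m, rfl⟩ := Nat.exists_eq_succ_of_ne_zero hm
      rw [show m + 1 + 1 - 2 = m by omega]
      push_cast
      ring
  refine h1.congr' ?_ ?_
  · filter_upwards [eventually_gt_atTop 0] with N hN
    rw [sum_range_add_two_mul (a := m + 1 - 2)
      (fun k hk => coeff_connHat_of_lt hx hi hk)
      (fun j hj => coeff_connHat_of_odd hx hj), mul_sub, mul_sum]
    congr 1
    · rw [hd]
      split_ifs with hm
      · field_simp
      · ring
    · refine sum_congr rfl fun g _ => ?_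
      rw [corr_eq hx hi, ← hz N hN g]
      ring
  · filter_upwards [eventually_gt_atTop 0] with N hN
    exact hz N hN G

theorem eq_zero_of_isBigO_zpow {c : ℝ} {e e' : ℤ} (he : e' < e)
    (h : (fun N : ℝ => N ^ e * c) =O[atTop] fun N : ℝ => N ^ e') : c = 0 := by
  have h1 := (isBigO_refl (fun N : ℝ => N ^ (-e)) atTop).mul h
  have h2 : (fun _ : ℝ => c) =O[atTop] fun N : ℝ => N ^ (-(e - e')) := by
    refine h1.congr' ?_ ?_
    · filter_upwards [eventually_gt_atTop 0] with N hN
      rw [← mul_assoc, ← zpow_add₀ hN.ne', neg_add_cancel, zpow_zero, one_mul]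
    · filter_upwards [eventually_gt_atTop 0] with N hN
      rw [← zpow_add₀ hN.ne']
      ring_nf
  exact tendsto_nhds_unique tendsto_const_nhds
    (h2.trans_tendsto (tendsto_zpow_atTop_zero (by omega)))

/-- The coefficients of the topological expansion are unique. -/
theorem topologicalExpansion_unique {ω ω' : ℕ → (n : ℕ) → (Fin n → ℝ) → ℝ}
    (h : IsTopologicalExpansion ω) (h' : IsTopologicalExpansion ω') {n : ℕ} (hn : 1 ≤ n) (g : ℕ)
    {x : Fin n → ℝ} (hx : ∀ i, 0 < x i) : ω g n x = ω' g n x := by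
  refine eqOn_orthant ((h n hn).1 g) ((h' n hn).1 g) (fun x hx hi => ?_) hx
  induction g using Nat.strong_induction_on with
  | _ g ih =>
    have h1 := (h n hn).2 x hx hi (g + 1)
    have h2 := (h' n hn).2 x hx hi (g + 1)
    rw [← sub_eq_zero]
    refine eq_zero_of_isBigO_zpow (e := 2 - 2 * (g : ℤ) - n)
      (e' := 2 - 2 * ((g + 1 : ℕ) : ℤ) - n) (by push_cast; omega) ?_
    refine (h2.sub h1).congr_left fun N => ?_
    have e : ∑ k ∈ range g, N ^ (2 - 2 * (k : ℤ) - n) * ω k n x =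
        ∑ k ∈ range g, N ^ (2 - 2 * (k : ℤ) - n) * ω' k n x :=
      sum_congr rfl fun k hk => by rw [ih k (mem_range.1 hk)]
    rw [sum_range_succ, sum_range_succ, e]
    ring

theorem iteratedIntegral_congr {y x : ℝ} {n : ℕ} {F F' : (Fin n → ℝ) → ℝ}
    (h : ∀ v, (∀ i, v i ∈ Set.uIcc y x) → F v = F' v) :
    iteratedIntegral y x n F = iteratedIntegral y x n F' := by
  induction n with
  | zero => exact h _ fun i => i.elim0
  | succ n ih =>
    refine intervalIntegral.integral_congr fun t ht => ih fun v hv => h _ fun i => ?_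
    refine Fin.cases ?_ (fun i => ?_) i
    · exact ht
    · exact hv i

theorem iteratedIntegral_zero (y x : ℝ) (n : ℕ) : iteratedIntegral y x n (fun _ => 0) = 0 := by
  induction n with
  | zero => rfl
  | succ n ih => simp [iteratedIntegral, ih]

/-- By uniqueness ω may be replaced by `corr`, even on the diagonals met by the integrals. The terms
with j - l odd, absent on the left, vanish by parity. -/
theorem exponentCoeff_eq_expSum {ω : ℕ → (n : ℕ) → (Fin n → ℝ) → ℝ}
    (h : IsTopologicalExpansion ω) {δ x y : ℝ} (hδ : 0 < δ) (hx : δ ≤ x) (hy : δ ≤ y) (j : ℕ) :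
    exponentCoeff ω x y j = expSum δ j x y := by
  have hbox : ∀ {n : ℕ} {v : Fin n → ℝ}, (∀ i, v i ∈ Set.uIcc y x) → ∀ i, δ ≤ v i :=
    fun hv i => (le_min hy hx).trans (hv i).1
  rw [exponentCoeff, sum_filter, sum_product_right, sum_range_succ', expSum,
    sum_eq_zero (s := range (j + 2)) (f := fun a => if 1 ≤ ((a, 0) : ℕ × ℕ).2 ∧ _ then _ else _)
      fun a _ => if_neg fun h => absurd h.1 (by simp), add_zero]
  refine sum_congr rfl fun l hl => ?_
  have hl := mem_range.1 hl
  rcases Nat.even_or_odd (j - l) with ⟨g, hg⟩ | hodd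
  · rw [sum_eq_single g, if_pos ⟨by simp, by simp; omega⟩]
    · rw [listIntegral]
      congr 1
      refine iteratedIntegral_congr fun v hv => ?_
      rw [corrList_ofFn, hg, ← two_mul, ← topologicalExpansion_unique isTopologicalExpansion_corr h (by omega) g
        fun i => hδ.trans_le (hbox hv i)]
      congr 1
      funext i
      exact (max_eq_right (hbox hv i)).symm
    · intro a _ ha
      rw [if_neg]
      rintro ⟨_, h2⟩
      simp only at h2
      omega
    · intro hg'
      simp only [mem_range] at hg'
      omega
  · rw [sum_eq_zero, listIntegral, iteratedIntegral_congr (F' := fun _ => 0),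
      iteratedIntegral_zero, mul_zero]
    · intro v hv
      rw [corrList_ofFn, corr_of_odd hodd fun i => hδ.trans_le (le_max_left _ _)]
    · intro a _
      rw [if_neg]
      rintro ⟨_, h2⟩
      obtain ⟨c, hc⟩ := hodd
      simp only at h2
      omega

end AiryFormal

namespace AiryFormal

open PowerSeries

/-! ### The exponential formula -/

theorem isBigO_coeff_inv {ι : Type*} {l : Filter ι} {s : ι → ℝ⟦X⟧}
    (h : ∀ k, (fun i => coeff k (s i)) =O[l] fun _ => (1 : ℝ))
    (h0 : (fun i => (coeff 0 (s i))⁻¹) =O[l] fun _ => (1 : ℝ)) (k : ℕ) :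
    (fun i => coeff k (s i)⁻¹) =O[l] fun _ => (1 : ℝ) := by
  induction k using Nat.strong_induction_on with
  | _ k ih =>
    simp only [coeff_zero_eq_constantCoeff_apply] at h0
    refine IsBigO.congr_left ?_ fun i => (coeff_inv k (s i)).symm
    split_ifs with hk
    · exact h0
    · have h1 : (fun i => ∑ p ∈ antidiagonal k, if p.2 < k then
          coeff p.1 (s i) * coeff p.2 (s i)⁻¹ else 0) =O[l] fun _ => (1 : ℝ) := by
        refine IsBigO.fun_sum fun p _ => ?_
        split_ifs with hp
        · simpa using (h p.1).mul (ih p.2 hp)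
        · exact isBigO_zero _ _
      simpa using h0.neg_left.mul h1

theorem coeff_zero_bHat_sub_aHat {x y : ℝ} (hx : 0 < x) (hy : 0 < y) :
    coeff 0 (bHat y - aHat x) = y ^ (1 / 2 : ℝ) + x ^ (1 / 2 : ℝ) := by
  rw [map_sub, bHat, aHat, coeff_hat _ _ hx, coeff_hat _ _ hy, coeff_zero_alpha, coeff_zero_beta]
  norm_num

variable {δ R : ℝ}

/-- The scaled logarithmic derivative of the kernel. -/
def logDerivScaled (y : ℝ) (p : ℝ × ℝ) : ℝ :=
  (aScaled p * bScaled (p.1, y) - p.2) * (bScaled (p.1, y) - aScaled p)⁻¹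

/-- The denominator has leading coefficient √x + √y, bounded away from 0, so the expansion is
uniform in x; `logDerivHat_mul` identifies the series. -/
theorem hasExpansion_logDerivScaled (hδ : 0 < δ) {y : ℝ} (hy : δ ≤ y) (hy' : y ≤ R) :
    (∀ᶠ p in unifTop δ R, bScaled (p.1, y) - aScaled p ≠ 0) ∧
    HasExpansion (unifTop δ R) small (logDerivScaled y) fun p => logDerivHat p.2 y := by
  have hy0 := hδ.trans_le hy
  have hty : Tendsto (fun p : ℝ × ℝ => (p.1, y)) (unifTop δ R) (unifTop δ R) :=
    tendsto_fst_unifTop.prodMk (tendsto_principal.2 (Eventually.of_forall fun _ => ⟨hy, hy'⟩))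
  have ha : HasExpansion (unifTop δ R) small aScaled fun p => aHat p.2 := hasExpansion_aScaled hδ
  have hb : HasExpansion (unifTop δ R) small (fun p => bScaled (p.1, y)) fun _ => bHat y :=
    (hasExpansion_bScaled (R := R) hδ).comp_tendsto hty
  have hba := hb.sub small_ne_zero ha
  have hpos : ∀ x, 0 < x → 0 < coeff 0 (bHat y - aHat x) := fun x hx => by
    rw [coeff_zero_bHat_sub_aHat hx hy0]
    positivity
  have h0 : (fun p : ℝ × ℝ => (coeff 0 (bHat y - aHat p.2))⁻¹) =O[unifTop δ R]
      fun _ => (1 : ℝ) := by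
    refine IsBigO.of_bound (y ^ (1 / 2 : ℝ))⁻¹ (eventually_unifTop_of_forall fun N x _ hx _ => ?_)
    have hx0 := hδ.trans_le hx
    rw [norm_one, mul_one, norm_inv, Real.norm_eq_abs, abs_of_pos (hpos x hx0)]
    refine inv_anti₀ (by positivity) ?_
    rw [coeff_zero_bHat_sub_aHat hx0 hy0]
    exact le_add_of_nonneg_right (by positivity)
  have hinv := hba.inv tendsto_small small_ne_zero (isBigO_coeff_inv hba.isBigO_coeff h0)
    (eventually_unifTop_of_forall fun N x _ hx _ => PowerSeries.mul_inv_cancel _ (by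
      rw [← coeff_zero_eq_constantCoeff_apply]
      exact (hpos x (hδ.trans_le hx)).ne'))
  refine ⟨hinv.1, (((ha.mul small_ne_zero hb).sub small_ne_zero
    (HasExpansion.const (isBigO_continuousOn continuousOn_id))).mul small_ne_zero hinv.2).congr'
    EventuallyEq.rfl (eventually_unifTop_of_forall fun N x _ hx _ => ?_)⟩
  have hx0 := hδ.trans_le hx
  have h1 := logDerivHat_mul hx0 hy0
  have h2 : (bHat y - aHat x) * (bHat y - aHat x)⁻¹ = 1 := PowerSeries.mul_inv_cancel _ (by
      rw [← coeff_zero_eq_constantCoeff_apply]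
      exact (hpos x hx0).ne')
  have h3 : aHat x * bHat y - C x = logDerivHat x y * (bHat y - aHat x) := by
    linear_combination h1
  simp only [id]
  rw [h3, mul_assoc, h2, mul_one]

/-- The numerator of the scaled kernel. -/
def kernelNum (N y x : ℝ) : ℝ :=
  airyAi (N ^ (2 / 3 : ℝ) * x) * deriv airyBi (N ^ (2 / 3 : ℝ) * y) -
    deriv airyAi (N ^ (2 / 3 : ℝ) * x) * airyBi (N ^ (2 / 3 : ℝ) * y)

theorem kernelNum_self (N y : ℝ) : kernelNum N y y = 1 := airy_wronskian _

theorem kernelNum_eq {N x y : ℝ} (hN : 0 < N) (hy : 0 < y)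
    (h : airyAi (N ^ (2 / 3 : ℝ) * x) ≠ 0) :
    kernelNum N y x = airyAi (N ^ (2 / 3 : ℝ) * x) * airyBi (N ^ (2 / 3 : ℝ) * y) *
        (N ^ (1 / 3 : ℝ) * (bScaled (N, y) - aScaled (N, x))) := by
  have hb := (airyBi_pos (x := N ^ (2 / 3 : ℝ) * y) (by positivity)).ne'
  have e : N ^ (-1 / 3 : ℝ) = (N ^ (1 / 3 : ℝ))⁻¹ := by
    rw [← Real.rpow_neg hN.le]; norm_num
  have hN3 : N ^ (1 / 3 : ℝ) ≠ 0 := (Real.rpow_pos_of_pos hN _).ne'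
  simp only [bScaled, aScaled, logDerivBi, e, kernelNum]
  field_simp

theorem hasDerivAt_log_kernelNum {N x y : ℝ} (hN : 0 < N) (hy : 0 < y)
    (h : airyAi (N ^ (2 / 3 : ℝ) * x) ≠ 0) (h' : bScaled (N, y) - aScaled (N, x) ≠ 0) :
    kernelNum N y x ≠ 0 ∧
      HasDerivAt (fun x => Real.log (kernelNum N y x)) (N * logDerivScaled y (N, x)) x := by
  have hb := (airyBi_pos (x := N ^ (2 / 3 : ℝ) * y) (by positivity)).ne'
  have hN3 : N ^ (1 / 3 : ℝ) ≠ 0 := (Real.rpow_pos_of_pos hN _).ne'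
  have hk := kernelNum_eq (x := x) hN hy h
  have hne : kernelNum N y x ≠ 0 := by
    rw [hk]
    exact mul_ne_zero (mul_ne_zero h hb) (mul_ne_zero hN3 h')
  refine ⟨hne, ?_⟩
  have hlin : HasDerivAt (fun x : ℝ => N ^ (2 / 3 : ℝ) * x) (N ^ (2 / 3 : ℝ)) x := by
    simpa using (hasDerivAt_id x).const_mul (N ^ (2 / 3 : ℝ))
  have hd : HasDerivAt (kernelNum N y) _ x :=
    (((hasDerivAt_airyAi _).comp x hlin).mul_const _).sub
      (((hasDerivAt_deriv_airyAi _).comp x hlin).mul_const _)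
  refine (hd.log hne).congr_deriv ?_
  rw [div_eq_iff hne, hk, logDerivScaled]
  have e2 : N ^ (2 / 3 : ℝ) = (N ^ (1 / 3 : ℝ)) ^ 2 := by
    rw [← Real.rpow_mul_natCast hN.le]; norm_num
  have e3 : N = (N ^ (1 / 3 : ℝ)) ^ 3 := by
    rw [← Real.rpow_mul_natCast hN.le]; norm_num
  have e : N ^ (-1 / 3 : ℝ) = (N ^ (1 / 3 : ℝ))⁻¹ := by
    rw [← Real.rpow_neg hN.le]; norm_num
  have e4 : deriv airyAi (N ^ (2 / 3 : ℝ) * x) =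
      N ^ (1 / 3 : ℝ) * aScaled (N, x) * airyAi (N ^ (2 / 3 : ℝ) * x) := by
    simp only [aScaled, e]
    field_simp
  have e5 : deriv airyBi (N ^ (2 / 3 : ℝ) * y) =
      N ^ (1 / 3 : ℝ) * bScaled (N, y) * airyBi (N ^ (2 / 3 : ℝ) * y) := by
    simp only [bScaled, e, logDerivBi]
    field_simp
  rw [e4, e5]
  generalize bScaled (N, y) = b at *
  generalize aScaled (N, x) = a at *
  generalize airyAi (N ^ (2 / 3 : ℝ) * x) = A at *
  generalize airyBi (N ^ (2 / 3 : ℝ) * y) = B at *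
  have hinv : (b - a)⁻¹ * (b - a) = 1 := inv_mul_cancel₀ h'
  rw [e2]
  linear_combination (-(a * b - x) * A * B * N ^ (1 / 3 : ℝ)) * e3 -
    N * (a * b - x) * A * B * N ^ (1 / 3 : ℝ) * hinv

theorem pos_of_ne_zero_of_uIcc {f : ℝ → ℝ} {x y : ℝ} (hf : ContinuousOn f (Set.uIcc y x))
    (hne : ∀ t ∈ Set.uIcc y x, f t ≠ 0) (hy : 0 < f y) : 0 < f x := by
  by_contra hx
  obtain ⟨t, ht, h0⟩ := intermediate_value_uIcc hf (Set.mem_uIcc.2 (Or.inr ⟨not_lt.1 hx, hy.le⟩))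
  exact hne t ht h0

/-- The numerator is 1 at x = y by the Wronskian and does not vanish on the segment for large N, so
it is positive. Integrating the uniform expansion of its logarithmic derivative from y to x gives
the estimate. -/
theorem isBigO_log_kernelNum {x y : ℝ} (hδ : 0 < δ) (hx : δ < x) (hy : δ < y) (m : ℕ) :
    (∀ᶠ N in atTop, 0 < kernelNum N y x) ∧
    (fun N => Real.log (kernelNum N y x) - N * ∑ k ∈ range m, expSum δ k x y * N⁻¹ ^ k)
      =O[atTop] fun N : ℝ => N * N⁻¹ ^ m := by
  set R := max x y with hR
  obtain ⟨δ', hδ', hδx⟩ := exists_between (lt_min hx hy)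
  have hδ'0 := hδ.trans hδ'
  have hy1 : δ' ≤ y := hδx.le.trans (min_le_right _ _)
  have hx1 : δ' ≤ x := hδx.le.trans (min_le_left _ _)
  have hy2 : y ≤ R := le_max_right _ _
  have hE := hasExpansion_logDerivScaled (R := R) hδ'0 hy1 hy2
  obtain ⟨C, hC⟩ := (hE.2.isBigO m).bound
  have hev := (eventually_unifTop.1 hC).and ((eventually_unifTop.1 hE.1).and
    ((eventually_unifTop.1 (eventually_airyAi_ne_zero (R := R) hδ'0)).and
      (eventually_gt_atTop 0)))
  have hbox : ∀ t ∈ Set.uIcc y x, δ' ≤ t ∧ t ≤ R := fun t ht =>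
    ⟨(le_min hy1 hx1).trans ht.1, ht.2.trans (max_comm y x).le⟩
  have hder : ∀ {N : ℝ}, 0 < N → (∀ x, δ' ≤ x → x ≤ R → bScaled (N, y) - aScaled (N, x) ≠ 0) →
      (∀ x, δ' ≤ x → x ≤ R → airyAi (N ^ (2 / 3 : ℝ) * x) ≠ 0) → ∀ t ∈ Set.uIcc y x,
      kernelNum N y t ≠ 0 ∧
      HasDerivAt (fun x => Real.log (kernelNum N y x)) (N * logDerivScaled y (N, t)) t :=
    fun hN h1 h2 t ht => hasDerivAt_log_kernelNum hN (hδ.trans hy)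
      (h2 t (hbox t ht).1 (hbox t ht).2) (h1 t (hbox t ht).1 (hbox t ht).2)
  constructor
  · filter_upwards [hev] with N ⟨_, h2, h3, h4⟩
    refine pos_of_ne_zero_of_uIcc (f := kernelNum N y) (y := y) ?_
      (fun t ht => (hder h4 h2 h3 t ht).1) (by rw [kernelNum_self]; exact one_pos)
    have hlin : Continuous fun x : ℝ => N ^ (2 / 3 : ℝ) * x := by fun_prop
    have h5 : Continuous airyAi :=
      continuous_iff_continuousAt.2 fun x => (hasDerivAt_airyAi x).continuousAt
    have h6 : Continuous (deriv airyAi) :=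
      continuous_iff_continuousAt.2 fun x => (hasDerivAt_deriv_airyAi x).continuousAt
    exact (((h5.comp hlin).mul continuous_const).sub
      ((h6.comp hlin).mul continuous_const)).continuousOn
  · refine IsBigO.of_bound (C * |x - y|) ?_
    filter_upwards [hev] with N ⟨h1, h2, h3, h4⟩
    have hd : ∀ t ∈ Set.uIcc y x, HasDerivWithinAt
        (fun x => Real.log (kernelNum N y x) - N * ∑ k ∈ range m, expSum δ k x y * N⁻¹ ^ k)
        (N * logDerivScaled y (N, t) - N * ∑ k ∈ range m, coeff k (logDerivHat t y) * N⁻¹ ^ k)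
        (Set.uIcc y x) t := fun t ht => by
      refine ((hder h4 h2 h3 t ht).2.sub (HasDerivAt.const_mul N
        (HasDerivAt.fun_sum fun k _ => HasDerivAt.mul_const ?_ _))).hasDerivWithinAt
      exact hasDerivAt_expSum hδ k (hδ'.trans_le (hbox t ht).1) hy
    have hb : ∀ t ∈ Set.uIcc y x, ‖N * logDerivScaled y (N, t) -
        N * ∑ k ∈ range m, coeff k (logDerivHat t y) * N⁻¹ ^ k‖ ≤ C * ‖N * N⁻¹ ^ m‖ :=
      fun t ht => by
        have h5 := h1 t (hbox t ht).1 (hbox t ht).2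
        rw [← mul_sub, norm_mul, norm_mul N, mul_left_comm]
        exact mul_le_mul_of_nonneg_left h5 (norm_nonneg _)
    have h6 := (convex_uIcc y x).norm_image_sub_le_of_norm_hasDerivWithin_le hd hb
      Set.left_mem_uIcc Set.right_mem_uIcc
    simp only [kernelNum_self, Real.log_one, expSum_self, zero_mul, sum_const_zero, mul_zero,
      sub_zero] at h6
    rw [Real.norm_eq_abs (x - y)] at h6
    linarith

theorem hasExpansion_log_kernelNum {ω : ℕ → (n : ℕ) → (Fin n → ℝ) → ℝ}
    (h : IsTopologicalExpansion ω) {x y : ℝ} (hx : 0 < x) (hy : 0 < y) :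
    HasExpansion atTop (fun N => N⁻¹)
      (fun N => Real.log (kernelNum N y x) -
        (N * exponentCoeff ω x y 0 + exponentCoeff ω x y 1)) fun _ => exponentTail ω x y := by
  obtain ⟨δ, hδ, hδ'⟩ := exists_between (lt_min hx hy)
  have hδx := hδ'.trans_le (min_le_left _ _)
  have hδy := hδ'.trans_le (min_le_right _ _)
  refine HasExpansion.of_succ (tendsto_inv_atTop_zero.isBigO_one ℝ)
    (fun k => isBigO_const_const _ one_ne_zero _) fun m => ?_
  -- Two extra orders are needed: with the prefactor N, the first two terms are of order N and 1 and
  -- form the explicit exponent, and m + 2 terms leave an error N^(-(m+1)).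
  refine (isBigO_log_kernelNum hδ hδx hδy (m + 2)).2.congr' ?_ ?_
  · filter_upwards [eventually_gt_atTop 0] with N hN
    have e : ∀ k, coeff (k + 1) (exponentTail ω x y) = expSum δ (k + 1 + 1) x y := fun k => by
      rw [exponentTail, coeff_mk, if_neg (Nat.succ_ne_zero k),
        exponentCoeff_eq_expSum h hδ hδx.le hδy.le]
    have e0 : coeff 0 (exponentTail ω x y) = 0 := by rw [exponentTail, coeff_mk, if_pos rfl]
    rw [sum_range_succ', sum_range_succ', sum_range_succ' (n := m), e0]
    simp only [e, exponentCoeff_eq_expSum h hδ hδx.le hδy.le]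
    rw [mul_add, mul_add, mul_sum]
    have e1 : ∑ k ∈ range m, N * (expSum δ (k + 1 + 1) x y * N⁻¹ ^ (k + 1 + 1)) =
        ∑ k ∈ range m, expSum δ (k + 1 + 1) x y * N⁻¹ ^ (k + 1) :=
      sum_congr rfl fun k _ => by
        rw [pow_succ _ (k + 1)]
        field_simp
    rw [e1]
    generalize ∑ k ∈ range m, expSum δ (k + 1 + 1) x y * N⁻¹ ^ (k + 1) = S
    have hNN : N * N⁻¹ = 1 := mul_inv_cancel₀ hN.ne'
    linear_combination -expSum δ 1 x y * hNN
  · filter_upwards [eventually_gt_atTop 0] with N hN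
    rw [pow_succ _ (m + 1)]
    field_simp

theorem hasAsymptoticSeries_airyKernel {ω : ℕ → (n : ℕ) → (Fin n → ℝ) → ℝ}
    (h : IsTopologicalExpansion ω) {x y : ℝ} (hx : 0 < x) (hy : 0 < y) (hxy : x ≠ y) :
    HasAsymptoticSeries
      (fun N : ℝ =>
        N ^ (2 / 3 : ℝ) * airyKernel (N ^ (2 / 3 : ℝ) * x) (N ^ (2 / 3 : ℝ) * y) /
          (1 / (x - y) * Real.exp (N * exponentCoeff ω x y 0 + exponentCoeff ω x y 1)))
      (fun k => PowerSeries.coeff k (expTail ω x y)) := by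
  intro m
  obtain ⟨δ, hδ, hδ'⟩ := exists_between (lt_min hx hy)
  have hpos := (isBigO_log_kernelNum hδ (hδ'.trans_le (min_le_left _ _))
    (hδ'.trans_le (min_le_right _ _)) 0).1
  have h1 := ((hasExpansion_log_kernelNum h hx hy).exp tendsto_inv_atTop_zero inv_ne_zero_atTop
    fun _ => by rw [exponentTail, coeff_mk, if_pos rfl]).isBigO m
  have hz : ∀ (N : ℝ) (k : ℕ), N⁻¹ ^ k = N ^ (-(k : ℤ)) := fun N k => by
    rw [zpow_neg, zpow_natCast, inv_pow]
  refine h1.congr' ?_ (Eventually.of_forall fun N => hz N m)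
  filter_upwards [hpos, eventually_gt_atTop 0] with N hN hN0
  have hN2 : N ^ (2 / 3 : ℝ) ≠ 0 := (Real.rpow_pos_of_pos hN0 _).ne'
  have hsub := sub_ne_zero.2 hxy
  simp only [hz, expTail]
  congr 1
  rw [Real.exp_sub, Real.exp_log hN, kernelNum, airyKernel, ← mul_sub]
  field_simp

end AiryFormal

end

theorem mainTheorem5 :
    (∃ ω : ℕ → (n : ℕ) → (Fin n → ℝ) → ℝ, IsTopologicalExpansion ω) ∧
    ∀ ω : ℕ → (n : ℕ) → (Fin n → ℝ) → ℝ, IsTopologicalExpansion ω →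
      ∀ x y : ℝ, 0 < x → 0 < y → x ≠ y →
        HasAsymptoticSeries
          (fun N : ℝ =>
            N ^ (2 / 3 : ℝ) * airyKernel (N ^ (2 / 3 : ℝ) * x) (N ^ (2 / 3 : ℝ) * y) /
              (1 / (x - y) * Real.exp (N * exponentCoeff ω x y 0 + exponentCoeff ω x y 1)))
          (fun k => PowerSeries.coeff k (expTail ω x y)) :=
  ⟨⟨_, AiryFormal.isTopologicalExpansion_corr⟩, fun _ hω _ _ hx hy hxy =>
    AiryFormal.hasAsymptoticSeries_airyKernel hω hx hy hxy⟩
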